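/- Let $p$ be a prime, $k$ an algebraic closure of $\mathbb{F}_p$, $G=\mathrm{GL}_2(\mathbb{Q}_p)$, $K=\mathrm{GL}_2(\mathbb{Z}_p)$, $\alpha=\mathrm{diag}(1,p)$, $\beta=\mathrm{diag}(p,p)$. Let $N\ge 1$ be prime to $p$, let $U_N\subseteq\prod_{\ell\mid N}\mathrm{GL}_2(\mathbb{Q}_\ell)$ be a compact open subgroup, and put $U^p=\prod_{\ell\nmid pN}\mathrm{GL}_2(\mathbb{Z}_\ell)\times U_N\subseteq\mathrm{GL}_2(\mathbb{A}^{p\infty})$. Write $\mathrm{GL}_2(\mathbb{R})^\circ$ for the matrices of positive determinant, and for a representation $M$ of $K$ (resp. $\pi$ of $G$), on which the factors other than $K$ (resp. $G$) act trivially, let $$H_n(U^pK,M)=\mathrm{Tor}_n^{k[\mathrm{GL}_2(\mathbb{Q})\times U^p\times K\times \mathrm{GL}_2(\mathbb{R})^\circ]}(k[\mathrm{GL}_2(\mathbb{A})],M),\qquad H_n(U^p,\pi)=\mathrm{Tor}_n^{k[\mathrm{GL}_2(\mathbb{Q})\times U^p\times G\times \mathrm{GL}_2(\mathbb{R})^\circ]}(k[\mathrm{GL}_2(\mathbb{A})],\pi).$$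 Both carry actions of the Hecke operators $T_\ell$, $S_\ell$ (double cosets of $\mathrm{diag}(1,\ell)$ and $\mathrm{diag}(\ell,\ell)$) for the primes $\ell\nmid pN$. Let $\omega\colon\mathbb{Q}_p^\times\to\mathbb{F}_p^\times$, $x\mapsto x|x| \bmod p$, and for $b\in k^\times$ let $\mathrm{unr}_b\colon\mathbb{Q}_p^\times\to k^\times$ be the unramified character with $p\mapsto b$; characters are viewed as characters of $G$ and $K$ through the determinant. Let $0\le r\le p-1$. The representation $\mathrm{Sym}^r(k^2)^\vee$ of $K$ extends to the monoid of inverses of the integral matrices in $G$, and also to $KZ$ ($Z$ the centre of $G$) with $\beta$ acting trivially. For $s\in\mathbb{Z}$, the double cosets of $\alpha$ (for the first extension) and of $\beta$ (for the second) define commuting operators $T$, $S$ on $H_n(U^pK,\mathrm{Sym}^r(k^2)^\vee\otimes\omega^s)$, and, for a commutative $k$-algebra $R$, on $\mathrm{cInd}_K^G(\mathrm{Sym}^r(k^2)^\vee\otimes\omega^s\otimes_k R)$, where $T[g,v]=\sum_{x\in K/(K\cap\alpha K\alpha^{-1})}[gx\alpha,\alpha^{-1}x^{-1}v]$ and $S[g,v]=[\beta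 g,v]$. For $\tau\in R$, $\sigma\in R^\times$ put $$\tilde\pi(r,\tau,\sigma,s)_R=\frac{\mathrm{cInd}_K^G(\mathrm{Sym}^r(k^2)^\vee\otimes\omega^s\otimes_kR)}{(T-\tau,S-\sigma)},$$ and for $\lambda\in k$ and a character $\chi\colon\mathbb{Q}_p^\times\to k^\times$ put $\pi(r,\lambda,\chi)=\frac{\mathrm{cInd}_K^G(\mathrm{Sym}^r(k^2)^\vee)}{(T-\lambda,S-1)}\otimes\chi\omega^r$. **Proposition.** (1) For every commutative $k$-algebra $R$ and all $\tau\in R$, $\sigma\in R^\times$, $s\in\mathbb{Z}$, there is a first quadrant homological spectral sequence $$E^2_{i,j}=\mathrm{Tor}_i^{k[T,S]}\!\left(\frac{R[T,S]}{(T-\tau,S-\sigma)},\,H_j(U^pK,\mathrm{Sym}^r(k^2)^\vee\otimes\omega^s)\right)\Longrightarrow H_{i+j}(U^p,\tilde\pi(r,\tau,\sigma,s)_R)$$ of $R$-modules, compatible with the Hecke operators $T_\ell$, $S_\ell$ for all primes $\ell\nmid pN$. (2) In particular, for all $\lambda\in k$, $a\in\mathbb{Z}$ and $b\in k^\times$,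 there is a first quadrant homological spectral sequence $$E^2_{i,j}=\mathrm{Tor}_i^{k[T,S]}\!\left(\frac{k[T,S]}{(T-\lambda b,S-b^2)},\,H_j(U^pK,\mathrm{Sym}^r(k^2)^\vee\otimes\omega^{a+r})\right)\Longrightarrow H_{i+j}(U^p,\pi(r,\lambda,\omega^a\,\mathrm{unr}_b))$$ of $k$-vector spaces, compatible with the Hecke operators $T_\ell$, $S_\ell$ for all primes $\ell\nmid pN$. -/

import Mathlib

open CategoryTheory
open scoped RestrictedProduct TensorProduct

universe u

namespace PArith

noncomputable section

section Coinvariants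

variable {A : Type u} [CommRing A] {P H Y Y' Y'' : Type} [Group P] [Group H]
  {M : Type u} [AddCommGroup M] [Module A M]

/-- Let the group `P` act on the set `Y`, let `j : H → P` be a homomorphism and `ρ` a representation
of `H` on an `A`-module `M`. This is the diagonal representation of `H` on
`A[Y] ⊗_A M`, written as the module of finitely supported functions `Y → M`. -/
def diagRep (j : H →* P) (act : P →* Equiv.Perm Y) (ρ : Representation A H M) :
    Representation A H (Y →₀ M) where
  toFun h := Finsupp.lmapDomain M A (act (j h)) ∘ₗ Finsupp.mapRange.linearMap (ρ h)
  map_one' := by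
    ext y m : 2
    simp
  map_mul' h h' := by
    ext y m : 2
    simp

/-- The `H`-coinvariants of `A[Y] ⊗_A M`, that is `A[Y] ⊗_{A[H]} M`. -/
abbrev Chains (j : H →* P) (act : P →* Equiv.Perm Y) (ρ : Representation A H M) : Type u :=
  (diagRep j act ρ).Coinvariants

/-- `cls y m` is the class of `y ⊗ m` in `A[Y] ⊗_{A[H]} M`. -/
def cls (j : H →* P) (act : P →* Equiv.Perm Y) (ρ : Representation A H M) (y : Y) :
    M →ₗ[A] Chains j act ρ :=
  Representation.Coinvariants.mk (diagRep j act ρ) ∘ₗ Finsupp.lsingle y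

variable {j : H →* P} {act : P →* Equiv.Perm Y} {act' : P →* Equiv.Perm Y'}
  {act'' : P →* Equiv.Perm Y''} {ρ : Representation A H M}

theorem cls_smul (h : H) (y : Y) (m : M) :
    cls j act ρ (act (j h) y) (ρ h m) = cls j act ρ y m := by
  have := Representation.Coinvariants.mk_self_apply (diagRep j act ρ) h (Finsupp.single y m)
  have e : diagRep j act ρ h (Finsupp.single y m) = Finsupp.single (act (j h) y) (ρ h m) := by
    simp [diagRep]
  rwa [e] at this

theorem chains_ext {W : Type u} [AddCommGroup W] [Module A W] {f f' : Chains j act ρ →ₗ[A] W}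
    (h : ∀ y m, f (cls j act ρ y m) = f' (cls j act ρ y m)) : f = f' := by
  apply Representation.Coinvariants.hom_ext
  ext y m
  exact h y m

/-- The universal property of `A[Y] ⊗_{A[H]} M`. -/
def liftChains {W : Type u} [AddCommGroup W] [Module A W] (F : Y → M →ₗ[A] W)
    (hF : ∀ (h : H) (y : Y) (m : M), F (act (j h) y) (ρ h m) = F y m) :
    Chains j act ρ →ₗ[A] W :=
  Representation.Coinvariants.lift (diagRep j act ρ) (Finsupp.lsum A F) fun h => by
    ext y m
    simp [diagRep, hF]

@[simp]
theorem liftChains_cls {W : Type u} [AddCommGroup W] [Module A W] (F : Y → M →ₗ[A] W)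
    (hF : ∀ (h : H) (y : Y) (m : M), F (act (j h) y) (ρ h m) = F y m) (y : Y) (m : M) :
    liftChains F hF (cls j act ρ y m) = F y m := by
  simp [liftChains, cls]

/-- The map `y ⊗ m ↦ f(y) ⊗ m` induced by a `P`-equivariant map `f`. -/
def mapChains (ρ : Representation A H M) (j : H →* P) (f : Y → Y')
    (hf : ∀ z y, f (act z y) = act' z (f y)) : Chains j act ρ →ₗ[A] Chains j act' ρ :=
  liftChains (fun y => cls j act' ρ (f y)) fun h y m => by rw [hf, cls_smul]

@[simp]
theorem mapChains_cls (f : Y → Y') (hf : ∀ z y, f (act z y) = act' z (f y)) (y : Y) (m : M) :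
    mapChains ρ j f hf (cls j act ρ y m) = cls j act' ρ (f y) m := by
  simp [mapChains]

/-- The data defining a Hecke operator: an element `g` of `P`, and a linear map `φ` giving the action
of `g⁻¹` on the coefficients, compatible with the action of `H`. -/
structure HeckeDatum (j : H →* P) (ρ : Representation A H M) where
  /-- the element `g` -/
  g : P
  /-- the action of `g⁻¹` on `M` -/
  φ : M →ₗ[A] M
  compat : ∀ x x' : H, j x * g = g * j x' → ∀ m, φ (ρ x m) = ρ x' (φ m)

namespace HeckeDatum

/-- The subgroup `H ∩ g H g⁻¹` of `H`. -/
def stab (D : HeckeDatum j ρ) : Subgroup H :=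
  ((MulAut.conj D.g).toMonoidHom.comp j).range.comap j

theorem mem_stab (D : HeckeDatum j ρ) (x : H) :
    x ∈ D.stab ↔ ∃ x', j x * D.g = D.g * j x' := by
  simp only [stab, Subgroup.mem_comap, MonoidHom.mem_range, MonoidHom.comp_apply,
    MulEquiv.coe_toMonoidHom, MulAut.conj_apply]
  refine exists_congr fun x' => ?_
  rw [mul_inv_eq_iff_eq_mul, eq_comm]

/-- The term `y x g ⊗ g⁻¹ x⁻¹ m` of the Hecke operator indexed by `x`, where `y x g` denotes
the action of `(x g)⁻¹` on `y`. It only depends on the class of `x` in `H / (H ∩ g H g⁻¹)`. -/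
def term (act : P →* Equiv.Perm Y) (D : HeckeDatum j ρ) (y : Y) (q : H ⧸ D.stab) :
    M →ₗ[A] Chains j act ρ :=
  Quotient.liftOn' q (fun x => cls j act ρ (act (j x * D.g)⁻¹ y) ∘ₗ D.φ ∘ₗ ρ x⁻¹) (by
    intro x₁ x₂ h
    rw [QuotientGroup.leftRel_apply, mem_stab] at h
    obtain ⟨x', hx'⟩ := h
    ext m
    have h1 : j x₂ * D.g = j x₁ * D.g * j x' := by
      rw [mul_assoc, ← hx', map_mul, map_inv]
      group
    have h2 : ρ x₂⁻¹ m = ρ (x₁⁻¹ * x₂)⁻¹ (ρ x₁⁻¹ m) := by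
      rw [← Module.End.mul_apply, ← map_mul]
      congr 2
      group
    have h3 : j (x₁⁻¹ * x₂)⁻¹ * D.g = D.g * j x'⁻¹ := by
      rw [map_inv, map_inv, inv_mul_eq_iff_eq_mul, ← mul_assoc, hx']
      group
    simp only [LinearMap.comp_apply]
    rw [h2, D.compat _ _ h3, h1, mul_inv_rev (j x₁ * D.g), ← map_inv j, map_mul act (j x'⁻¹),
      Equiv.Perm.mul_apply, cls_smul])

theorem term_mk (D : HeckeDatum j ρ) (y : Y) (x : H) (m : M) :
    D.term act y (x : H ⧸ D.stab) m = cls j act ρ (act (j x * D.g)⁻¹ y) (D.φ (ρ x⁻¹ m)) :=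
  rfl

theorem term_smul (D : HeckeDatum j ρ) (h : H) (y : Y) (q : H ⧸ D.stab) (m : M) :
    D.term act (act (j h) y) (h • q) (ρ h m) = D.term act y q m := by
  induction q using QuotientGroup.induction_on with | H x => ?_
  have e : h • (x : H ⧸ D.stab) = ((h * x : H) : H ⧸ D.stab) := rfl
  have e2 : ρ (h * x)⁻¹ (ρ h m) = ρ x⁻¹ m := by
    rw [← Module.End.mul_apply, ← map_mul]
    congr 2
    group
  have e3 : act (j (h * x) * D.g)⁻¹ (act (j h) y) = act (j x * D.g)⁻¹ y := by
    rw [← Equiv.Perm.mul_apply, ← map_mul]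
    congr 2
    rw [map_mul]
    group
  rw [e, term_mk, term_mk, e2, e3]

open Classical in
/-- The Hecke operator
`y ⊗ m ↦ ∑ y x g ⊗ g⁻¹ x⁻¹ m`, the sum being over `x ∈ H / (H ∩ g H g⁻¹)` (which is finite
whenever `g` lies in the commensurator of `H`). -/
def op (act : P →* Equiv.Perm Y) (D : HeckeDatum j ρ) : Chains j act ρ →ₗ[A] Chains j act ρ :=
  if hfin : Finite (H ⧸ D.stab) then
    letI := Fintype.ofFinite (H ⧸ D.stab)
    liftChains (fun y => ∑ q : H ⧸ D.stab, D.term act y q) fun h y m => by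
      simp only [LinearMap.sum_apply]
      refine (Fintype.sum_equiv (MulAction.toPerm h) _ _ fun q => ?_).symm
      exact (D.term_smul h y q m).symm
  else 0

theorem op_cls (D : HeckeDatum j ρ) [Fintype (H ⧸ D.stab)] (y : Y) (m : M) :
    D.op act (cls j act ρ y m) = ∑ q : H ⧸ D.stab, D.term act y q m := by
  have hfin : Finite (H ⧸ D.stab) := inferInstance
  rw [op, dif_pos hfin, liftChains_cls, LinearMap.sum_apply]
  congr!

theorem op_eq_zero (D : HeckeDatum j ρ) (h : ¬ Finite (H ⧸ D.stab)) : D.op act = 0 :=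
  dif_neg h

theorem mapChains_op (D : HeckeDatum j ρ) (f : Y → Y')
    (hf : ∀ z y, f (act z y) = act' z (f y)) :
    mapChains ρ j f hf ∘ₗ D.op act = D.op act' ∘ₗ mapChains ρ j f hf := by
  by_cases hfin : Finite (H ⧸ D.stab)
  · let _ := Fintype.ofFinite (H ⧸ D.stab)
    apply chains_ext
    intro y m
    simp only [LinearMap.comp_apply, op_cls, mapChains_cls, map_sum]
    refine Finset.sum_congr rfl fun q _ => ?_
    induction q using QuotientGroup.induction_on with | H x => ?_
    rw [term_mk, term_mk, mapChains_cls, hf]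
  · rw [op_eq_zero D hfin, op_eq_zero D hfin, LinearMap.comp_zero, LinearMap.zero_comp]

/-- Hecke operators at different places commute. -/
theorem op_comm (D E : HeckeDatum j ρ) (S₁ S₂ : Subgroup H)
    (h₁ : ∀ x : H, ∃ s ∈ S₁, x⁻¹ * s ∈ D.stab) (h₂ : ∀ x : H, ∃ s ∈ S₂, x⁻¹ * s ∈ E.stab)
    (hc : ∀ s ∈ S₁, ∀ t ∈ S₂, Commute (j s * D.g) (j t * E.g))
    (hφ : ∀ s ∈ S₁, ∀ t ∈ S₂, ∀ m, D.φ (ρ s⁻¹ (E.φ (ρ t⁻¹ m))) = E.φ (ρ t⁻¹ (D.φ (ρ s⁻¹ m)))) :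
    D.op act ∘ₗ E.op act = E.op act ∘ₗ D.op act := by
  by_cases hD : Finite (H ⧸ D.stab)
  swap
  · rw [op_eq_zero D hD, LinearMap.comp_zero, LinearMap.zero_comp]
  by_cases hE : Finite (H ⧸ E.stab)
  swap
  · rw [op_eq_zero E hE, LinearMap.comp_zero, LinearMap.zero_comp]
  let _ := Fintype.ofFinite (H ⧸ D.stab)
  let _ := Fintype.ofFinite (H ⧸ E.stab)
  have k₁ : ∀ q : H ⧸ D.stab, ∃ s ∈ S₁, (s : H ⧸ D.stab) = q := fun q => by
    induction q using QuotientGroup.induction_on with | H x => ?_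
    obtain ⟨s, hs, h⟩ := h₁ x
    exact ⟨s, hs, (QuotientGroup.eq.2 h).symm⟩
  have k₂ : ∀ q : H ⧸ E.stab, ∃ s ∈ S₂, (s : H ⧸ E.stab) = q := fun q => by
    induction q using QuotientGroup.induction_on with | H x => ?_
    obtain ⟨s, hs, h⟩ := h₂ x
    exact ⟨s, hs, (QuotientGroup.eq.2 h).symm⟩
  choose s hs hs' using k₁
  choose t ht ht' using k₂
  have tD : ∀ y q m, D.term act y q m =
      cls j act ρ (act (j (s q) * D.g)⁻¹ y) (D.φ (ρ (s q)⁻¹ m)) := fun y q m => by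
    conv_lhs => rw [← hs' q, term_mk]
  have tE : ∀ y q m, E.term act y q m =
      cls j act ρ (act (j (t q) * E.g)⁻¹ y) (E.φ (ρ (t q)⁻¹ m)) := fun y q m => by
    conv_lhs => rw [← ht' q, term_mk]
  apply chains_ext
  intro y m
  simp only [LinearMap.comp_apply, op_cls, map_sum, tD, tE]
  rw [Finset.sum_comm]
  refine Finset.sum_congr rfl fun a _ => Finset.sum_congr rfl fun b _ => ?_
  rw [hφ _ (hs _) _ (ht _), ← Equiv.Perm.mul_apply, ← Equiv.Perm.mul_apply, ← map_mul, ← map_mul,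
    ← mul_inv_rev, ← mul_inv_rev, (hc _ (hs a) _ (ht b)).eq]

end HeckeDatum

/-- For a central element `z` of `P`, acting trivially on the coefficients, the double coset of `z`
is a single coset and its Hecke operator is `y ⊗ m ↦ y z ⊗ m`. -/
def centralOp (j : H →* P) (act : P →* Equiv.Perm Y) (ρ : Representation A H M) (z : P)
    (hz : ∀ w, z * w = w * z) : Chains j act ρ →ₗ[A] Chains j act ρ :=
  mapChains ρ j (act z⁻¹) fun w y => by
    have h : z⁻¹ * w = w * z⁻¹ := by
      rw [inv_mul_eq_iff_eq_mul, ← mul_assoc, hz w, mul_inv_cancel_right]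
    rw [← Equiv.Perm.mul_apply, ← Equiv.Perm.mul_apply, ← map_mul, ← map_mul, h]

theorem mapChains_comp (ρ : Representation A H M) (j : H →* P) (f : Y → Y')
    (hf : ∀ z y, f (act z y) = act' z (f y)) (f' : Y' → Y'')
    (hf' : ∀ z y, f' (act' z y) = act'' z (f' y)) (f'' : Y → Y'')
    (hf'' : ∀ z y, f'' (act z y) = act'' z (f'' y)) (h : ∀ y, f' (f y) = f'' y) :
    mapChains ρ j f' hf' ∘ₗ mapChains ρ j f hf = mapChains ρ j f'' hf'' := by
  apply chains_ext
  intro y m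
  simp [h]

theorem mapChains_id (ρ : Representation A H M) (j : H →* P) (f : Y → Y)
    (hf : ∀ z y, f (act z y) = act z (f y)) (h : ∀ y, f y = y) :
    mapChains ρ j f hf = LinearMap.id := by
  apply chains_ext
  intro y m
  simp [h]

theorem mapChains_centralOp (z : P) (hz : ∀ w, z * w = w * z) (f : Y → Y')
    (hf : ∀ z y, f (act z y) = act' z (f y)) :
    mapChains ρ j f hf ∘ₗ centralOp j act ρ z hz = centralOp j act' ρ z hz ∘ₗ mapChains ρ j f hf := by
  apply chains_ext
  intro y m
  simp only [centralOp, LinearMap.comp_apply, mapChains_cls, hf]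

theorem centralOp_comm (z : P) (hz : ∀ w, z * w = w * z) (z' : P) (hz' : ∀ w, z' * w = w * z') :
    centralOp j act ρ z hz ∘ₗ centralOp j act ρ z' hz' =
      centralOp j act ρ z' hz' ∘ₗ centralOp j act ρ z hz :=
  mapChains_centralOp z' hz' _ _

theorem op_centralOp (D : HeckeDatum j ρ) (z : P) (hz : ∀ w, z * w = w * z) :
    D.op act ∘ₗ centralOp j act ρ z hz = centralOp j act ρ z hz ∘ₗ D.op act :=
  (D.mapChains_op _ _).symm

end Coinvariants

section Local

/-- The diagonal matrix `diag(a, b)`. -/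
def diagGL {R : Type} [CommRing R] (a b : Rˣ) : GL (Fin 2) R where
  val := Matrix.diagonal ![(a : R), (b : R)]
  inv := Matrix.diagonal ![((a⁻¹ : Rˣ) : R), ((b⁻¹ : Rˣ) : R)]
  val_inv := by
    rw [Matrix.diagonal_mul_diagonal, ← Matrix.diagonal_one]
    congr 1
    ext i
    fin_cases i <;> simp
  inv_val := by
    rw [Matrix.diagonal_mul_diagonal, ← Matrix.diagonal_one]
    congr 1
    ext i
    fin_cases i <;> simp

theorem diagGL_central {R : Type} [CommRing R] (a : Rˣ) (g : GL (Fin 2) R) :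
    diagGL a a * g = g * diagGL a a := by
  ext i j
  fin_cases i <;> fin_cases j <;> simp [diagGL, Matrix.mul_apply, mul_comm]

variable (p : ℕ) [Fact p.Prime]

/-- The unit `p` of `ℚ_p`. -/
def pUnit : ℚ_[p]ˣ :=
  Units.mk0 (p : ℚ_[p]) (Nat.cast_ne_zero.2 (Fact.out : p.Prime).ne_zero)

/-- `α = diag(1, p)`. -/
def alpha : GL (Fin 2) ℚ_[p] := diagGL 1 (pUnit p)

/-- `β = diag(p, p)`. -/
def beta : GL (Fin 2) ℚ_[p] := diagGL (pUnit p) (pUnit p)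

/-- The inclusion of `K = GL₂(ℤ_p)` into `G = GL₂(ℚ_p)`. -/
def inclK : GL (Fin 2) ℤ_[p] →* GL (Fin 2) ℚ_[p] :=
  Matrix.GeneralLinearGroup.map (algebraMap ℤ_[p] ℚ_[p])

/-- The unit part `x ↦ x |x|` of an element of `ℚ_p^×`, where `|p| = 1 / p`. -/
def unitPart (x : ℚ_[p]ˣ) : ℤ_[p] :=
  ⟨(x : ℚ_[p]) * (p : ℚ_[p]) ^ (-(x : ℚ_[p]).valuation), by
    rw [norm_mul, norm_zpow, Padic.norm_p, Padic.norm_eq_zpow_neg_valuation x.ne_zero, inv_zpow,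
      zpow_neg, inv_inv, inv_mul_cancel₀]
    exact zpow_ne_zero _ (Nat.cast_ne_zero.2 (Fact.out : p.Prime).ne_zero)⟩

variable (k : Type u) [Field k] [Algebra (ZMod p) k]

/-- The character `ω : ℚ_p^× → 𝔽_p^× ⊆ k^×`, `x ↦ x |x| mod p`. -/
def omega : ℚ_[p]ˣ →* kˣ :=
  MonoidHom.toHomUnits
    { toFun := fun x => algebraMap (ZMod p) k (PadicInt.toZMod (unitPart p x))
      map_one' := by
        have : unitPart p 1 = 1 := by
          apply Subtype.ext
          simp [unitPart]
        rw [this, map_one, map_one]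
      map_mul' := fun x y => by
        have : unitPart p (x * y) = unitPart p x * unitPart p y := by
          apply Subtype.ext
          have hp : (p : ℚ_[p]) ≠ 0 := Nat.cast_ne_zero.2 (Fact.out : p.Prime).ne_zero
          change ((x * y : ℚ_[p]ˣ) : ℚ_[p]) * (p : ℚ_[p]) ^ (-((x * y : ℚ_[p]ˣ) : ℚ_[p]).valuation) =
            (x * (p : ℚ_[p]) ^ (-(x : ℚ_[p]).valuation)) *
              (y * (p : ℚ_[p]) ^ (-(y : ℚ_[p]).valuation))
          rw [Units.val_mul, Padic.valuation_mul x.ne_zero y.ne_zero, neg_add, zpow_add₀ hp]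
          ring
        rw [this, map_mul, map_mul] }

variable {k} in
/-- The unramified character of `ℚ_p^×` sending `p` to `b`. -/
def unr (b : kˣ) : ℚ_[p]ˣ →* kˣ where
  toFun x := b ^ (x : ℚ_[p]).valuation
  map_one' := by simp
  map_mul' x y := by
    rw [Units.val_mul, Padic.valuation_mul x.ne_zero y.ne_zero, zpow_add]

/-- `Sym^r(k²)`, as the space of homogeneous polynomials of degree `r` in the standard basis
`X 0, X 1` of `k²`. -/
abbrev SymPow (k : Type u) [Field k] (r : ℕ) : Type u :=
  MvPolynomial.homogeneousSubmodule (Fin 2) k r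

/-- The action of the monoid of `2 × 2` matrices over `k` on `Sym^r(k²)`, induced by the
standard action `e_j ↦ ∑ i, a_{ij} e_i` on `k²`. -/
def symAction (k : Type u) [Field k] (r : ℕ) :
    Matrix (Fin 2) (Fin 2) k →* Module.End k (SymPow k r) where
  toFun a := (MvPolynomial.aeval (R := k)
    fun j : Fin 2 => ∑ i, a i j • (MvPolynomial.X i : MvPolynomial (Fin 2) k)).toLinearMap.restrict
      (p := MvPolynomial.homogeneousSubmodule (Fin 2) k r)
      (q := MvPolynomial.homogeneousSubmodule (Fin 2) k r) fun f hf => by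
        rw [MvPolynomial.mem_homogeneousSubmodule] at hf ⊢
        have h : ∀ j : Fin 2, (∑ i, a i j • (MvPolynomial.X i : MvPolynomial (Fin 2) k)).IsHomogeneous
            1 := fun j => by
          refine MvPolynomial.IsHomogeneous.sum _ _ _ fun i _ => ?_
          rw [MvPolynomial.smul_eq_C_mul]
          exact (MvPolynomial.isHomogeneous_X k i).C_mul _
        simpa using hf.aeval _ h
  map_one' := by
    ext f : 2
    change MvPolynomial.aeval (R := k) (fun j : Fin 2 => ∑ i, (1 : Matrix (Fin 2) (Fin 2) k) i j •
        (MvPolynomial.X i : MvPolynomial (Fin 2) k)) f.1 = f.1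
    have : (fun j : Fin 2 => ∑ i, (1 : Matrix (Fin 2) (Fin 2) k) i j •
        (MvPolynomial.X i : MvPolynomial (Fin 2) k)) = MvPolynomial.X := by
      ext1 j
      fin_cases j <;> simp [Matrix.one_apply]
    rw [this, MvPolynomial.aeval_X_left_apply]
  map_mul' a b := by
    ext f : 2
    change MvPolynomial.aeval (R := k) (fun j : Fin 2 => ∑ i, (a * b) i j •
        (MvPolynomial.X i : MvPolynomial (Fin 2) k)) f.1 =
      MvPolynomial.aeval (R := k) (fun j : Fin 2 => ∑ i, a i j •
        (MvPolynomial.X i : MvPolynomial (Fin 2) k))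
        (MvPolynomial.aeval (R := k) (fun j : Fin 2 => ∑ i, b i j •
        (MvPolynomial.X i : MvPolynomial (Fin 2) k)) f.1)
    rw [← AlgHom.comp_apply, MvPolynomial.comp_aeval]
    congr 2
    ext1 j
    simp only [Fin.sum_univ_two, map_add, map_smul, MvPolynomial.aeval_X, Matrix.mul_apply,
      smul_add, add_smul, smul_smul]
    simp only [mul_comm (b _ j)]
    abel

/-- Reduction of matrices modulo `p`. -/
def reduceMat : Matrix (Fin 2) (Fin 2) ℤ_[p] →* Matrix (Fin 2) (Fin 2) k :=
  (((algebraMap (ZMod p) k).comp PadicInt.toZMod).mapMatrix :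
    Matrix (Fin 2) (Fin 2) ℤ_[p] →+* Matrix (Fin 2) (Fin 2) k).toMonoidHom

/-- The underlying space of the Serre weight `Sym^r(k²)^∨ ⊗ ω^s`. -/
abbrev Weight (k : Type u) [Field k] (r : ℕ) : Type u := Module.Dual k (SymPow k r)

/-- The representation `Sym^r(k²)^∨ ⊗ ω^s` of `K`. -/
def weightRep (r : ℕ) (s : ℤ) : Representation k (GL (Fin 2) ℤ_[p]) (Weight k r) where
  toFun x := (((omega p k ^ s) (inclK p x).det : kˣ) : k) •
    Module.Dual.transpose (symAction k r (reduceMat p k (x⁻¹ : GL (Fin 2) ℤ_[p])))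
  map_one' := by
    ext f v
    simp [Module.Dual.transpose_apply]
  map_mul' x y := by
    ext f v
    simp only [map_mul, Units.val_mul, mul_inv_rev, Module.End.mul_apply, LinearMap.smul_apply,
      map_smul, Module.Dual.transpose_apply, LinearMap.comp_apply, mul_smul]
    rw [smul_comm]

/-- The matrix `α = diag(1, p)` over `ℤ_p`. -/
def alphaInt : Matrix (Fin 2) (Fin 2) ℤ_[p] := Matrix.diagonal ![1, (p : ℤ_[p])]

/-- The action of `α⁻¹` on `Sym^r(k²)^∨ ⊗ ω^s` as an element of the monoid `G⁻` of inverses of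
integral matrices: it is the transpose of the action of the matrix `α` on `Sym^r(k²)`
(note that `ω(det α) = ω(p) = 1`). -/
def weightAlpha (r : ℕ) : Module.End k (Weight k r) :=
  Module.Dual.transpose (symAction k r (reduceMat p k (alphaInt p)))

theorem weight_compat (r : ℕ) (s : ℤ) (x x' : GL (Fin 2) ℤ_[p])
    (h : inclK p x * alpha p = alpha p * inclK p x') (m : Weight k r) :
    weightAlpha p k r (weightRep p k r s x m) = weightRep p k r s x' (weightAlpha p k r m) := by
  have hdet : (inclK p x).det = (inclK p x').det := by
    have := congrArg Matrix.GeneralLinearGroup.det h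
    rw [map_mul, map_mul, mul_comm] at this
    exact mul_left_cancel this
  have hmat : (x : Matrix (Fin 2) (Fin 2) ℤ_[p]) * alphaInt p = alphaInt p * x' := by
    have hinj : Function.Injective
        ((algebraMap ℤ_[p] ℚ_[p]).mapMatrix : Matrix (Fin 2) (Fin 2) ℤ_[p] →+* _) :=
      Matrix.map_injective (IsFractionRing.injective ℤ_[p] ℚ_[p])
    apply hinj
    have hα : (algebraMap ℤ_[p] ℚ_[p]).mapMatrix (alphaInt p) = (alpha p : Matrix _ _ ℚ_[p]) := by
      ext i j
      fin_cases i <;> fin_cases j <;> simp [alphaInt, alpha, diagGL, pUnit]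
    rw [map_mul, map_mul, hα]
    exact congrArg Units.val h
  have hmat2 : ((x⁻¹ : GL (Fin 2) ℤ_[p]) : Matrix (Fin 2) (Fin 2) ℤ_[p]) * alphaInt p =
      alphaInt p * (x'⁻¹ : GL (Fin 2) ℤ_[p]) := by
    rw [Units.inv_mul_eq_iff_eq_mul, ← mul_assoc, hmat, mul_assoc, Units.mul_inv, mul_one]
  ext v
  simp only [weightRep, weightAlpha, MonoidHom.coe_mk, OneHom.coe_mk, LinearMap.smul_apply, map_smul,
    hdet, Module.Dual.transpose_apply, LinearMap.comp_apply]
  rw [← Module.End.mul_apply, ← Module.End.mul_apply, ← map_mul, ← map_mul, ← map_mul, ← map_mul,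
    hmat2]

end Local

section BaseChange

variable {A : Type u} [CommRing A] {P H : Type} [Group P] [Group H]
  {j : H →* P}
  {M : Type u} [AddCommGroup M] [Module A M]

/-- The base change `M ⊗_A R` of a representation on `M`. -/
def baseChangeRep (R : Type u) [CommRing R] [Algebra A R] (ρ : Representation A H M) :
    Representation R H (R ⊗[A] M) :=
  ((Module.End.baseChangeHom A R M : Module.End A M →ₐ[A] Module.End R (R ⊗[A] M)) :
    Module.End A M →* Module.End R (R ⊗[A] M)).comp ρ

/-- Base change of the data defining a Hecke operator. -/
def HeckeDatum.baseChange (R : Type u) [CommRing R] [Algebra A R] {ρ : Representation A H M}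
    (D : HeckeDatum j ρ) : HeckeDatum j (baseChangeRep R ρ) where
  g := D.g
  φ := D.φ.baseChange R
  compat x x' h m := by
    have e : D.φ ∘ₗ ρ x = ρ x' ∘ₗ D.φ := LinearMap.ext (D.compat x x' h)
    change (D.φ.baseChange R ∘ₗ (ρ x).baseChange R) m = ((ρ x').baseChange R ∘ₗ D.φ.baseChange R) m
    rw [← LinearMap.baseChange_comp, ← LinearMap.baseChange_comp, e]

end BaseChange

section Induction

variable (p : ℕ) [Fact p.Prime] {A : Type u} [CommRing A] {M : Type u} [AddCommGroup M]
  [Module A M] {ρ : Representation A (GL (Fin 2) ℤ_[p]) M}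

/-- A group acting on itself by `z • y = y z⁻¹`. -/
def rightAct (G : Type) [Group G] : G →* Equiv.Perm G where
  toFun z := Equiv.mulRight z⁻¹
  map_one' := by
    ext
    simp
  map_mul' z w := by
    ext
    simp [mul_assoc]

theorem mul_rightAct {G : Type} [Group G] (h z g : G) :
    h * rightAct G z g = rightAct G z (h * g) :=
  (mul_assoc h g z⁻¹).symm

theorem beta_central (g : GL (Fin 2) ℚ_[p]) : beta p * g = g * beta p :=
  diagGL_central _ g

/-- The compact induction `cInd_K^G ρ = A[G] ⊗_{A[K]} ρ`. The class `cls g v` is the element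
`[g, v]` supported on `gK` and with value `v` at `g`, so that `[g k, v] = [g, ρ(k) v]`. -/
abbrev CInd (ρ : Representation A (GL (Fin 2) ℤ_[p]) M) : Type u :=
  Chains (inclK p) (rightAct (GL (Fin 2) ℚ_[p])) ρ

/-- The action of `G` on the compact induction, `h [g, v] = [h g, v]`. -/
def cIndRep (ρ : Representation A (GL (Fin 2) ℤ_[p]) M) :
    Representation A (GL (Fin 2) ℚ_[p]) (CInd p ρ) where
  toFun h := mapChains ρ (inclK p) (fun g => h * g) (mul_rightAct h)
  map_one' := by
    apply chains_ext
    intro y m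
    rw [mapChains_cls, one_mul, Module.End.one_apply]
  map_mul' h h' := by
    apply chains_ext
    intro y m
    rw [Module.End.mul_apply, mapChains_cls, mapChains_cls, mapChains_cls, mul_assoc]

/-- The Hecke operator `S [g, v] = [β g, v]` on the compact induction. -/
def cIndS (ρ : Representation A (GL (Fin 2) ℤ_[p]) M) : Module.End A (CInd p ρ) :=
  centralOp (inclK p) (rightAct (GL (Fin 2) ℚ_[p])) ρ (beta p) (beta_central p)

/-- The Hecke operator `T [g, v] = ∑_{x ∈ K / (K ∩ α K α⁻¹)} [g x α, α⁻¹ x⁻¹ v]` on the compact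
induction; the datum `D` consists of `α` and of the action of `α⁻¹` on the coefficients. -/
def cIndT (D : HeckeDatum (inclK p) ρ) : Module.End A (CInd p ρ) :=
  D.op (rightAct (GL (Fin 2) ℚ_[p]))

/-- The submodule `(T - τ, S - σ) cInd_K^G ρ`. -/
def eigenSub (D : HeckeDatum (inclK p) ρ) (τ σ : A) : Submodule A (CInd p ρ) :=
  LinearMap.range (cIndT p D - τ • 1) ⊔ LinearMap.range (cIndS p ρ - σ • 1)

/-- The representation of `G` on the quotient `cInd_K^G ρ / (T - τ, S - σ)`. -/
def eigenRep (D : HeckeDatum (inclK p) ρ) (τ σ : A) :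
    Representation A (GL (Fin 2) ℚ_[p]) (CInd p ρ ⧸ eigenSub p D τ σ) :=
  (cIndRep p ρ).quotient (eigenSub p D τ σ) fun h => by
    have hT : cIndRep p ρ h ∘ₗ cIndT p D = cIndT p D ∘ₗ cIndRep p ρ h := D.mapChains_op _ (mul_rightAct h)
    have hS : cIndRep p ρ h ∘ₗ cIndS p ρ = cIndS p ρ ∘ₗ cIndRep p ρ h := 
      mapChains_centralOp _ _ _ (mul_rightAct h)
    refine sup_le ?_ ?_
    · rintro _ ⟨v, rfl⟩
      refine Submodule.mem_sup_left ⟨cIndRep p ρ h v, ?_⟩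
      have := LinearMap.congr_fun hT v
      simp only [LinearMap.comp_apply] at this
      simp [this]
    · rintro _ ⟨v, rfl⟩
      refine Submodule.mem_sup_right ⟨cIndRep p ρ h v, ?_⟩
      have := LinearMap.congr_fun hS v
      simp only [LinearMap.comp_apply] at this
      simp [this]

/-- The twist `g ↦ χ(det g) π(g)` of a representation `π` of `G` by a character `χ`. -/
def twistRep {V : Type u} [AddCommGroup V] [Module A V]
    (π : Representation A (GL (Fin 2) ℚ_[p]) V) (χ : ℚ_[p]ˣ →* Aˣ) :
    Representation A (GL (Fin 2) ℚ_[p]) V where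
  toFun g := ((χ g.det : Aˣ) : A) • π g
  map_one' := by simp
  map_mul' g h := by
    rw [map_mul, map_mul, map_mul, Units.val_mul, smul_mul_smul_comm]

variable (k : Type u) [Field k] [Algebra (ZMod p) k]

/-- `α` together with the action of `α⁻¹` on `Sym^r(k²)^∨ ⊗ ω^s`. -/
def weightDatum (r : ℕ) (s : ℤ) : HeckeDatum (inclK p) (weightRep p k r s) where
  g := alpha p
  φ := weightAlpha p k r
  compat := weight_compat p k r s

/-- The representation
`π̃(r, τ, σ, s)_R = cInd_K^G(Sym^r(k²)^∨ ⊗ ω^s ⊗_k R) / (T - τ, S - σ)` of `G` over `R`. -/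
def piTilde {R : Type u} [CommRing R] [Algebra k R] (r : ℕ) (τ : R) (σ : Rˣ) (s : ℤ) :
    Representation R (GL (Fin 2) ℚ_[p])
      (CInd p (baseChangeRep R (weightRep p k r s)) ⧸
        eigenSub p ((weightDatum p k r s).baseChange R) τ σ) :=
  eigenRep p ((weightDatum p k r s).baseChange R) τ (σ : R)

variable {k}

/-- The representation
`π(r, l, χ) = cInd_K^G(Sym^r(k²)^∨) / (T - l, S - 1) ⊗ χ ω^r` of `G` over `k`. -/
def piRep (r : ℕ) (l : k) (χ : ℚ_[p]ˣ →* kˣ) :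
    Representation k (GL (Fin 2) ℚ_[p])
      (CInd p (weightRep p k r 0) ⧸ eigenSub p (weightDatum p k r 0) l 1) :=
  twistRep p (eigenRep p (weightDatum p k r 0) l 1) (χ * omega p k ^ r)

end Induction

section Adelic

variable (p : ℕ) [Fact p.Prime]

/-- The primes different from `p`. -/
def PrimesAway (p : ℕ) : Type := {l : ℕ // l.Prime ∧ l ≠ p}

instance (l : PrimesAway p) : Fact l.1.Prime := ⟨l.2.1⟩

instance : DecidableEq (PrimesAway p) := Classical.decEq _

/-- The ring `𝔸^{p∞}` of finite adeles of `ℚ` away from `p`: the restricted product of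
the fields `ℚ_l` with respect to `ℤ_l`, for the primes `l ≠ p`. -/
abbrev FinAdele : Type := Πʳ l : PrimesAway p, [ℚ_[l.1], PadicInt.subring l.1]

/-- The diagonal embedding of `ℚ`. -/
def ratDiag : ℚ →+* FinAdele p where
  toFun x := ⟨fun l => (x : ℚ_[l.1]), by
    have hfin : {l : PrimesAway p | l.1 ∣ x.den}.Finite := by
      refine Set.Finite.of_finite_image (f := Subtype.val) ?_ Subtype.val_injective.injOn
      refine (Set.finite_le_nat x.den).subset ?_
      rintro _ ⟨l, hl, rfl⟩
      exact Nat.le_of_dvd x.den_pos hl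
    filter_upwards [hfin.compl_mem_cofinite] with l hl
    exact Padic.norm_rat_le_one hl⟩
  map_one' := by
    ext l
    exact Rat.cast_one
  map_mul' x y := by
    ext l
    exact Rat.cast_mul x y
  map_zero' := by
    ext l
    exact Rat.cast_zero
  map_add' x y := by
    ext l
    exact Rat.cast_add x y

/-- The projection `GL₂(𝔸^{p∞}) → GL₂(ℚ_l)`. -/
def evalGL (l : PrimesAway p) : GL (Fin 2) (FinAdele p) →* GL (Fin 2) ℚ_[l.1] :=
  Matrix.GeneralLinearGroup.map (RestrictedProduct.evalRingHom (fun l : PrimesAway p => ℚ_[l.1]) l)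

/-- The element of `(𝔸^{p∞})^×` equal to `l` at the prime `l` and to `1` at all other primes. -/
def uniformizer (l : PrimesAway p) : (FinAdele p)ˣ where
  val := RestrictedProduct.mulSingle _ l (l.1 : ℚ_[l.1])
  inv := RestrictedProduct.mulSingle _ l ((l.1 : ℚ_[l.1])⁻¹)
  val_inv := by
    rw [← RestrictedProduct.mulSingle_mul, mul_inv_cancel₀, RestrictedProduct.mulSingle_one]
    exact Nat.cast_ne_zero.2 l.2.1.ne_zero
  inv_val := by
    rw [← RestrictedProduct.mulSingle_mul, inv_mul_cancel₀, RestrictedProduct.mulSingle_one]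
    exact Nat.cast_ne_zero.2 l.2.1.ne_zero

/-- The product of the groups `GL₂(ℚ_l)` over the primes `l` dividing `N` (and different from `p`). -/
abbrev LevelGL (N : ℕ) : Type := ∀ l : {l : PrimesAway p // l.1 ∣ N}, GL (Fin 2) ℚ_[l.1.1]

/-- The subgroup `U^p = ∏_{l ∤ N} GL₂(ℤ_l) × U_N` of `GL₂(𝔸^{p∞})`. -/
def levelSubgroup (N : ℕ) (UN : Subgroup (LevelGL p N)) : Subgroup (GL (Fin 2) (FinAdele p)) :=
  (⨅ l : {l : PrimesAway p // ¬ l.1 ∣ N}, (inclK l.1.1).range.comap (evalGL p l.1)) ⊓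
    UN.comap (MonoidHom.pi fun l : {l : PrimesAway p // l.1 ∣ N} => evalGL p l.1)

/-- `GL₂(𝔸) = GL₂(𝔸^{p∞}) × GL₂(ℚ_p) × GL₂(ℝ)`. -/
abbrev AdelicGL : Type := GL (Fin 2) (FinAdele p) × GL (Fin 2) ℚ_[p] × GL (Fin 2) ℝ

/-- `GL₂(ℚ) × GL₂(𝔸^{p∞}) × GL₂(ℚ_p) × GL₂(ℝ)°`. -/
abbrev BigGroup : Type :=
  GL (Fin 2) ℚ × GL (Fin 2) (FinAdele p) × GL (Fin 2) ℚ_[p] × Matrix.GLPos (Fin 2) ℝ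

/-- The set `E^{n+1} × GL₂(𝔸)`, where `E = GL₂(ℚ) × GL₂(ℝ)°`. -/
abbrev ResSet (n : ℕ) : Type :=
  (Fin (n + 1) → GL (Fin 2) ℚ × Matrix.GLPos (Fin 2) ℝ) × AdelicGL p

variable {p} in
/-- The group `GL₂(ℚ) × GL₂(𝔸^{p∞}) × GL₂(ℚ_p) × GL₂(ℝ)°` acts on `E^{n+1} × GL₂(𝔸)` as follows:
it acts on each factor `E = GL₂(ℚ) × GL₂(ℝ)°` by left multiplication through its projection to
`E`, while on `GL₂(𝔸)` the group `GL₂(ℚ)` acts by left multiplication, and the three other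
factors act by right multiplication by the inverse. -/
def resSmul {n : ℕ} (z : BigGroup p) (y : ResSet p n) : ResSet p n :=
  (fun i => (z.1, z.2.2.2) * y.1 i,
    Matrix.GeneralLinearGroup.map (ratDiag p) z.1 * y.2.1 * z.2.1⁻¹,
    Matrix.GeneralLinearGroup.map (Rat.castHom ℚ_[p]) z.1 * y.2.2.1 * z.2.2.1⁻¹,
    Matrix.GeneralLinearGroup.map (Rat.castHom ℝ) z.1 * y.2.2.2 * (z.2.2.2 : GL (Fin 2) ℝ)⁻¹)

theorem one_resSmul {n : ℕ} (y : ResSet p n) : resSmul 1 y = y := by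
  obtain ⟨y1, y2, y3, y4⟩ := y
  simp only [resSmul, Prod.fst_one, Prod.snd_one, map_one, one_mul, inv_one, mul_one,
    OneMemClass.coe_one, Prod.mk_one_one]

theorem mul_resSmul {n : ℕ} (z w : BigGroup p) (y : ResSet p n) :
    resSmul (z * w) y = resSmul z (resSmul w y) := by
  obtain ⟨y1, y2, y3, y4⟩ := y
  simp only [resSmul, Prod.fst_mul, Prod.snd_mul, map_mul, mul_inv_rev, mul_assoc,
    Subgroup.coe_mul]
  refine Prod.ext ?_ rfl
  ext1 i
  exact mul_assoc (z.1, z.2.2.2) (w.1, w.2.2.2) (y1 i)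

/-- The action of `GL₂(ℚ) × GL₂(𝔸^{p∞}) × GL₂(ℚ_p) × GL₂(ℝ)°` on `E^{n+1} × GL₂(𝔸)`.
For a subgroup `H` of the form `GL₂(ℚ) × U × GL₂(ℝ)°`, this action is free on `H`, and the modules
`k[E^{n+1} × GL₂(𝔸)]`, `n ≥ 0`, with the simplicial structure in the first factor, form a
resolution of the `k[H]`-module `k[GL₂(𝔸)]` by free `k[H]`-modules. -/
def resAct (n : ℕ) : BigGroup p →* Equiv.Perm (ResSet p n) where
  toFun z :=
    { toFun := resSmul z
      invFun := resSmul z⁻¹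
      left_inv := fun y => by rw [← mul_resSmul, inv_mul_cancel, one_resSmul]
      right_inv := fun y => by rw [← mul_resSmul, mul_inv_cancel, one_resSmul] }
  map_one' := by
    ext1 y
    exact one_resSmul p y
  map_mul' z w := by
    ext1 y
    exact mul_resSmul p z w y

variable {p}

/-- The simplicial structure: for a map `f : [m] → [n]`, the map
`E^{n+1} × GL₂(𝔸) → E^{m+1} × GL₂(𝔸)` given by composition with `f`. -/
def resMap {m n : ℕ} (f : Fin (m + 1) → Fin (n + 1)) (y : ResSet p n) : ResSet p m :=
  (y.1 ∘ f, y.2)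

theorem resMap_act {m n : ℕ} (f : Fin (m + 1) → Fin (n + 1)) (z : BigGroup p) (y : ResSet p n) :
    resMap f (resAct p n z y) = resAct p m z (resMap f y) :=
  rfl

variable {A : Type u} [CommRing A] {M : Type u} [AddCommGroup M] [Module A M]
  {L : Type} [Group L]

/-- The group `GL₂(ℚ) × U^p × L × GL₂(ℝ)°`, where `L` is a group with a homomorphism to `GL₂(ℚ_p)`
(below, `L` is `GL₂(ℤ_p)` or `GL₂(ℚ_p)`). -/
abbrev LevelGroup (U : Subgroup (GL (Fin 2) (FinAdele p))) (L : Type) [Group L] : Type :=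
  GL (Fin 2) ℚ × U × L × Matrix.GLPos (Fin 2) ℝ

/-- The homomorphism from `GL₂(ℚ) × U^p × L × GL₂(ℝ)°` to
`GL₂(ℚ) × GL₂(𝔸^{p∞}) × GL₂(ℚ_p) × GL₂(ℝ)°`. -/
def levelIncl (U : Subgroup (GL (Fin 2) (FinAdele p))) (i : L →* GL (Fin 2) ℚ_[p]) :
    LevelGroup U L →* BigGroup p :=
  (MonoidHom.id _).prodMap (U.subtype.prodMap (i.prodMap (MonoidHom.id _)))

/-- A representation of `L`, viewed as a representation of `GL₂(ℚ) × U^p × L × GL₂(ℝ)°` on which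
`GL₂(ℚ) × U^p × GL₂(ℝ)°` acts trivially. -/
def levelRep (U : Subgroup (GL (Fin 2) (FinAdele p))) (ρ : Representation A L M) :
    Representation A (LevelGroup U L) M :=
  ρ.comp ((MonoidHom.fst _ _).comp ((MonoidHom.snd _ _).comp (MonoidHom.snd _ _)))

/-- The `A`-module `A[E^{n+1} × GL₂(𝔸)] ⊗_{A[H]} M`, where `H = GL₂(ℚ) × U^p × L × GL₂(ℝ)°`. -/
abbrev ResChains (U : Subgroup (GL (Fin 2) (FinAdele p))) (i : L →* GL (Fin 2) ℚ_[p])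
    (ρ : Representation A L M) (n : ℕ) : Type u :=
  Chains (levelIncl U i) (resAct p n) (levelRep U ρ)

/-- The map induced on `A[E^{n+1} × GL₂(𝔸)] ⊗_{A[H]} M` by the simplicial structure. -/
def resChainsMap (U : Subgroup (GL (Fin 2) (FinAdele p))) (i : L →* GL (Fin 2) ℚ_[p])
    (ρ : Representation A L M) {m n : ℕ} (f : Fin (m + 1) → Fin (n + 1)) :
    ResChains U i ρ n →ₗ[A] ResChains U i ρ m :=
  mapChains (levelRep U ρ) (levelIncl U i) (resMap f) (resMap_act f)

theorem resChainsMap_id (U : Subgroup (GL (Fin 2) (FinAdele p))) (i : L →* GL (Fin 2) ℚ_[p])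
    (ρ : Representation A L M) (n : ℕ) :
    resChainsMap U i ρ (id : Fin (n + 1) → Fin (n + 1)) = LinearMap.id :=
  mapChains_id _ _ _ _ fun _ => rfl

theorem resChainsMap_comp (U : Subgroup (GL (Fin 2) (FinAdele p))) (i : L →* GL (Fin 2) ℚ_[p])
    (ρ : Representation A L M) {l m n : ℕ} (f : Fin (m + 1) → Fin (n + 1))
    (f' : Fin (l + 1) → Fin (m + 1)) :
    resChainsMap U i ρ (f ∘ f') = resChainsMap U i ρ f' ∘ₗ resChainsMap U i ρ f := by
  apply chains_ext
  intro y v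
  rw [LinearMap.comp_apply, resChainsMap, resChainsMap, resChainsMap, mapChains_cls, mapChains_cls,
    mapChains_cls]
  rfl

/-- The simplicial `A`-module with terms `A[E^{n+1} × GL₂(𝔸)] ⊗_{A[H]} M`, where
`H = GL₂(ℚ) × U^p × L × GL₂(ℝ)°`. As the modules `A[E^{n+1} × GL₂(𝔸)]` form a free resolution
of `A[GL₂(𝔸)]`, its homology is `Tor^{A[H]}(A[GL₂(𝔸)], M)`. -/
def simpChains (U : Subgroup (GL (Fin 2) (FinAdele p))) (i : L →* GL (Fin 2) ℚ_[p])
    (ρ : Representation A L M) : SimplicialObject (ModuleCat.{u} A) where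
  obj Δ := ModuleCat.of A (ResChains U i ρ Δ.unop.len)
  map f := ModuleCat.ofHom (resChainsMap U i ρ f.unop.toOrderHom)
  map_id Δ := ModuleCat.hom_ext (resChainsMap_id U i ρ Δ.unop.len)
  map_comp f f' := ModuleCat.hom_ext
    (resChainsMap_comp U i ρ f.unop.toOrderHom f'.unop.toOrderHom)

/-- The functor sending a simplicial module to the `n`-th homology of the associated chain
complex (with differential the alternating sum of the faces). -/
def simpHomology (A : Type u) [CommRing A] (n : ℕ) :
    SimplicialObject (ModuleCat.{u} A) ⥤ ModuleCat.{u} A :=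
  AlgebraicTopology.alternatingFaceMapComplex (ModuleCat.{u} A) ⋙
    HomologicalComplex.homologyFunctor (ModuleCat.{u} A) (ComplexShape.down ℕ) n

variable {U : Subgroup (GL (Fin 2) (FinAdele p))} {i : L →* GL (Fin 2) ℚ_[p]}
  {ρ : Representation A L M}

/-- A Hecke operator on the simplicial module computing homology. -/
def heckeEnd (D : HeckeDatum (levelIncl U i) (levelRep U ρ)) : simpChains U i ρ ⟶ simpChains U i ρ where
  app Δ := ModuleCat.ofHom (D.op (resAct p Δ.unop.len))
  naturality Δ Δ' f := by
    apply ModuleCat.hom_ext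
    exact (D.mapChains_op (resMap (p := p) f.unop.toOrderHom) (resMap_act f.unop.toOrderHom)).symm

/-- The Hecke operator of a central element on the simplicial module computing homology. -/
def centralEnd (U : Subgroup (GL (Fin 2) (FinAdele p))) (i : L →* GL (Fin 2) ℚ_[p])
    (ρ : Representation A L M) (z : BigGroup p) (hz : ∀ w, z * w = w * z) :
    simpChains U i ρ ⟶ simpChains U i ρ where
  app Δ := ModuleCat.ofHom (centralOp (levelIncl U i) (resAct p Δ.unop.len) (levelRep U ρ) z hz)
  naturality Δ Δ' f := by
    apply ModuleCat.hom_ext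
    exact (mapChains_centralOp z hz (resMap (p := p) f.unop.toOrderHom)
      (resMap_act f.unop.toOrderHom)).symm

theorem heckeEnd_centralEnd (D : HeckeDatum (levelIncl U i) (levelRep U ρ)) (z : BigGroup p)
    (hz : ∀ w, z * w = w * z) :
    heckeEnd D ≫ centralEnd U i ρ z hz = centralEnd U i ρ z hz ≫ heckeEnd D := by
  refine NatTrans.ext (funext fun Δ => ModuleCat.hom_ext ?_)
  exact (op_centralOp D z hz).symm

theorem centralEnd_comm (z : BigGroup p) (hz : ∀ w, z * w = w * z) (z' : BigGroup p)
    (hz' : ∀ w, z' * w = w * z') :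
    centralEnd U i ρ z hz ≫ centralEnd U i ρ z' hz' =
      centralEnd U i ρ z' hz' ≫ centralEnd U i ρ z hz := by
  refine NatTrans.ext (funext fun Δ => ModuleCat.hom_ext ?_)
  exact centralOp_comm z' hz' z hz

/-- The prime numbers `l` not dividing `p N`. -/
abbrev HeckePrime (p N : ℕ) : Type := {l : PrimesAway p // ¬ l.1 ∣ N}

/-- The generators `T_l`, `S_l` of the abstract Hecke algebra away from `p N`. -/
inductive HeckeGen (p N : ℕ) : Type
  | T (l : HeckePrime p N) : HeckeGen p N
  | S (l : HeckePrime p N) : HeckeGen p N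

/-- The element `diag(1, l) ∈ GL₂(ℚ_l) ⊆ GL₂(𝔸^{p∞})`, together with its trivial action on the
coefficients. -/
def datumAt (U : Subgroup (GL (Fin 2) (FinAdele p))) (i : L →* GL (Fin 2) ℚ_[p])
    (hi : Function.Injective i) (ρ : Representation A L M) (l : PrimesAway p) :
    HeckeDatum (levelIncl U i) (levelRep U ρ) where
  g := (1, diagGL 1 (uniformizer p l), 1, 1)
  φ := LinearMap.id
  compat x x' h m := by
    have h3 : i x.2.2.1 * 1 = 1 * i x'.2.2.1 := congrArg (fun z : BigGroup p => z.2.2.1) h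
    rw [mul_one, one_mul] at h3
    change ρ x.2.2.1 m = ρ x'.2.2.1 m
    rw [hi h3]

/-- The scalar matrix `l ∈ GL₂(ℚ_l) ⊆ GL₂(𝔸^{p∞})`. -/
def scalarAt (l : PrimesAway p) : BigGroup p :=
  (1, diagGL (uniformizer p l) (uniformizer p l), 1, 1)

theorem scalarAt_central (l : PrimesAway p) (w : BigGroup p) :
    scalarAt l * w = w * scalarAt l := by
  ext1
  · exact (one_mul _).trans (mul_one _).symm
  ext1
  · exact diagGL_central _ _
  ext1
  · exact (one_mul _).trans (mul_one _).symm
  · exact (one_mul _).trans (mul_one _).symm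

/-- The action of the Hecke operators `T_l`, `S_l`, for the primes `l ∤ p N`, on the simplicial
module computing homology. -/
def genEnd {N : ℕ} (U : Subgroup (GL (Fin 2) (FinAdele p))) (i : L →* GL (Fin 2) ℚ_[p])
    (hi : Function.Injective i) (ρ : Representation A L M) :
    HeckeGen p N → (simpChains U i ρ ⟶ simpChains U i ρ)
  | .T l => heckeEnd (datumAt U i hi ρ l.1)
  | .S l => centralEnd U i ρ (scalarAt l.1) (scalarAt_central l.1)

/-- Data defining a Hecke operator at `p`, viewed adelically. -/
def datumP (U : Subgroup (GL (Fin 2) (FinAdele p))) (D : HeckeDatum i ρ) :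
    HeckeDatum (levelIncl U i) (levelRep U ρ) where
  g := (1, 1, D.g, 1)
  φ := D.φ
  compat x x' h := D.compat x.2.2.1 x'.2.2.1 (congrArg (fun z : BigGroup p => z.2.2.1) h)

/-- The matrix `β`, viewed adelically. -/
def betaAd (p : ℕ) [Fact p.Prime] : BigGroup p := (1, 1, beta p, 1)

theorem betaAd_central (w : BigGroup p) : betaAd p * w = w * betaAd p := by
  ext1
  · exact (one_mul _).trans (mul_one _).symm
  ext1
  · exact (one_mul _).trans (mul_one _).symm
  ext1
  · exact beta_central p _
  · exact (one_mul _).trans (mul_one _).symm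

/-- The Hecke operators at `p` commute with those away from `p`. -/
theorem datum_comm (hi : Function.Injective i) (D : HeckeDatum i ρ) (l : PrimesAway p) :
    heckeEnd (datumP U D) ≫ heckeEnd (datumAt U i hi ρ l) =
      heckeEnd (datumAt U i hi ρ l) ≫ heckeEnd (datumP U D) := by
  refine NatTrans.ext (funext fun Δ => ModuleCat.hom_ext ?_)
  refine HeckeDatum.op_comm (datumAt U i hi ρ l) (datumP U D)
    (MonoidHom.ker ((MonoidHom.fst _ _).comp ((MonoidHom.snd _ _).comp (MonoidHom.snd _ _)) :
      LevelGroup U L →* L) ⊓ MonoidHom.ker (MonoidHom.fst _ _) ⊓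
      MonoidHom.ker ((MonoidHom.snd _ _).comp ((MonoidHom.snd _ _).comp (MonoidHom.snd _ _))))
    (MonoidHom.ker ((MonoidHom.fst _ _).comp (MonoidHom.snd _ _) : LevelGroup U L →* U) ⊓
      MonoidHom.ker (MonoidHom.fst _ _) ⊓
      MonoidHom.ker ((MonoidHom.snd _ _).comp ((MonoidHom.snd _ _).comp (MonoidHom.snd _ _))))
    ?_ ?_ ?_ ?_
  · rintro ⟨x1, x2, x3, x4⟩
    refine ⟨(1, x2, 1, 1), ⟨⟨rfl, rfl⟩, rfl⟩, ?_⟩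
    rw [HeckeDatum.mem_stab]
    refine ⟨(x1⁻¹, 1, x3⁻¹, x4⁻¹), ?_⟩
    simp [levelIncl, datumAt]
  · rintro ⟨x1, x2, x3, x4⟩
    refine ⟨(1, 1, x3, 1), ⟨⟨rfl, rfl⟩, rfl⟩, ?_⟩
    rw [HeckeDatum.mem_stab]
    refine ⟨(x1⁻¹, x2⁻¹, 1, x4⁻¹), ?_⟩
    simp [levelIncl, datumP]
  · rintro ⟨s1, s2, s3, s4⟩ ⟨⟨h3, h1⟩, h4⟩ ⟨t1, t2, t3, t4⟩ ⟨⟨k2, k1⟩, k4⟩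
    change s3 = 1 at h3
    change s1 = 1 at h1
    change s4 = 1 at h4
    change t1 = 1 at k1
    change t2 = 1 at k2
    change t4 = 1 at k4
    subst h1 h3 h4 k1 k2 k4
    simp [Commute, SemiconjBy, levelIncl, datumAt, datumP]
  · rintro ⟨s1, s2, s3, s4⟩ ⟨⟨h3, h1⟩, h4⟩ ⟨t1, t2, t3, t4⟩ ⟨⟨k2, k1⟩, k4⟩ m
    change s3 = 1 at h3
    subst h3
    simp [levelRep, datumAt, datumP]

end Adelic

section Modules

variable {k : Type u} [Field k]

/-- The algebra homomorphism from `k[T, S]` (with `T = X 0` and `S = X 1`) given by two commuting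
endomorphisms. -/
def polyHom {V : Type u} [AddCommGroup V] [Module k V] (T S : Module.End k V) (h : Commute T S) :
    MvPolynomial (Fin 2) k →ₐ[k] Module.End k V :=
  AddMonoidAlgebra.lift k (Module.End k V) (Fin 2 →₀ ℕ)
    { toFun := fun n => T ^ (n.toAdd 0) * S ^ (n.toAdd 1)
      map_one' := by simp
      map_mul' := fun m n => by
        simp only [toAdd_mul, Finsupp.add_apply, pow_add]
        have := (h.symm.pow_pow (m.toAdd 1) (n.toAdd 0)).eq
        rw [mul_assoc, ← mul_assoc (T ^ (n.toAdd 0)), ← this]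
        simp only [mul_assoc] }

theorem polyHom_X_zero {V : Type u} [AddCommGroup V] [Module k V] (T S : Module.End k V)
    (h : Commute T S) : polyHom T S h (MvPolynomial.X 0) = T :=
  (AddMonoidAlgebra.lift_single _ _ _).trans (by simp)

theorem polyHom_X_one {V : Type u} [AddCommGroup V] [Module k V] (T S : Module.End k V)
    (h : Commute T S) : polyHom T S h (MvPolynomial.X 1) = S :=
  (AddMonoidAlgebra.lift_single _ _ _).trans (by simp)

theorem commute_of_comp {V : ModuleCat.{u} k} {f g : V ⟶ V} (h : f ≫ g = g ≫ f) :
    Commute (S := Module.End k V) f.hom g.hom :=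
  (congrArg ModuleCat.Hom.hom h).symm

/-- A `k`-vector space with two commuting endomorphisms `T`, `S`, as a `k[T, S]`-module. -/
def polyModule (V : ModuleCat.{u} k) (T S : V ⟶ V) (h : T ≫ S = S ≫ T) :
    ModuleCat.{u} (MvPolynomial (Fin 2) k) :=
  letI : Module (MvPolynomial (Fin 2) k) V :=
    Module.compHom V (polyHom T.hom S.hom (commute_of_comp h)).toRingHom
  ModuleCat.of (MvPolynomial (Fin 2) k) V

/-- An endomorphism commuting with `T` and `S` is `k[T, S]`-linear. -/
def polyModuleMap {V : ModuleCat.{u} k} {T S : V ⟶ V} (h : T ≫ S = S ≫ T) (f : V ⟶ V)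
    (hT : T ≫ f = f ≫ T) (hS : S ≫ f = f ≫ S) :
    polyModule V T S h ⟶ polyModule V T S h :=
  letI : Module (MvPolynomial (Fin 2) k) V :=
    Module.compHom V (polyHom T.hom S.hom (commute_of_comp h)).toRingHom
  ModuleCat.ofHom (X := V) (Y := V)
    { toFun := f.hom
      map_add' := map_add f.hom
      map_smul' := fun P v => by
        change f.hom (polyHom T.hom S.hom (commute_of_comp h) P v) =
          polyHom T.hom S.hom (commute_of_comp h) P (f.hom v)
        have hT' : ∀ v, f.hom (T.hom v) = T.hom (f.hom v) := fun v =>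
          LinearMap.congr_fun (congrArg ModuleCat.Hom.hom hT) v
        have hS' : ∀ v, f.hom (S.hom v) = S.hom (f.hom v) := fun v =>
          LinearMap.congr_fun (congrArg ModuleCat.Hom.hom hS) v
        induction P using MvPolynomial.induction_on generalizing v with
        | C a =>
          rw [← MvPolynomial.algebraMap_eq, AlgHom.commutes]
          exact map_smul f.hom a v
        | add P Q hP hQ => rw [map_add, LinearMap.add_apply, LinearMap.add_apply, map_add, hP, hQ]
        | mul_X P i hP =>
          rw [map_mul, Module.End.mul_apply, Module.End.mul_apply, hP]
          fin_cases i
          · exact congrArg _ ((congrArg f.hom (LinearMap.congr_fun (polyHom_X_zero _ _ _) v)).trans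
              ((hT' v).trans (LinearMap.congr_fun (polyHom_X_zero _ _ _) (f.hom v)).symm))
          · exact congrArg _ ((congrArg f.hom (LinearMap.congr_fun (polyHom_X_one _ _ _) v)).trans
              ((hS' v).trans (LinearMap.congr_fun (polyHom_X_one _ _ _) (f.hom v)).symm)) }

/-- An `R`-module with a family of operators, as a module over the free algebra on the family. -/
def opModule {R : Type u} [CommRing R] {X : Type} (V : Type u) [AddCommGroup V] [Module R V]
    (ops : X → Module.End R V) : ModuleCat.{u} (FreeAlgebra R X) :=
  letI : Module (FreeAlgebra R X) V := Module.compHom V (FreeAlgebra.lift R ops).toRingHom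
  ModuleCat.of (FreeAlgebra R X) V

end Modules

section Tor

theorem leftDerived_map_add {C D : Type*} [Category C] [Category D] [Abelian C]
    [HasProjectiveResolutions C] [Abelian D] (F : C ⥤ D) [F.Additive] (n : ℕ) {X Y : C}
    (f g : X ⟶ Y) :
    (F.leftDerived n).map (f + g) = (F.leftDerived n).map f + (F.leftDerived n).map g := by
  let P := projectiveResolution X
  let Q := projectiveResolution Y
  rw [F.leftDerived_map_eq n f _ (ProjectiveResolution.lift_commutes f P Q),
    F.leftDerived_map_eq n g _ (ProjectiveResolution.lift_commutes g P Q),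
    F.leftDerived_map_eq n (f + g)
      (ProjectiveResolution.lift f P Q + ProjectiveResolution.lift g P Q)
      (by rw [Preadditive.add_comp, ProjectiveResolution.lift_commutes,
            ProjectiveResolution.lift_commutes, Functor.map_add, Preadditive.comp_add])]
  rw [Functor.map_add, Preadditive.add_comp, Preadditive.comp_add]

variable {k : Type u} [Field k] {R : Type u} [CommRing R] [Algebra k R]

/-- The ring `R[T, S] / (T - τ, S - σ)`, with `T = X 0` and `S = X 1`. -/
abbrev EigenRing (τ σ : R) : Type u :=
  MvPolynomial (Fin 2) R ⧸ (Ideal.span {MvPolynomial.X 0 - MvPolynomial.C τ,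
    MvPolynomial.X 1 - MvPolynomial.C σ} : Ideal (MvPolynomial (Fin 2) R))

/-- `R[T, S] / (T - τ, S - σ)` as a module over `k[T, S]`. -/
def eigenModule (k : Type u) [Field k] [Algebra k R] (τ σ : R) :
    ModuleCat.{u} (MvPolynomial (Fin 2) k) :=
  (ModuleCat.restrictScalars (MvPolynomial.map (algebraMap k R))).obj
    (ModuleCat.of (MvPolynomial (Fin 2) R) (EigenRing τ σ))

/-- The action of `R` on the `k[T, S]`-module `R[T, S] / (T - τ, S - σ)` by multiplication. -/
def eigenModuleScalar (k : Type u) [Field k] [Algebra k R] (τ σ : R) (c : R) :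
    eigenModule k τ σ ⟶ eigenModule k τ σ :=
  (ModuleCat.restrictScalars (MvPolynomial.map (algebraMap k R))).map
    (ModuleCat.ofHom ((MvPolynomial.C c : MvPolynomial (Fin 2) R) •
      (LinearMap.id : EigenRing τ σ →ₗ[MvPolynomial (Fin 2) R] EigenRing τ σ)))

/-- `Tor_i^{k[T, S]}(R[T, S] / (T - τ, S - σ), V)`, as an abelian group. -/
abbrev eigenTor (τ σ : R) (i : ℕ) (V : ModuleCat.{u} (MvPolynomial (Fin 2) k)) :
    ModuleCat.{u} (MvPolynomial (Fin 2) k) :=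
  ((Tor' (ModuleCat.{u} (MvPolynomial (Fin 2) k)) i).obj (eigenModule k τ σ)).obj V

/-- The action of `R` on `Tor_i^{k[T, S]}(R[T, S] / (T - τ, S - σ), V)`, coming from the action of
`R` on the first argument. -/
def eigenTorScalar (τ σ : R) (i : ℕ) (V : ModuleCat.{u} (MvPolynomial (Fin 2) k)) (c : R) :
    eigenTor τ σ i V ⟶ eigenTor τ σ i V :=
  ((Tor' (ModuleCat.{u} (MvPolynomial (Fin 2) k)) i).map (eigenModuleScalar k τ σ c)).app V

theorem eigenModuleScalar_one (τ σ : R) : eigenModuleScalar k τ σ 1 = 𝟙 _ := by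
  rw [eigenModuleScalar, map_one, one_smul]
  exact CategoryTheory.Functor.map_id _ _

theorem eigenModuleScalar_mul (τ σ c d : R) :
    eigenModuleScalar k τ σ (c * d) = eigenModuleScalar k τ σ d ≫ eigenModuleScalar k τ σ c := by
  refine ModuleCat.hom_ext (LinearMap.ext fun (x : EigenRing τ σ) => ?_)
  change (MvPolynomial.C (c * d) : MvPolynomial (Fin 2) R) • x =
    (MvPolynomial.C c : MvPolynomial (Fin 2) R) • (MvPolynomial.C d : MvPolynomial (Fin 2) R) • x
  rw [map_mul, mul_smul]

theorem eigenModuleScalar_add (τ σ c d : R) :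
    eigenModuleScalar k τ σ (c + d) = eigenModuleScalar k τ σ c + eigenModuleScalar k τ σ d := by
  refine ModuleCat.hom_ext (LinearMap.ext fun (x : EigenRing τ σ) => ?_)
  change (MvPolynomial.C (c + d) : MvPolynomial (Fin 2) R) • x =
    (MvPolynomial.C c : MvPolynomial (Fin 2) R) • x + (MvPolynomial.C d : MvPolynomial (Fin 2) R) • x
  rw [map_add, add_smul]

theorem eigenTorScalar_one (τ σ : R) (i : ℕ) (V : ModuleCat.{u} (MvPolynomial (Fin 2) k)) :
    eigenTorScalar τ σ i V 1 = 𝟙 _ := by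
  rw [eigenTorScalar, eigenModuleScalar_one, CategoryTheory.Functor.map_id, NatTrans.id_app]

theorem eigenTorScalar_mul (τ σ : R) (i : ℕ) (V : ModuleCat.{u} (MvPolynomial (Fin 2) k))
    (c d : R) :
    eigenTorScalar τ σ i V (c * d) = eigenTorScalar τ σ i V d ≫ eigenTorScalar τ σ i V c := by
  rw [eigenTorScalar, eigenModuleScalar_mul, CategoryTheory.Functor.map_comp, NatTrans.comp_app]
  rfl

theorem eigenTorScalar_add (τ σ : R) (i : ℕ) (V : ModuleCat.{u} (MvPolynomial (Fin 2) k))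
    (c d : R) :
    eigenTorScalar τ σ i V (c + d) = eigenTorScalar τ σ i V c + eigenTorScalar τ σ i V d := by
  rw [eigenTorScalar, eigenModuleScalar_add]
  exact leftDerived_map_add ((MonoidalCategory.tensoringRight _).obj V) i
    (eigenModuleScalar k τ σ c) (eigenModuleScalar k τ σ d)

/-- `Tor_i^{k[T, S]}(R[T, S] / (T - τ, S - σ), V)` as an `R`-module. -/
@[reducible]
def eigenTorModule (τ σ : R) (i : ℕ) (V : ModuleCat.{u} (MvPolynomial (Fin 2) k)) :
    Module R (eigenTor τ σ i V) where
  smul c x := (eigenTorScalar τ σ i V c).hom x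
  one_smul x := LinearMap.congr_fun (congrArg ModuleCat.Hom.hom (eigenTorScalar_one τ σ i V)) x
  mul_smul c d x :=
    LinearMap.congr_fun (congrArg ModuleCat.Hom.hom (eigenTorScalar_mul τ σ i V c d)) x
  smul_zero c := map_zero (eigenTorScalar τ σ i V c).hom
  smul_add c := map_add (eigenTorScalar τ σ i V c).hom
  add_smul c d x :=
    LinearMap.congr_fun (congrArg ModuleCat.Hom.hom (eigenTorScalar_add τ σ i V c d)) x
  zero_smul x := by
    have h : eigenTorScalar τ σ i V 0 = 0 := by
      have := eigenTorScalar_add τ σ i V 0 0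
      rw [add_zero] at this
      exact left_eq_add.1 this
    exact LinearMap.congr_fun (congrArg ModuleCat.Hom.hom h) x

attribute [local instance] eigenTorModule

/-- The `R`-linear endomorphism of `Tor_i^{k[T, S]}(R[T, S] / (T - τ, S - σ), V)` induced by an
endomorphism of `V`. -/
def eigenTorMap (τ σ : R) (i : ℕ) {V : ModuleCat.{u} (MvPolynomial (Fin 2) k)} (f : V ⟶ V) :
    Module.End R (eigenTor τ σ i V) where
  toFun := (((Tor' (ModuleCat.{u} (MvPolynomial (Fin 2) k)) i).obj (eigenModule k τ σ)).map f).hom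
  map_add' := map_add _
  map_smul' c x := LinearMap.congr_fun (congrArg ModuleCat.Hom.hom
    (((Tor' (ModuleCat.{u} (MvPolynomial (Fin 2) k)) i).map
      (eigenModuleScalar k τ σ c)).naturality f).symm) x

end Tor

section Homology

variable {p : ℕ} [Fact p.Prime]

theorem inclK_injective : Function.Injective (inclK p) := by
  intro x y h
  ext i j
  have := congrArg (fun g : GL (Fin 2) ℚ_[p] => g i j) h
  exact IsFractionRing.injective ℤ_[p] ℚ_[p] this

variable {A : Type u} [CommRing A] {M : Type u} [AddCommGroup M] [Module A M]

/-- The `p`-arithmetic homology `H_n(U^p, π)` of a representation `π` of `GL₂(ℚ_p)` over `A`, with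
the action of `A` and of the Hecke operators `T_l`, `S_l` for `l ∤ p N`. -/
def pArithHomology (N : ℕ) (U : Subgroup (GL (Fin 2) (FinAdele p)))
    (π : Representation A (GL (Fin 2) ℚ_[p]) M) (n : ℕ) :
    ModuleCat.{u} (FreeAlgebra A (HeckeGen p N)) :=
  opModule ((simpHomology A n).obj (simpChains U (MonoidHom.id _) π)) fun x =>
    ((simpHomology A n).map (genEnd U (MonoidHom.id _) Function.injective_id π x)).hom

variable (k : Type u) [Field k] [Algebra (ZMod p) k]

attribute [local instance] eigenTorModule

/-- The Hecke operator `T` on the arithmetic homology `H_n(U^p K, Sym^r(k²)^∨ ⊗ ω^s)`. -/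
def arithT (U : Subgroup (GL (Fin 2) (FinAdele p))) (r : ℕ) (s : ℤ) (n : ℕ) :
    (simpHomology k n).obj (simpChains U (inclK p) (weightRep p k r s)) ⟶
      (simpHomology k n).obj (simpChains U (inclK p) (weightRep p k r s)) :=
  (simpHomology k n).map (heckeEnd (datumP U (weightDatum p k r s)))

/-- The Hecke operator `S` on the arithmetic homology `H_n(U^p K, Sym^r(k²)^∨ ⊗ ω^s)`, for the
action of `K Z` on `Sym^r(k²)^∨ ⊗ ω^s` where `β` acts trivially. -/
def arithS (U : Subgroup (GL (Fin 2) (FinAdele p))) (r : ℕ) (s : ℤ) (n : ℕ) :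
    (simpHomology k n).obj (simpChains U (inclK p) (weightRep p k r s)) ⟶
      (simpHomology k n).obj (simpChains U (inclK p) (weightRep p k r s)) :=
  (simpHomology k n).map (centralEnd U (inclK p) (weightRep p k r s) (betaAd p) betaAd_central)

theorem arithT_arithS (U : Subgroup (GL (Fin 2) (FinAdele p))) (r : ℕ) (s : ℤ) (n : ℕ) :
    arithT k U r s n ≫ arithS k U r s n = arithS k U r s n ≫ arithT k U r s n := by
  rw [arithT, arithS, ← Functor.map_comp, ← Functor.map_comp, heckeEnd_centralEnd]

/-- The arithmetic homology `H_n(U^p K, Sym^r(k²)^∨ ⊗ ω^s)`, as a module over `k[T, S]`. -/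
def arithHomology (U : Subgroup (GL (Fin 2) (FinAdele p))) (r : ℕ) (s : ℤ) (n : ℕ) :
    ModuleCat.{u} (MvPolynomial (Fin 2) k) :=
  polyModule ((simpHomology k n).obj (simpChains U (inclK p) (weightRep p k r s)))
    (arithT k U r s n) (arithS k U r s n) (arithT_arithS k U r s n)

/-- The action of the Hecke operators `T_l`, `S_l` for `l ∤ p N` on the arithmetic homology
`H_n(U^p K, Sym^r(k²)^∨ ⊗ ω^s)`. -/
def arithHecke {N : ℕ} (U : Subgroup (GL (Fin 2) (FinAdele p))) (r : ℕ) (s : ℤ) (n : ℕ)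
    (x : HeckeGen p N) : arithHomology k U r s n ⟶ arithHomology k U r s n :=
  polyModuleMap (arithT_arithS k U r s n)
    ((simpHomology k n).map (genEnd U (inclK p) inclK_injective (weightRep p k r s) x))
    (by
      rw [arithT, ← Functor.map_comp, ← Functor.map_comp]
      cases x with
      | T l => exact congrArg _ (datum_comm inclK_injective _ _)
      | S l => exact congrArg _ (heckeEnd_centralEnd _ _ _))
    (by
      rw [arithS, ← Functor.map_comp, ← Functor.map_comp]
      cases x with
      | T l => exact congrArg _ (heckeEnd_centralEnd _ _ _).symm
      | S l => exact congrArg _ (centralEnd_comm _ _ _ _))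

/-- The term `Tor_i^{k[T, S]}(R[T, S] / (T - τ, S - σ), H_j(U^p K, Sym^r(k²)^∨ ⊗ ω^s))`, with the
action of `R` and of the Hecke operators `T_l`, `S_l` for `l ∤ p N`. -/
def torTerm (N : ℕ) (U : Subgroup (GL (Fin 2) (FinAdele p))) (r : ℕ) (s : ℤ) {R : Type u}
    [CommRing R] [Algebra k R] (τ σ : R) (i j : ℕ) :
    ModuleCat.{u} (FreeAlgebra R (HeckeGen p N)) :=
  opModule (eigenTor τ σ i (arithHomology k U r s j)) fun x =>
    eigenTorMap τ σ i (arithHecke k U r s j x)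

end Homology

section SpectralSequences

/-- First quadrant homological spectral sequences starting at the second page: the
differential on the `r`-th page goes from the position `(i, j)` to the position
`(i - r, j + r - 1)`. -/
abbrev HomologicalSS (C : Type*) [Category C] [Abelian C] : Type _ :=
  SpectralSequence C (fun r : ℤ => ComplexShape.spectralSequenceNat (-r, r - 1)) 2

/-- Convergence of a first quadrant homological spectral sequence of modules to a family `H`:
each `H n` has an increasing filtration `0 = F₋₁ ⊆ F₀ ⊆ ⋯ ⊆ F_n = H n` (with `F_{i-1}` denoted by
`Fil i`) whose `i`-th graded piece `F_i / F_{i-1}` is the limit term at `(i, j)`, where `i + j = n`.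
As the differentials from and to the position `(i, j)` vanish on the `r`-th page for `r ≥ n + 2`,
the limit term is the term of any of those pages. -/
def ConvergesTo {𝒪 : Type u} [Ring 𝒪] (E : HomologicalSS (ModuleCat.{u} 𝒪))
    (H : ℕ → ModuleCat.{u} 𝒪) : Prop :=
  ∀ n : ℕ, ∃ Fil : ℕ → Submodule 𝒪 (H n),
    Monotone Fil ∧ Fil 0 = ⊥ ∧ Fil (n + 1) = ⊤ ∧
      ∀ i j : ℕ, i + j = n → ∀ (r : ℤ) (hr : (n : ℤ) + 2 ≤ r),
        Nonempty ((E.page r (by lia)).X (i, j) ≅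
          ModuleCat.of 𝒪 (Fil (i + 1) ⧸ (Fil i).submoduleOf (Fil (i + 1))))

end SpectralSequences

end

end PArith

/-! Let C be the compact induction from K to G of Sym^r(k²)^∨ ⊗ ω^s ⊗_k R. The heart of the proof is
that (S - σ, T - τ) is a regular sequence on C, so that the Koszul complex 0 → C → C² → C → π̃ → 0
is exact. Injectivity of S - σ (`cIndS_sub_injective`) comes from the grading of C by the valuation
of the determinant: S shifts it by 2, while σ is a unit. Modulo S - σ, an element of C becomes a
finitely supported function on the vertices of the Bruhat–Tits tree with values in the weight
(`centralQuot`). At a vertex of its support furthest from the origin, T pushes the value to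
neighbours further out, which no other vertex of the support reaches and to which τ contributes
nothing. If T - τ kills the element, the value at that vertex is therefore killed by at least p of
the p + 1 maps attached to its neighbours (`centralQuot_eq_zero_of_cIndT`). For r ≤ p - 1 any such p
maps are jointly injective: they determine a functional on the powers (a X + Y)^r with a ∈ 𝔽_p, and
these span Sym^r (`weight_eq_zero`).

The groups defining arithmetic and p-arithmetic homology act freely on the sets E^{n+1} × GL₂(𝔸), so
chains are exact in the coefficients (`coeffMap_exact`) and there are long exact sequences with
Hecke-equivariant connecting maps (`exists_pArithδ`). With I = (T - τ, S - σ) C, the Koszul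
resolution is cut into 0 → C → C² → I → 0 and 0 → I → C → π̃ → 0. The two long exact sequences are
spliced by hand into a spectral sequence with three columns, whose only differential goes from
column 2 to column 0 on the second page (`KoszulSequences`). Its second page is the Koszul homology
of S - σ and T - τ on H_j(U^p, C).

Shapiro's lemma (`shapiroMap_bijective`) and flatness of R over k identify H_j(U^p, C) with R ⊗_k
H_j(U^p K, Sym^r(k²)^∨ ⊗ ω^s), compatibly with T, S, T_l and S_l. On the other side, R[T, S] is free
over k[T, S] and T - τ, S - σ is a regular sequence in it, so the same Koszul homology is the
required Tor (`nonempty_eigenTor_iso`).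

Part (2) is the case R = k: for a character χ of ℚ_p^×, the twist of C by χ is the compact induction
of the twisted weight, and this isomorphism rescales T and S by χ(p) and χ(p)² (`map_eigenSub`). -/

namespace PArith

noncomputable section

/-! ### Homology of modules in terms of explicit cycles. -/

section LinearAlgebra

variable {𝒪 : Type*} [Ring 𝒪] {A B C : Type*} [AddCommGroup A] [AddCommGroup B] [AddCommGroup C]
  [Module 𝒪 A] [Module 𝒪 B] [Module 𝒪 C]

/-- Two surjections from the same module with the same kernel have isomorphic targets. -/
theorem nonempty_equiv_of_ker_eq (f : A →ₗ[𝒪] B) (g : A →ₗ[𝒪] C) (hf : Function.Surjective f)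
    (hg : Function.Surjective g) (h : ∀ a, f a = 0 ↔ g a = 0) : Nonempty (B ≃ₗ[𝒪] C) :=
  ⟨(f.quotKerEquivOfSurjective hf).symm ≪≫ₗ
    Submodule.quotEquivOfEq _ _ (show LinearMap.ker f = LinearMap.ker g from Submodule.ext h) ≪≫ₗ g.quotKerEquivOfSurjective hg⟩

/-- The factorization of a linear map through a surjective one. -/
def descend (f : A →ₗ[𝒪] B) (g : A →ₗ[𝒪] C) (hf : Function.Surjective f)
    (h : ∀ a, f a = 0 → g a = 0) : B →ₗ[𝒪] C :=
  (LinearMap.ker f).liftQ g (fun a ha => h a ha) ∘ₗ (f.quotKerEquivOfSurjective hf).symm.toLinearMap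

theorem descend_apply (f : A →ₗ[𝒪] B) (g : A →ₗ[𝒪] C) (hf : Function.Surjective f)
    (h : ∀ a, f a = 0 → g a = 0) (a : A) : descend f g hf h (f a) = g a := by
  have : (f.quotKerEquivOfSurjective hf).symm (f a) = (LinearMap.ker f).mkQ a := by
    rw [LinearEquiv.symm_apply_eq]
    rfl
  simp only [descend, LinearMap.comp_apply, LinearEquiv.coe_coe, this]
  exact (LinearMap.ker f).liftQ_apply g a

/-- The homology `ker g / im f` of a pair of linear maps. -/
abbrev Hlg (f : A →ₗ[𝒪] B) (g : B →ₗ[𝒪] C) : Type _ :=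
  LinearMap.ker g ⧸ (LinearMap.range f).submoduleOf (LinearMap.ker g)

/-- The class of a cycle. -/
def hlgMk (f : A →ₗ[𝒪] B) (g : B →ₗ[𝒪] C) : LinearMap.ker g →ₗ[𝒪] Hlg f g :=
  ((LinearMap.range f).submoduleOf (LinearMap.ker g)).mkQ

theorem hlgMk_surjective (f : A →ₗ[𝒪] B) (g : B →ₗ[𝒪] C) : Function.Surjective (hlgMk f g) :=
  Submodule.mkQ_surjective _

theorem hlgMk_eq_zero (f : A →ₗ[𝒪] B) (g : B →ₗ[𝒪] C) (x : LinearMap.ker g) :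
    hlgMk f g x = 0 ↔ (x : B) ∈ LinearMap.range f := by
  rw [hlgMk, Submodule.mkQ_apply, Submodule.Quotient.mk_eq_zero]
  rfl

end LinearAlgebra

section Homology

variable {𝒪 : Type*} [Ring 𝒪]

/-- The class in homology of a cycle of a short complex of modules. -/
def homMk (S : ShortComplex (ModuleCat.{u} 𝒪)) : LinearMap.ker S.g.hom →ₗ[𝒪] S.homology :=
  (S.moduleCatCyclesIso.inv ≫ S.homologyπ).hom

theorem homMk_surjective (S : ShortComplex (ModuleCat.{u} 𝒪)) : Function.Surjective (homMk S) :=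
  (ModuleCat.epi_iff_surjective _).1 inferInstance

theorem homMk_eq_zero (S : ShortComplex (ModuleCat.{u} 𝒪)) (x : LinearMap.ker S.g.hom) :
    homMk S x = 0 ↔ (x : S.X₂) ∈ LinearMap.range S.f.hom := by
  have h : homMk S = (S.moduleCatLeftHomologyData.π ≫ S.moduleCatHomologyIso.inv).hom :=
    congrArg ModuleCat.Hom.hom S.moduleCatCyclesIso_inv_π
  have h' : homMk S x = S.moduleCatHomologyIso.inv.hom
      ((LinearMap.range S.moduleCatToCycles).mkQ x) := LinearMap.congr_fun h x
  rw [h']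
  refine (LinearMap.map_eq_zero_iff S.moduleCatHomologyIso.inv.hom
    ((ModuleCat.mono_iff_injective _).1 inferInstance)).trans ?_
  refine (Submodule.Quotient.mk_eq_zero (LinearMap.range S.moduleCatToCycles)).trans ?_
  constructor
  · rintro ⟨y, rfl⟩
    exact ⟨y, rfl⟩
  · rintro ⟨y, hy⟩
    exact ⟨y, Subtype.ext hy⟩

/-- Chasing a cycle through the abstract object of cycles lets a map on homology be read off on
representatives; the later compatibilities of Tor with scalars and operators are checked this way.
-/
theorem homologyMap_homMk {S S' : ShortComplex (ModuleCat.{u} 𝒪)} (φ : S ⟶ S')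
    (x : LinearMap.ker S.g.hom) (hx : φ.τ₂ x.1 ∈ LinearMap.ker S'.g.hom) :
    (ShortComplex.homologyMap φ).hom (homMk S x) = homMk S' ⟨φ.τ₂ x.1, hx⟩ := by
  have h1 : S.moduleCatCyclesIso.inv ≫ S.homologyπ ≫ ShortComplex.homologyMap φ =
      S.moduleCatCyclesIso.inv ≫ ShortComplex.cyclesMap φ ≫ S'.homologyπ := by
    rw [ShortComplex.homologyπ_naturality]
  have h2 : S.moduleCatCyclesIso.inv ≫ ShortComplex.cyclesMap φ ≫ S'.moduleCatCyclesIso.hom ≫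
      S'.moduleCatLeftHomologyData.i = S.moduleCatLeftHomologyData.i ≫ φ.τ₂ := by
    rw [ShortComplex.moduleCatCyclesIso_hom_i, ShortComplex.cyclesMap_i,
      ShortComplex.moduleCatCyclesIso_inv_iCycles_assoc]
  have h3 : S'.moduleCatCyclesIso.hom (ShortComplex.cyclesMap φ (S.moduleCatCyclesIso.inv x)) =
      (⟨φ.τ₂ x.1, hx⟩ : LinearMap.ker S'.g.hom) :=
    Subtype.ext (LinearMap.congr_fun (congrArg ModuleCat.Hom.hom h2) x)
  have h4 := LinearMap.congr_fun (congrArg ModuleCat.Hom.hom h1) x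
  refine h4.trans ?_
  change S'.homologyπ _ = S'.homologyπ (S'.moduleCatCyclesIso.inv _)
  rw [← h3]
  refine congrArg _ ?_
  exact (LinearMap.congr_fun (congrArg ModuleCat.Hom.hom S'.moduleCatCyclesIso.hom_inv_id) _).symm

end Homology

section ZeroDifferentials

variable {C : Type*} [Category C] [Abelian C] {κ : Type*}

/-- The complex with zero differentials. -/
def zeroComplex (c : ComplexShape κ) (X : κ → C) : HomologicalComplex C c where
  X := X
  d _ _ := 0

/-- The homology of a complex with zero differentials. -/
def zeroComplexIso (c : ComplexShape κ) (X : κ → C) (x : κ) : (zeroComplex c X).homology x ≅ X x :=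
  (ShortComplex.HomologyData.ofZeros ((zeroComplex c X).sc x) rfl rfl).left.homologyIso

end ZeroDifferentials

/-! ### The three-column spectral sequence obtained from two spliced long exact sequences. -/

section Koszul

variable {𝒪 : Type u} [Ring 𝒪] {H : Type u} [AddCommGroup H] [Module 𝒪 H]

/-- The differential `(a, b) ↦ t a - s b` of the Koszul complex. -/
def kosD₁ (s t : Module.End 𝒪 H) : H × H →ₗ[𝒪] H :=
  t ∘ₗ LinearMap.fst 𝒪 H H - s ∘ₗ LinearMap.snd 𝒪 H H

/-- The differential `a ↦ (s a, t a)` of the Koszul complex. -/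
def kosD₂ (s t : Module.End 𝒪 H) : H →ₗ[𝒪] H × H :=
  LinearMap.prod s t

/-- The homology of the Koszul complex of two endomorphisms. -/
def kosHomology (s t : Module.End 𝒪 H) : ℕ → ModuleCat.{u} 𝒪
  | 0 => ModuleCat.of 𝒪 (Hlg (kosD₁ s t) (0 : H →ₗ[𝒪] PUnit.{u + 1}))
  | 1 => ModuleCat.of 𝒪 (Hlg (kosD₂ s t) (kosD₁ s t))
  | 2 => ModuleCat.of 𝒪 (Hlg (0 : PUnit.{u + 1} →ₗ[𝒪] H) (kosD₂ s t))
  | _ + 3 => ModuleCat.of 𝒪 PUnit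

end Koszul

/-- The exact sequences relating the homology `H` of a complex with two endomorphisms `s`, `t`
forming a regular sequence, the homology `K` of its subcomplex generated by the images of `s`
and `t`, and the homology `Q` of the quotient by this subcomplex. -/
structure KoszulSequences (𝒪 : Type u) [Ring 𝒪] where
  /-- the homology of the complex -/
  H : ℕ → ModuleCat.{u} 𝒪
  /-- the homology of the subcomplex -/
  K : ℕ → ModuleCat.{u} 𝒪
  /-- the homology of the quotient -/
  Q : ℕ → ModuleCat.{u} 𝒪
  /-- the first endomorphism -/
  s (n : ℕ) : Module.End 𝒪 (H n)
  /-- the second endomorphism -/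
  t (n : ℕ) : Module.End 𝒪 (H n)
  /-- the map `(a, b) ↦ t a - s b` to the subcomplex -/
  u (n : ℕ) : H n × H n →ₗ[𝒪] K n
  /-- the inclusion of the subcomplex -/
  v (n : ℕ) : K n →ₗ[𝒪] H n
  /-- the map to the quotient -/
  q (n : ℕ) : H n →ₗ[𝒪] Q n
  /-- a connecting homomorphism -/
  δ (n : ℕ) : Q (n + 1) →ₗ[𝒪] K n
  /-- a connecting homomorphism -/
  e (n : ℕ) : K (n + 1) →ₗ[𝒪] H n
  v_u (n : ℕ) (x : H n × H n) : v n (u n x) = kosD₁ (s n) (t n) x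
  exact_d_u (n : ℕ) : Function.Exact (kosD₂ (s n) (t n)) (u n)
  exact_u_e (n : ℕ) : Function.Exact (u (n + 1)) (e n)
  exact_e_d (n : ℕ) : Function.Exact (e n) (kosD₂ (s n) (t n))
  u_surjective : Function.Surjective (u 0)
  exact_v_q (n : ℕ) : Function.Exact (v n) (q n)
  exact_q_δ (n : ℕ) : Function.Exact (q (n + 1)) (δ n)
  exact_δ_v (n : ℕ) : Function.Exact (δ n) (v n)
  q_surjective : Function.Surjective (q 0)

namespace KoszulSequences

variable {𝒪 : Type u} [Ring 𝒪] (D : KoszulSequences 𝒪)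

/-- The second page. -/
def E₂ (x : ℕ × ℕ) : ModuleCat.{u} 𝒪 :=
  kosHomology (D.s x.2) (D.t x.2) x.1

/-- The surjection from `K` to the third column of the second page. -/
def toE₂ (j : ℕ) : D.K (j + 1) →ₗ[𝒪] D.E₂ (2, j) :=
  hlgMk _ _ ∘ₗ (D.e j).codRestrict _ fun x => (D.exact_e_d j).apply_apply_eq_zero x

/-- The Koszul complex stops in degree 2, so column 2 consists of cycles without boundaries: it is
the kernel of `kosD₂`, which is the image of the connecting map `e`. -/
theorem toE₂_eq_zero (j : ℕ) (x : D.K (j + 1)) : D.toE₂ j x = 0 ↔ D.e j x = 0 := by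
  refine (hlgMk_eq_zero _ _ _).trans ?_
  rw [LinearMap.range_zero, Submodule.mem_bot]
  rfl

theorem toE₂_surjective (j : ℕ) : Function.Surjective (D.toE₂ j) := by
  refine (hlgMk_surjective _ _).comp ?_
  rintro ⟨x, hx⟩
  obtain ⟨y, rfl⟩ := (D.exact_e_d j x).1 hx
  exact ⟨y, rfl⟩

/-- The surjection from `H` to the first column of the second page. -/
def zeroE₂ (j : ℕ) : D.H j →ₗ[𝒪] D.E₂ (0, j) :=
  hlgMk _ _ ∘ₗ LinearMap.id.codRestrict _ fun _ => rfl

theorem zeroE₂_eq_zero (j : ℕ) (x : D.H j) :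
    D.zeroE₂ j x = 0 ↔ x ∈ LinearMap.range (kosD₁ (D.s j) (D.t j)) :=
  hlgMk_eq_zero _ _ _

theorem zeroE₂_surjective (j : ℕ) : Function.Surjective (D.zeroE₂ j) :=
  (hlgMk_surjective _ _).comp fun x => ⟨x.1, rfl⟩

/-- The differential of the second page from the third to the first column. -/
def d₂ (j : ℕ) : D.E₂ (2, j) →ₗ[𝒪] D.E₂ (0, j + 1) :=
  descend (D.toE₂ j) (D.zeroE₂ (j + 1) ∘ₗ D.v (j + 1)) (D.toE₂_surjective j) fun x hx => by
    rw [toE₂_eq_zero] at hx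
    -- The kernel of `e` is the image of `u`, and `v ∘ u` is `kosD₁`, whose image vanishes in column
    -- 0.
    obtain ⟨y, rfl⟩ := (D.exact_u_e j x).1 hx
    rw [LinearMap.comp_apply, D.v_u, zeroE₂_eq_zero]
    exact ⟨y, rfl⟩

theorem d₂_apply (j : ℕ) (x : D.K (j + 1)) :
    D.d₂ j (D.toE₂ j x) = D.zeroE₂ (j + 1) (D.v (j + 1) x) :=
  descend_apply _ _ _ _ _

/-- The differential of the second page. -/
def d : ∀ x y : ℕ × ℕ, D.E₂ x ⟶ D.E₂ y
  | (2, j), (0, j') =>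
    if h : j + 1 = j' then ModuleCat.ofHom (D.d₂ j) ≫ eqToHom (by rw [h]) else 0
  | _, _ => 0

theorem d_two (j : ℕ) : D.d (2, j) (0, j + 1) = ModuleCat.ofHom (D.d₂ j) :=
  (dif_pos rfl).trans (Category.comp_id _)

theorem d_eq_zero {x y : ℕ × ℕ} (h : x.1 = 2 → y.1 = 0 → x.2 + 1 = y.2 → False) :
    D.d x y = 0 := by
  unfold d
  split
  · exact dif_neg fun h' => h rfl rfl h'
  · rfl

/-- The second page, as a complex. -/
def page₂ : HomologicalComplex (ModuleCat.{u} 𝒪)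
    (ComplexShape.spectralSequenceNat (-(2 : ℤ), (2 : ℤ) - 1)) where
  X := D.E₂
  d := D.d
  shape x y h := D.d_eq_zero fun h1 h2 h3 => h (by
    rw [ComplexShape.spectralSequenceNat_rel_iff]
    lia)
  d_comp_d' x y z _ _ := by
    -- Nonzero arrows start in column 2 and end in column 0, so of two consecutive ones at least one
    -- is zero.
    by_cases h : y.1 = 0
    · rw [D.d_eq_zero (x := y) (by lia), Limits.comp_zero]
    · rw [D.d_eq_zero (x := x) (y := y) (by lia), Limits.zero_comp]

open Classical in
/-- The pages of the spectral sequence. -/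
def page (r : ℤ) : HomologicalComplex (ModuleCat.{u} 𝒪)
    (ComplexShape.spectralSequenceNat (-r, r - 1)) :=
  -- From page 3 on the differentials cross at least three columns and vanish, so the terms stay
  -- equal to the homology of page 2. For r < 2 this is only a default value.
  if h : r = 2 then h ▸ D.page₂ else zeroComplex _ fun x => D.page₂.homology x

theorem page_two : D.page 2 = D.page₂ :=
  dif_pos rfl

theorem page_of_ne (r : ℤ) (h : r ≠ 2) : D.page r = zeroComplex _ fun x => D.page₂.homology x :=
  dif_neg h

/-- The spectral sequence. -/
def spectralSequence : HomologicalSS (ModuleCat.{u} 𝒪) where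
  page r _ := D.page r
  iso r r' x hrr' hr :=
    (if h : r = 2 then eqToIso (Y := D.page₂.homology x) (by subst h; rw [page_two])
      else eqToIso (Y := (zeroComplex _ fun x => D.page₂.homology x).homology x)
        (by rw [page_of_ne _ _ h]) ≪≫
        zeroComplexIso _ (fun x => D.page₂.homology x) x) ≪≫
    eqToIso (by rw [page_of_ne _ r' (by lia)]; rfl)

/-- The filtration on the limit. -/
def fil : ∀ n : ℕ, ℕ → Submodule 𝒪 (D.Q n)
  | _, 0 => ⊥
  | n, 1 => LinearMap.range (D.q n)
  -- Index i holds F_{i-1}. Here F₁ consists of the classes whose image in K comes from H × H, so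
  -- that F₂ / F₁ embeds into column 2 through `e ∘ δ`.
  | n + 1, 2 => (LinearMap.range (D.u n)).comap (D.δ n)
  | _, _ => ⊤

theorem fil_monotone (n : ℕ) : Monotone (D.fil n) := by
  refine monotone_nat_of_le_succ fun i => ?_
  match n, i with
  | _, 0 => exact bot_le
  | 0, 1 => exact le_top
  | n + 1, 1 =>
    rintro _ ⟨x, rfl⟩
    refine ⟨0, ?_⟩
    rw [map_zero, (D.exact_q_δ n).apply_apply_eq_zero]
  | 0, i + 2 => exact le_top
  | n + 1, i + 2 => exact le_top

/-- In degrees 0 and 1 the filtration is exhausted early, because homology is right exact in degree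
0: `q 0` and `u 0` are surjective. -/
theorem fil_top (n : ℕ) : D.fil n (n + 1) = ⊤ := by
  match n with
  | 0 => exact LinearMap.range_eq_top.2 D.q_surjective
  | 1 =>
    have h : LinearMap.range (D.u 0) = ⊤ := LinearMap.range_eq_top.2 D.u_surjective
    change (LinearMap.range (D.u 0)).comap (D.δ 0) = ⊤
    rw [h, Submodule.comap_top]
  | n + 2 => rfl

/-- The graded pieces of the filtration. -/
abbrev gr (n i : ℕ) : Type u :=
  D.fil n (i + 1) ⧸ (D.fil n i).submoduleOf (D.fil n (i + 1))

/-- The projection to the graded pieces. -/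
def toGr (n i : ℕ) : D.fil n (i + 1) →ₗ[𝒪] D.gr n i :=
  ((D.fil n i).submoduleOf (D.fil n (i + 1))).mkQ

theorem toGr_surjective (n i : ℕ) : Function.Surjective (D.toGr n i) :=
  Submodule.mkQ_surjective _

theorem toGr_eq_zero (n i : ℕ) (x : D.fil n (i + 1)) : D.toGr n i x = 0 ↔ (x : D.Q n) ∈ D.fil n i := by
  rw [toGr, Submodule.mkQ_apply, Submodule.Quotient.mk_eq_zero]
  rfl

/-- The surjection from `H` to the first graded piece. -/
def zeroGr (n : ℕ) : D.H n →ₗ[𝒪] D.gr n 0 :=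
  D.toGr n 0 ∘ₗ (D.q n).codRestrict _ fun x => LinearMap.mem_range_self (D.q n) x

theorem zeroGr_surjective (n : ℕ) : Function.Surjective (D.zeroGr n) := by
  refine (D.toGr_surjective n 0).comp ?_
  rintro ⟨_, x, rfl⟩
  exact ⟨x, rfl⟩

theorem zeroGr_eq_zero (n : ℕ) (x : D.H n) :
    D.zeroGr n x = 0 ↔ x ∈ LinearMap.range (D.v n) := by
  rw [zeroGr, LinearMap.comp_apply, toGr_eq_zero]
  exact (D.exact_v_q n x)

/-- The homology of the second page at a position where the outgoing differential is zero. -/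
theorem exists_surjective_homology (x : ℕ × ℕ) (hx : x.1 ≠ 2) :
    ∃ f : D.E₂ x →ₗ[𝒪] D.page₂.homology x, Function.Surjective f ∧ ∀ a, f a = 0 ↔
      a ∈ LinearMap.range (D.d ((ComplexShape.spectralSequenceNat (-(2 : ℤ), (2 : ℤ) - 1)).prev x) x).hom := by
  have h0 : (D.page₂.sc x).g = 0 := D.d_eq_zero fun h _ _ => hx h
  refine ⟨homMk (D.page₂.sc x) ∘ₗ LinearMap.id.codRestrict (LinearMap.ker (D.page₂.sc x).g.hom)
    fun a => ?_, (homMk_surjective _).comp fun a => ⟨a.1, rfl⟩, fun a => homMk_eq_zero _ _⟩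
  rw [h0]
  rfl

theorem prev_zero_succ (j : ℕ) :
    (ComplexShape.spectralSequenceNat (-(2 : ℤ), (2 : ℤ) - 1)).prev (0, j + 1) = (2, j) := by
  apply ComplexShape.prev_eq'
  rw [ComplexShape.spectralSequenceNat_rel_iff]
  simp

/-- Dividing H_n by the image of `kosD₁ = v ∘ u`, and then by that of the differential, which is
induced by `v`, amounts to dividing by the image of `v`; and H_n / im v is im q = F₀. For n = 0
there is no incoming differential, but `u 0` is surjective. -/
theorem nonempty_zero (n : ℕ) : Nonempty (D.page₂.homology (0, n) ≃ₗ[𝒪] D.gr n 0) := by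
  obtain ⟨f, hf, hf0⟩ := D.exists_surjective_homology (0, n) (by simp)
  refine nonempty_equiv_of_ker_eq (f ∘ₗ D.zeroE₂ n) (D.zeroGr n)
    (hf.comp (D.zeroE₂_surjective n)) (D.zeroGr_surjective n) fun a => ?_
  rw [zeroGr_eq_zero, LinearMap.comp_apply, hf0]
  match n with
  | 0 =>
    rw [D.d_eq_zero (by simp), ModuleCat.hom_zero, LinearMap.range_zero, Submodule.mem_bot,
      zeroE₂_eq_zero]
    constructor
    · rintro ⟨y, rfl⟩
      exact ⟨_, D.v_u 0 y⟩
    · rintro ⟨y, rfl⟩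
      obtain ⟨z, rfl⟩ := D.u_surjective y
      exact ⟨z, (D.v_u 0 z).symm⟩
  | j + 1 =>
    rw [prev_zero_succ, d_two, ModuleCat.hom_ofHom]
    constructor
    · rintro ⟨y, hy⟩
      obtain ⟨z, rfl⟩ := D.toE₂_surjective j y
      rw [d₂_apply, ← sub_eq_zero, ← map_sub, zeroE₂_eq_zero] at hy
      obtain ⟨w, hw⟩ := hy
      refine ⟨z - D.u _ w, ?_⟩
      rw [map_sub, D.v_u, hw]
      abel
    · rintro ⟨y, rfl⟩
      exact ⟨_, D.d₂_apply j y⟩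

/-- For n = 0 convergence is already demanded of page 2 itself, so the corner needs a version before
passing to homology. -/
theorem nonempty_zero_zero : Nonempty (D.E₂ (0, 0) ≃ₗ[𝒪] D.gr 0 0) := by
  refine nonempty_equiv_of_ker_eq (D.zeroE₂ 0) (D.zeroGr 0)
    (D.zeroE₂_surjective 0) (D.zeroGr_surjective 0) fun a => ?_
  rw [zeroGr_eq_zero, zeroE₂_eq_zero]
  constructor
  · rintro ⟨y, rfl⟩
    exact ⟨_, D.v_u 0 y⟩
  · rintro ⟨y, rfl⟩
    obtain ⟨z, rfl⟩ := D.u_surjective y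
    exact ⟨z, (D.v_u 0 z).symm⟩

/-- No differential touches column 1. Its term ker `kosD₁` / im `kosD₂` is compared with F₁ / F₀
through the pairs (x, y) with δ x = u y. As v (u y) = `kosD₁` y, exactness makes both projections
surjective, and the conditions x ∈ im q, δ x = u y = 0 and y ∈ im `kosD₂` are equivalent. -/
theorem nonempty_one (m : ℕ) : Nonempty (D.page₂.homology (1, m) ≃ₗ[𝒪] D.gr (m + 1) 1) := by
  obtain ⟨f, hf, hf0⟩ := D.exists_surjective_homology (1, m) (by simp)
  rw [D.d_eq_zero (by simp), ModuleCat.hom_zero, LinearMap.range_zero] at hf0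
  let A : Submodule 𝒪 (D.Q (m + 1) × (D.H m × D.H m)) :=
    LinearMap.ker (D.δ m ∘ₗ LinearMap.fst 𝒪 _ _ - D.u m ∘ₗ LinearMap.snd 𝒪 _ _)
  have hA : ∀ a : A, D.δ m a.1.1 = D.u m a.1.2 := fun a => sub_eq_zero.1 a.2
  let g₁ : A →ₗ[𝒪] D.fil (m + 1) 2 := (LinearMap.fst 𝒪 _ _ ∘ₗ A.subtype).codRestrict _
    fun a => ⟨a.1.2, (hA a).symm⟩
  let g₂ : A →ₗ[𝒪] LinearMap.ker (kosD₁ (D.s m) (D.t m)) :=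
    (LinearMap.snd 𝒪 _ _ ∘ₗ A.subtype).codRestrict _ fun a => by
      change kosD₁ (D.s m) (D.t m) a.1.2 = 0
      rw [← D.v_u, ← hA, (D.exact_δ_v m).apply_apply_eq_zero]
  have hg₁ : Function.Surjective g₁ := by
    rintro ⟨x, y, hy⟩
    exact ⟨⟨(x, y), sub_eq_zero.2 hy.symm⟩, rfl⟩
  have hg₂ : Function.Surjective g₂ := by
    rintro ⟨y, hy⟩
    have hy' : kosD₁ (D.s m) (D.t m) y = 0 := hy
    rw [← D.v_u] at hy'
    obtain ⟨x, hx⟩ := (D.exact_δ_v m _).1 hy'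
    exact ⟨⟨(x, y), sub_eq_zero.2 hx⟩, rfl⟩
  let m₁ : LinearMap.ker (kosD₁ (D.s m) (D.t m)) →ₗ[𝒪] D.E₂ (1, m) := hlgMk _ _
  refine nonempty_equiv_of_ker_eq (f ∘ₗ m₁ ∘ₗ g₂)
    (D.toGr (m + 1) 1 ∘ₗ g₁) (hf.comp ((hlgMk_surjective _ _).comp hg₂))
    ((D.toGr_surjective _ _).comp hg₁) fun a => ?_
  rw [LinearMap.comp_apply, LinearMap.comp_apply, LinearMap.comp_apply, hf0, Submodule.mem_bot,
    toGr_eq_zero]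
  refine (hlgMk_eq_zero _ _ _).trans ?_
  change a.1.2 ∈ LinearMap.range (kosD₂ (D.s m) (D.t m)) ↔ a.1.1 ∈ LinearMap.range (D.q (m + 1))
  exact ((D.exact_d_u m _).symm.trans (by rw [hA])).trans (D.exact_q_δ m a.1.1)

/-- What survives of column 2 is the kernel of `d₂`. By exactness at K, the connecting map δ
followed by K → column 2 sends Q onto this kernel, and it annihilates exactly δ⁻¹(ker e) = δ⁻¹(im u)
= F₁. -/
theorem nonempty_two (j : ℕ) : Nonempty (D.page₂.homology (2, j) ≃ₗ[𝒪] D.gr (j + 2) 2) := by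
  have hn : (ComplexShape.spectralSequenceNat (-(2 : ℤ), (2 : ℤ) - 1)).next (2, j) = (0, j + 1) := by
    apply ComplexShape.next_eq'
    rw [ComplexShape.spectralSequenceNat_rel_iff]
    simp
  let S := D.page₂.sc' ((ComplexShape.spectralSequenceNat (-(2 : ℤ), (2 : ℤ) - 1)).prev (2, j)) (2, j)
    (0, j + 1)
  let iso : D.page₂.homology (2, j) ≅ S.homology :=
    ShortComplex.homologyMapIso (D.page₂.isoSc' _ _ _ rfl hn)
  have hS : ∀ a, homMk S a = 0 ↔ a = 0 := fun a => by
    rw [homMk_eq_zero]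
    have : S.f = 0 := D.d_eq_zero (by simp)
    rw [this, ModuleCat.hom_zero, LinearMap.range_zero, Submodule.mem_bot, Submodule.coe_eq_zero]
  have hg : ∀ y : D.E₂ (2, j), S.g.hom y = D.d₂ j y := fun y =>
    LinearMap.congr_fun (congrArg ModuleCat.Hom.hom (D.d_two j)) y
  let g : D.Q (j + 2) →ₗ[𝒪] LinearMap.ker S.g.hom :=
    (D.toE₂ j ∘ₗ D.δ (j + 1)).codRestrict _ fun x => by
      refine (hg _).trans ?_
      rw [LinearMap.comp_apply, d₂_apply, (D.exact_δ_v (j + 1)).apply_apply_eq_zero, map_zero]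
      rfl
  have hgs : Function.Surjective g := by
    rintro ⟨y, hy⟩
    have hy' : D.d₂ j y = 0 := (hg y).symm.trans hy
    obtain ⟨z, rfl⟩ := D.toE₂_surjective j y
    rw [d₂_apply, zeroE₂_eq_zero] at hy'
    obtain ⟨w, hw⟩ := hy'
    rw [← D.v_u, ← sub_eq_zero, ← map_sub] at hw
    obtain ⟨x, hx⟩ := (D.exact_δ_v (j + 1) _).1 hw
    -- Exactness provides δ x = u w - z, whence the sign; the term u w dies in column 2.
    refine ⟨-x, Subtype.ext ?_⟩
    change D.toE₂ j (D.δ (j + 1) (-x)) = D.toE₂ j z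
    have h0 : D.toE₂ j (D.u (j + 1) w) = 0 := by
      rw [toE₂_eq_zero, (D.exact_u_e j).apply_apply_eq_zero]
    rw [map_neg, hx, neg_sub, map_sub, h0, sub_zero]
  obtain ⟨i⟩ := nonempty_equiv_of_ker_eq (homMk S ∘ₗ g)
    (D.toGr (j + 2) 2 ∘ₗ LinearMap.id.codRestrict (D.fil (j + 2) 3) fun _ => Submodule.mem_top)
    ((homMk_surjective S).comp hgs) ((D.toGr_surjective _ _).comp fun a => ⟨a.1, rfl⟩) fun a => by
      rw [LinearMap.comp_apply, LinearMap.comp_apply, hS, toGr_eq_zero, ← Submodule.coe_eq_zero]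
      change D.toE₂ j (D.δ (j + 1) a) = 0 ↔ D.δ (j + 1) a ∈ LinearMap.range (D.u (j + 1))
      rw [toE₂_eq_zero]
      exact D.exact_u_e j _
  exact ⟨iso.toLinearEquiv ≪≫ₗ i⟩

theorem nonempty_three (n i j : ℕ) :
    Nonempty (D.page₂.homology (i + 3, j) ≃ₗ[𝒪] D.gr n (i + 3)) := by
  obtain ⟨f, hf, -⟩ := D.exists_surjective_homology (i + 3, j) (by simp)
  have h1 : Subsingleton (D.E₂ (i + 3, j)) := inferInstanceAs (Subsingleton PUnit)
  have h2 : Subsingleton (D.page₂.homology (i + 3, j)) := hf.subsingleton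
  have h4 : D.fil n (i + 3) = ⊤ := by
    match n with
    | 0 => rfl
    | n + 1 => rfl
  have h3 : Subsingleton (D.gr n (i + 3)) := by
    refine subsingleton_of_forall_eq 0 fun x => ?_
    obtain ⟨y, rfl⟩ := D.toGr_surjective _ _ x
    rw [toGr_eq_zero, h4]
    exact Submodule.mem_top
  exact ⟨LinearEquiv.ofSubsingleton _ _⟩

theorem nonempty_homology (i j : ℕ) :
    Nonempty (D.page₂.homology (i, j) ≃ₗ[𝒪] D.gr (i + j) i) := by
  match i with
  | 0 =>
    rw [zero_add]
    exact D.nonempty_zero j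
  | 1 =>
    rw [add_comm]
    exact D.nonempty_one j
  | 2 =>
    rw [add_comm]
    exact D.nonempty_two j
  | i + 3 => exact D.nonempty_three _ i j

theorem page₂_iso (x : ℕ × ℕ) :
    Nonempty ((D.spectralSequence.page 2 le_rfl).X x ≅ kosHomology (D.s x.2) (D.t x.2) x.1) :=
  ⟨eqToIso (by
    change (D.page 2).X x = _
    rw [page_two]
    rfl)⟩

theorem convergesTo : ConvergesTo D.spectralSequence D.Q := by
  intro n
  refine ⟨D.fil n, D.fil_monotone n, rfl, D.fil_top n, ?_⟩
  rintro i j rfl r hr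
  -- The bound r ≥ n + 2 allows r = 2 only at the corner (0, 0).
  by_cases h : r = 2
  · subst h
    obtain ⟨rfl, rfl⟩ : i = 0 ∧ j = 0 := by lia
    obtain ⟨e⟩ := D.nonempty_zero_zero
    obtain ⟨f⟩ := D.page₂_iso (0, 0)
    exact ⟨f ≪≫ e.toModuleIso⟩
  · obtain ⟨e⟩ := D.nonempty_homology i j
    refine ⟨eqToIso ?_ ≪≫ e.toModuleIso⟩
    change (D.page r).X (i, j) = _
    rw [page_of_ne _ r h]
    rfl

end KoszulSequences

end

noncomputable section

/-! ### Classes of cycles in chain complexes. -/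

section ChainComplexes

variable {𝒪 : Type*} [Ring 𝒪]

/-- The description of the short complexes attached to a chain complex. -/
def chainSc (𝒪 : Type*) [Ring 𝒪] (i : ℕ) :
    HomologicalComplex.shortComplexFunctor (ModuleCat.{u} 𝒪) (ComplexShape.down ℕ) i ≅
      HomologicalComplex.shortComplexFunctor' (ModuleCat.{u} 𝒪) (ComplexShape.down ℕ)
        (i + 1) i (i - 1) :=
  -- For i = 0 the truncated difference i - 1 is 0 and the differential from 0 to 0 is zero, so
  -- every element of degree 0 counts as a cycle.
  HomologicalComplex.natIsoSc' _ _ _ _ _ (by simp) (by cases i <;> simp)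

/-- The class in homology of a cycle of a chain complex of modules. -/
def cycMk (K : ChainComplex (ModuleCat.{u} 𝒪) ℕ) (i : ℕ) :
    LinearMap.ker (K.d i (i - 1)).hom →ₗ[𝒪] K.homology i :=
  (ShortComplex.homologyMap ((chainSc 𝒪 i).inv.app K)).hom ∘ₗ homMk (K.sc' (i + 1) i (i - 1))

theorem cycMk_surjective (K : ChainComplex (ModuleCat.{u} 𝒪) ℕ) (i : ℕ) :
    Function.Surjective (cycMk K i) :=
  ((ModuleCat.epi_iff_surjective _).1 inferInstance).comp (homMk_surjective _)

theorem cycMk_eq_zero (K : ChainComplex (ModuleCat.{u} 𝒪) ℕ) (i : ℕ)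
    (x : LinearMap.ker (K.d i (i - 1)).hom) :
    cycMk K i x = 0 ↔ (x : K.X i) ∈ LinearMap.range (K.d (i + 1) i).hom := by
  refine (LinearMap.map_eq_zero_iff _ ((ModuleCat.mono_iff_injective _).1 inferInstance)).trans ?_
  exact homMk_eq_zero (K.sc' (i + 1) i (i - 1)) x

theorem homologyMap_cycMk {K K' : ChainComplex (ModuleCat.{u} 𝒪) ℕ} (φ : K ⟶ K') (i : ℕ)
    (x : LinearMap.ker (K.d i (i - 1)).hom) (hx : φ.f i x.1 ∈ LinearMap.ker (K'.d i (i - 1)).hom) :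
    (HomologicalComplex.homologyMap φ i).hom (cycMk K i x) = cycMk K' i ⟨φ.f i x.1, hx⟩ := by
  have h : ShortComplex.homologyMap ((chainSc.{u} 𝒪 i).inv.app K) ≫
      HomologicalComplex.homologyMap φ i =
      ShortComplex.homologyMap
        ((HomologicalComplex.shortComplexFunctor' (ModuleCat.{u} 𝒪) _ (i + 1) i (i - 1)).map φ) ≫
      ShortComplex.homologyMap ((chainSc.{u} 𝒪 i).inv.app K') := by
    refine (ShortComplex.homologyMap_comp _ _).symm.trans
      (Eq.trans ?_ (ShortComplex.homologyMap_comp _ _))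
    have e := (chainSc.{u} 𝒪 i).inv.naturality φ
    congr 1
    exact e.symm
  refine (LinearMap.congr_fun (congrArg ModuleCat.Hom.hom h) _).trans ?_
  exact congrArg _ (homologyMap_homMk
    ((HomologicalComplex.shortComplexFunctor' (ModuleCat.{u} 𝒪) _ (i + 1) i (i - 1)).map φ) x hx)

end ChainComplexes

/-! ### The Koszul complex of a regular pair of endomorphisms as a projective resolution. -/

section KoszulComplex

variable {𝒪 : Type u} [Ring 𝒪] {H : Type u} [AddCommGroup H] [Module 𝒪 H]

/-- The terms of the Koszul complex. -/
def kosX (𝒪 : Type u) [Ring 𝒪] (H : Type u) [AddCommGroup H] [Module 𝒪 H] : ℕ → ModuleCat.{u} 𝒪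
  | 0 => ModuleCat.of 𝒪 H
  | 1 => ModuleCat.of 𝒪 (H × H)
  | 2 => ModuleCat.of 𝒪 H
  | _ + 3 => ModuleCat.of 𝒪 PUnit

/-- The differentials of the Koszul complex. -/
def kosD (s t : Module.End 𝒪 H) : ∀ n, kosX 𝒪 H (n + 1) ⟶ kosX 𝒪 H n
  | 0 => ModuleCat.ofHom (kosD₁ s t)
  | 1 => ModuleCat.ofHom (kosD₂ s t)
  | _ + 2 => 0

theorem kosD₁_kosD₂ {s t : Module.End 𝒪 H} (h : ∀ x, s (t x) = t (s x)) (x : H) :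
    kosD₁ s t (kosD₂ s t x) = 0 :=
  sub_eq_zero.2 (h x).symm

/-- The Koszul complex of two commuting endomorphisms. -/
def kosComplex (s t : Module.End 𝒪 H) (h : ∀ x, s (t x) = t (s x)) :
    ChainComplex (ModuleCat.{u} 𝒪) ℕ :=
  ChainComplex.of (kosX 𝒪 H) (kosD s t) fun n => by
    match n with
    | 0 => exact ModuleCat.hom_ext (LinearMap.ext fun x => kosD₁_kosD₂ h x)
    | n + 1 => exact Limits.zero_comp

theorem kosComplex_d (s t : Module.End 𝒪 H) (h : ∀ x, s (t x) = t (s x)) (n : ℕ) :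
    (kosComplex s t h).d (n + 1) n = kosD s t n :=
  ChainComplex.of_d _ _ _

/-- The components of the endomorphism of the Koszul complex induced by an endomorphism. -/
def kosXMap (f : Module.End 𝒪 H) : ∀ n, kosX 𝒪 H n ⟶ kosX 𝒪 H n
  | 0 => ModuleCat.ofHom f
  | 1 => ModuleCat.ofHom (LinearMap.prodMap f f)
  | 2 => ModuleCat.ofHom f
  | _ + 3 => 𝟙 _

/-- The endomorphism of the Koszul complex induced by an endomorphism commuting with `s`, `t`. -/
def kosMap (s t : Module.End 𝒪 H) (h : ∀ x, s (t x) = t (s x)) (f : Module.End 𝒪 H)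
    (hs : ∀ x, f (s x) = s (f x)) (ht : ∀ x, f (t x) = t (f x)) :
    kosComplex s t h ⟶ kosComplex s t h :=
  ChainComplex.ofHom (kosXMap f) fun n => by
    rw [kosComplex_d]
    match n with
    | 0 =>
      refine ModuleCat.hom_ext (LinearMap.ext fun (x : H × H) => ?_)
      change t (f x.1) - s (f x.2) = f (t x.1 - s x.2)
      rw [map_sub, hs, ht]
    | 1 =>
      refine ModuleCat.hom_ext (LinearMap.ext fun (x : H) => ?_)
      exact Prod.ext (hs x).symm (ht x).symm
    | n + 2 => exact Limits.comp_zero.trans Limits.zero_comp.symm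

variable {Z : ModuleCat.{u} 𝒪}

/-- The Koszul complex of a regular sequence on a projective module, as a projective resolution. -/
def kosResolution [Module.Projective 𝒪 H] (s t : Module.End 𝒪 H) (h : ∀ x, s (t x) = t (s x))
    (hs : Function.Injective s) (hst : ∀ a b, t a = s b → ∃ c, a = s c)
    (π : H →ₗ[𝒪] Z) (hπ : Function.Surjective π)
    (hex : Function.Exact (kosD₁ s t) π) : ProjectiveResolution Z where
  complex := kosComplex s t h
  projective n := by
    change Projective (kosX 𝒪 H n)
    rw [← IsProjective.iff_projective]
    match n with
    | 0 => exact inferInstanceAs (Module.Projective 𝒪 H)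
    | 1 => exact inferInstanceAs (Module.Projective 𝒪 (H × H))
    | 2 => exact inferInstanceAs (Module.Projective 𝒪 H)
    | n + 3 => exact inferInstanceAs (Module.Projective 𝒪 PUnit.{u + 1})
  π := (ChainComplex.toSingle₀Equiv _ _).symm ⟨ModuleCat.ofHom π, by
    rw [kosComplex_d]
    exact ModuleCat.hom_ext (LinearMap.ext fun x => hex.apply_apply_eq_zero x)⟩
  quasiIso := ⟨fun n => by
    cases n with
    | zero =>
      rw [ChainComplex.quasiIsoAt₀_iff, ShortComplex.quasiIso_iff_of_zeros']
      · refine (ShortComplex.exact_and_epi_g_iff_of_iso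
          (S₂ := ShortComplex.mk (kosD s t 0) (ModuleCat.ofHom π : kosX 𝒪 H 0 ⟶ Z)
            (ModuleCat.hom_ext (LinearMap.ext fun x => hex.apply_apply_eq_zero x))) ?_).2 ⟨?_, ?_⟩
        · refine ShortComplex.isoMk (Iso.refl _) (Iso.refl _) (Iso.refl _) ?_ ?_
          · exact (Category.id_comp _).trans ((kosComplex_d s t h 0).symm.trans
              (Category.comp_id _).symm)
          · refine (Category.id_comp _).trans (Eq.trans ?_ (Category.comp_id _).symm)
            exact (ChainComplex.toSingle₀Equiv_symm_apply_f_zero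
              (C := kosComplex s t h) (ModuleCat.ofHom π) _).symm
        · exact (ShortComplex.moduleCat_exact_iff _).2 fun x hx => (hex x).1 hx
        · exact (ModuleCat.epi_iff_surjective _).2 hπ
      all_goals rfl
    | succ n =>
      rw [quasiIsoAt_iff_exactAt']
      · rw [HomologicalComplex.exactAt_iff' _ (n + 1 + 1) (n + 1) n (by simp) (by simp),
          ShortComplex.moduleCat_exact_iff]
        intro x hx
        have hx' : (kosD s t n).hom x = 0 := by
          rw [← kosComplex_d s t h]
          exact hx
        have key : ∃ y, (kosD s t (n + 1)).hom y = x := by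
          match n with
          | 0 =>
            -- From t a = s b follow a = s c and s (t c) = t (s c) = s b; cancelling s gives b = t
            -- c.
            obtain ⟨a, b⟩ : H × H := x
            have hab : t a = s b := sub_eq_zero.1 hx'
            obtain ⟨c, rfl⟩ := hst a b hab
            refine ⟨c, Prod.ext rfl (hs ?_)⟩
            exact (h c).trans hab
          | 1 =>
            refine ⟨0, ?_⟩
            have h1 : s x = 0 := congrArg Prod.fst hx'
            rw [map_zero]
            exact (hs (h1.trans (map_zero s).symm)).symm
          | n + 2 => exact ⟨0, rfl⟩
        obtain ⟨y, hy⟩ := key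
        refine ⟨y, ?_⟩
        rw [← kosComplex_d s t h] at hy
        exact hy
      · apply ChainComplex.exactAt_succ_single_obj⟩

theorem kosResolution_π_f [Module.Projective 𝒪 H] (s t : Module.End 𝒪 H)
    (h : ∀ x, s (t x) = t (s x))
    (hs : Function.Injective s) (hst : ∀ a b, t a = s b → ∃ c, a = s c)
    (π : H →ₗ[𝒪] Z) (hπ : Function.Surjective π)
    (hex : Function.Exact (kosD₁ s t) π) :
    (kosResolution s t h hs hst π hπ hex).π.f 0 = ModuleCat.ofHom π :=
  ChainComplex.toSingle₀Equiv_symm_apply_f_zero (C := kosComplex s t h) (ModuleCat.ofHom π) _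

end KoszulComplex

end

noncomputable section

/-! ### Regularity of the sequence T - τ, S - σ in R[T, S]. -/

section Polynomials

open MvPolynomial

variable {R : Type u} [CommRing R]

/-- R may have zero divisors, so unique factorization is not available and coefficients are compared
instead. If X 1 does not divide a monomial m, the coefficient of a at m is that of X 1 * b at X 0 *
m, a monomial not involving X 1. -/
theorem X_one_dvd_of_X_zero_mul {a b : MvPolynomial (Fin 2) R} (h : X 0 * a = X 1 * b) :
    X 1 ∣ a := by
  rw [X_dvd_iff_modMonomial_eq_zero]
  ext m
  rw [coeff_zero]
  by_cases hm : Finsupp.single 1 1 ≤ m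
  · exact coeff_modMonomial_of_le _ hm
  · rw [coeff_modMonomial_of_not_le _ hm, ← coeff_X_mul m 0, h, coeff_X_mul', if_neg]
    intro h1
    refine hm (Finsupp.single_le_iff.2 ?_)
    rw [Finsupp.mem_support_iff] at h1
    simpa [Nat.one_le_iff_ne_zero] using h1

/-- The translation of the variables. -/
def shift (c : Fin 2 → R) : MvPolynomial (Fin 2) R →ₐ[R] MvPolynomial (Fin 2) R :=
  aeval fun i => X i + C (c i)

theorem shift_shift (c : Fin 2 → R) (a : MvPolynomial (Fin 2) R) :
    shift (-c) (shift c a) = a := by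
  have : (shift (-c)).comp (shift c) = AlgHom.id R _ := by
    ext i
    simp [shift]
  exact DFunLike.congr_fun this a

theorem shift_injective (c : Fin 2 → R) : Function.Injective (shift c) :=
  Function.LeftInverse.injective (shift_shift c)

/-- A translation of the variables turns X i - τ into X i, which is a nonzerodivisor over any R. -/
theorem eq_zero_of_X_sub_C_mul (τ : R) (i : Fin 2) {a : MvPolynomial (Fin 2) R}
    (h : (X i - C τ) * a = 0) : a = 0 := by
  apply shift_injective fun _ => τ
  have := congrArg (shift fun _ => τ) h
  rw [map_mul, map_zero] at this
  rw [map_zero]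
  refine (isRegular_X (n := i)).left ?_
  simpa [shift] using this

/-- The second half of regularity, injectivity of T - τ modulo S - σ; translating both variables
reduces it to τ = σ = 0. -/
theorem exists_of_X_sub_C_mul (τ σ : R) {a b : MvPolynomial (Fin 2) R}
    (h : (X 0 - C τ) * a = (X 1 - C σ) * b) : ∃ c, a = (X 1 - C σ) * c := by
  have := congrArg (shift ![τ, σ]) h
  rw [map_mul, map_mul] at this
  obtain ⟨c, hc⟩ := X_one_dvd_of_X_zero_mul (a := shift ![τ, σ] a) (b := shift ![τ, σ] b)
    (by simpa [shift] using this)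
  refine ⟨shift (-![τ, σ]) c, ?_⟩
  rw [← shift_shift ![τ, σ] a, hc, map_mul]
  congr 1
  simp [shift, sub_eq_add_neg]

end Polynomials

section Operators

variable {R : Type u} [CommRing R] {X : Type}

theorem opModule_algebraMap_smul {V : Type u} [AddCommGroup V] [Module R V]
    (ops : X → Module.End R V) (c : R) (v : V) :
    (algebraMap R (FreeAlgebra R X) c • (show opModule V ops from v) : opModule V ops) =
      LinearMap.lsmul R V c v := by
  change FreeAlgebra.lift R ops (algebraMap R _ c) v = LinearMap.lsmul R V c v
  rw [AlgHom.commutes]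
  rfl

theorem opModule_ι_smul {V : Type u} [AddCommGroup V] [Module R V]
    (ops : X → Module.End R V) (x : X) (v : V) :
    (FreeAlgebra.ι R x • (show opModule V ops from v) : opModule V ops) = ops x v := by
  change FreeAlgebra.lift R ops (FreeAlgebra.ι R x) v = ops x v
  rw [FreeAlgebra.lift_ι_apply]

/-- An additive map commuting with the generators is linear over the free algebra. -/
def freeAlgebraLinear {M N : Type*} [AddCommGroup M] [AddCommGroup N] [Module (FreeAlgebra R X) M]
    [Module (FreeAlgebra R X) N] (f : M →+ N)
    (h₁ : ∀ (c : R) m, f (algebraMap R (FreeAlgebra R X) c • m) = algebraMap R (FreeAlgebra R X) c • f m)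
    (h₂ : ∀ (x : X) m, f (FreeAlgebra.ι R x • m) = FreeAlgebra.ι R x • f m) :
    M →ₗ[FreeAlgebra R X] N where
  toFun := f
  map_add' := map_add f
  map_smul' a m := by
    rw [RingHom.id_apply]
    induction a using FreeAlgebra.induction generalizing m with
    | grade0 c => exact h₁ c m
    | grade1 x => exact h₂ x m
    | mul a b ha hb => rw [mul_smul, mul_smul, ha, hb]
    | add a b ha hb => rw [add_smul, add_smul, map_add, ha, hb]

/-- A linear map commuting with the operators. -/
def opHom {V W : Type u} [AddCommGroup V] [Module R V] [AddCommGroup W] [Module R W]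
    (ops : X → Module.End R V) (ops' : X → Module.End R W) (f : V →ₗ[R] W)
    (h : ∀ x v, f (ops x v) = ops' x (f v)) : opModule V ops →ₗ[FreeAlgebra R X] opModule W ops' :=
  freeAlgebraLinear (M := opModule V ops) (N := opModule W ops') f.toAddMonoidHom
    (fun c v => (congrArg f (opModule_algebraMap_smul ops c v)).trans
      ((LinearMap.map_smul f c v).trans (opModule_algebraMap_smul ops' c (f v)).symm))
    (fun x v => (congrArg f (opModule_ι_smul ops x v)).trans
      ((h x v).trans (opModule_ι_smul ops' x (f v)).symm))

end Operators

/-! ### Tor over k[T, S] computed with the Koszul resolution of R[T, S] / (T - τ, S - σ). -/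

section Tor

attribute [local instance] MvPolynomial.algebraMvPolynomial eigenTorModule

variable {k : Type u} [Field k] {R : Type u} [CommRing R] [Algebra k R]

/-- The operator `X i - c` on the polynomial ring. -/
def polyMul (k : Type u) [Field k] [Algebra k R] (f : MvPolynomial (Fin 2) R) :
    Module.End (MvPolynomial (Fin 2) k) (MvPolynomial (Fin 2) R) :=
  LinearMap.mulLeft _ f

theorem polyMul_apply (f g : MvPolynomial (Fin 2) R) : polyMul k f g = f * g :=
  rfl

theorem polyMul_comm (f g h : MvPolynomial (Fin 2) R) :
    polyMul k f (polyMul k g h) = polyMul k g (polyMul k f h) :=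
  mul_left_comm f g h

/-- The projection `R[T, S] → R[T, S] / (T - τ, S - σ)`. -/
def toEigen (k : Type u) [Field k] [Algebra k R] (τ σ : R) :
    MvPolynomial (Fin 2) R →ₗ[MvPolynomial (Fin 2) k] eigenModule k τ σ where
  toFun f := (Ideal.Quotient.mk _ f : EigenRing τ σ)
  map_add' _ _ := rfl
  map_smul' _ _ := rfl

theorem toEigen_surjective (τ σ : R) : Function.Surjective (toEigen k τ σ) :=
  Ideal.Quotient.mk_surjective

theorem toEigen_exact (τ σ : R) : Function.Exact
    (kosD₁ (polyMul k (MvPolynomial.X 1 - MvPolynomial.C σ))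
      (polyMul k (MvPolynomial.X 0 - MvPolynomial.C τ))) (toEigen k τ σ) := by
  intro f
  refine Ideal.Quotient.eq_zero_iff_mem.trans (Ideal.mem_span_pair.trans ?_)
  constructor
  · rintro ⟨a, b, rfl⟩
    -- The Koszul differential has a minus sign on its second component.
    refine ⟨(a, -b), ?_⟩
    change (MvPolynomial.X 0 - MvPolynomial.C τ) * a - (MvPolynomial.X 1 - MvPolynomial.C σ) * -b = _
    ring
  · rintro ⟨⟨a, b⟩, rfl⟩
    refine ⟨a, -b, ?_⟩
    change _ = (MvPolynomial.X 0 - MvPolynomial.C τ) * a - (MvPolynomial.X 1 - MvPolynomial.C σ) * b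
    ring

/-- R[T, S] is the base change of R to k[T, S], and R has a basis over the field k. -/
instance : Module.Free (MvPolynomial (Fin 2) k) (MvPolynomial (Fin 2) R) :=
  Module.Free.of_equiv
    (Algebra.IsPushout.out (R := k) (S := MvPolynomial (Fin 2) k) (R' := R)
      (S' := MvPolynomial (Fin 2) R)).equiv

/-- The Koszul resolution of `R[T, S] / (T - τ, S - σ)` over `k[T, S]`. -/
def eigenResolution (k : Type u) [Field k] [Algebra k R] (τ σ : R) :
    ProjectiveResolution (eigenModule k τ σ) :=
  kosResolution (polyMul k (MvPolynomial.X 1 - MvPolynomial.C σ))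
    (polyMul k (MvPolynomial.X 0 - MvPolynomial.C τ)) (polyMul_comm _ _)
    (fun a b h => sub_eq_zero.1 (eq_zero_of_X_sub_C_mul σ 1
      ((mul_sub _ a b).trans (sub_eq_zero.2 h))))
    (fun _ _ h => exists_of_X_sub_C_mul τ σ h) (toEigen k τ σ) (toEigen_surjective τ σ)
    (toEigen_exact τ σ)

/-- The lift of multiplication by a scalar to the Koszul resolution. -/
def eigenResolutionScalar (k : Type u) [Field k] [Algebra k R] (τ σ c : R) :
    (eigenResolution k τ σ).complex ⟶ (eigenResolution k τ σ).complex :=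
  kosMap _ _ (polyMul_comm _ _) (polyMul k (MvPolynomial.C c)) (polyMul_comm _ _) (polyMul_comm _ _)

/-- This square makes `eigenResolutionScalar` a lift of multiplication by c. The action of R on Tor,
defined by functoriality in the first variable, thus becomes visible on the Koszul complex. -/
theorem eigenResolutionScalar_comm (τ σ c : R) :
    (eigenResolutionScalar k τ σ c).f 0 ≫ (eigenResolution k τ σ).π.f 0 =
      (eigenResolution k τ σ).π.f 0 ≫ eigenModuleScalar k τ σ c := by
  have h : (eigenResolution k τ σ).π.f 0 = ModuleCat.ofHom (toEigen k τ σ) :=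
    kosResolution_π_f _ _ _ _ _ _ _ _
  rw [h]
  refine ModuleCat.hom_ext (LinearMap.ext fun (x : MvPolynomial (Fin 2) R) => ?_)
  change (Ideal.Quotient.mk _ (MvPolynomial.C c * x) : EigenRing τ σ) =
    (MvPolynomial.C c : MvPolynomial (Fin 2) R) • (Ideal.Quotient.mk _ x : EigenRing τ σ)
  rfl

/-- The complex computing `Tor`. -/
abbrev torComplex (τ σ : R) (V : ModuleCat.{u} (MvPolynomial (Fin 2) k)) :
    ChainComplex (ModuleCat.{u} (MvPolynomial (Fin 2) k)) ℕ :=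
  (((MonoidalCategory.tensoringRight _).obj V).mapHomologicalComplex _).obj
    (eigenResolution k τ σ).complex

/-- The isomorphism from `Tor` to the homology of the complex. -/
def torIso (τ σ : R) (V : ModuleCat.{u} (MvPolynomial (Fin 2) k)) (i : ℕ) :
    eigenTor τ σ i V ≅ (torComplex τ σ V).homology i :=
  (eigenResolution k τ σ).isoLeftDerivedObj ((MonoidalCategory.tensoringRight _).obj V) i

/-- The class in `Tor` of a cycle in the Koszul complex. -/
def torMk (τ σ : R) (V : ModuleCat.{u} (MvPolynomial (Fin 2) k)) (i : ℕ) :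
    LinearMap.ker ((torComplex τ σ V).d i (i - 1)).hom →ₗ[MvPolynomial (Fin 2) k] eigenTor τ σ i V :=
  (torIso τ σ V i).inv.hom ∘ₗ cycMk (torComplex τ σ V) i

theorem torMk_surjective (τ σ : R) (V : ModuleCat.{u} (MvPolynomial (Fin 2) k)) (i : ℕ) :
    Function.Surjective (torMk τ σ V i) :=
  (torIso τ σ V i).symm.toLinearEquiv.surjective.comp (cycMk_surjective _ _)

theorem torMk_eq_zero (τ σ : R) (V : ModuleCat.{u} (MvPolynomial (Fin 2) k)) (i : ℕ)
    (x : LinearMap.ker ((torComplex τ σ V).d i (i - 1)).hom) :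
    torMk τ σ V i x = 0 ↔
      (x : (torComplex τ σ V).X i) ∈ LinearMap.range ((torComplex τ σ V).d (i + 1) i).hom := by
  refine ((torIso τ σ V i).symm.toLinearEquiv.map_eq_zero_iff).trans ?_
  exact cycMk_eq_zero (torComplex τ σ V) i x

/-- A derived functor may be evaluated on a morphism with any lift to the chosen resolutions; here
the lift multiplies by the constant c in degrees 0, 1 and 2. -/
theorem smul_torMk (τ σ : R) (V : ModuleCat.{u} (MvPolynomial (Fin 2) k)) (i : ℕ) (c : R)
    (x y : LinearMap.ker ((torComplex τ σ V).d i (i - 1)).hom)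
    (h : y.1 = (MonoidalCategory.whiskerRight
      (kosXMap (polyMul k (MvPolynomial.C c : MvPolynomial (Fin 2) R)) i) V).hom x.1) :
    c • torMk τ σ V i x = torMk τ σ V i y := by
  have h1 := ProjectiveResolution.isoLeftDerivedObj_inv_naturality (eigenModuleScalar k τ σ c)
    _ _ (eigenResolutionScalar k τ σ c) (eigenResolutionScalar_comm τ σ c)
    ((MonoidalCategory.tensoringRight _).obj V) i
  refine (LinearMap.congr_fun (congrArg ModuleCat.Hom.hom h1) (cycMk (torComplex τ σ V) i x)).trans ?_
  refine congrArg (torIso τ σ V i).inv.hom ?_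
  obtain ⟨y, hy⟩ := y
  subst h
  exact homologyMap_cycMk ((((MonoidalCategory.tensoringRight _).obj V).mapHomologicalComplex _).map
    (eigenResolutionScalar k τ σ c)) i x hy

/-- No lift is needed in the second variable: the resolution stays fixed and f acts on the other
tensor factor, by naturality of the comparison with the derived functor. -/
theorem eigenTorMap_torMk (τ σ : R) {V : ModuleCat.{u} (MvPolynomial (Fin 2) k)} (i : ℕ) (f : V ⟶ V)
    (x y : LinearMap.ker ((torComplex τ σ V).d i (i - 1)).hom)
    (h : y.1 = (MonoidalCategory.whiskerLeft
      (kosX (MvPolynomial (Fin 2) k) (MvPolynomial (Fin 2) R) i) f).hom x.1) :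
    eigenTorMap τ σ i f (torMk τ σ V i x) = torMk τ σ V i y := by
  have h1 := ProjectiveResolution.leftDerived_app_eq ((MonoidalCategory.tensoringRight _).map f)
    (eigenResolution k τ σ) i
  have h2 : ((eigenResolution k τ σ).isoLeftDerivedObj
      ((MonoidalCategory.tensoringRight _).obj V) i).inv ≫
      (NatTrans.leftDerived ((MonoidalCategory.tensoringRight _).map f) i).app (eigenModule k τ σ) =
      (HomologicalComplex.homologyFunctor _ (ComplexShape.down ℕ) i).map
        ((NatTrans.mapHomologicalComplex ((MonoidalCategory.tensoringRight _).map f) _).app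
          (eigenResolution k τ σ).complex) ≫ ((eigenResolution k τ σ).isoLeftDerivedObj
      ((MonoidalCategory.tensoringRight _).obj V) i).inv := by
    rw [h1, Iso.inv_hom_id_assoc]
  refine (LinearMap.congr_fun (congrArg ModuleCat.Hom.hom h2) (cycMk (torComplex τ σ V) i x)).trans ?_
  refine congrArg (torIso τ σ V i).inv.hom ?_
  obtain ⟨y, hy⟩ := y
  subst h
  exact homologyMap_cycMk ((NatTrans.mapHomologicalComplex ((MonoidalCategory.tensoringRight _).map f)
    _).app (eigenResolution k τ σ).complex) i x hy

end Tor

end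

noncomputable section

theorem tensor_induction {k : Type u} [Field k] {R : Type u} [CommRing R] [Algebra k R] {V : Type u}
    [AddCommGroup V] [Module k V] {W : Type u} [AddCommGroup W] [Module R W] (E : W ≃ₗ[R] R ⊗[k] V)
    {P : W → Prop} (h0 : P 0) (hadd : ∀ x y, P x → P y → P (x + y))
    (ht : ∀ (c : R) (v : V), P (E.symm (c ⊗ₜ v))) (w : W) : P w := by
  rw [← E.symm_apply_apply w]
  generalize E w = z
  induction z with
  | zero =>
    rw [map_zero]
    exact h0
  | add x y hx hy =>
    rw [map_add]
    exact hadd _ _ hx hy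
  | tmul c v => exact ht c v

section Products

variable {A : Type u} [Ring A] {V : Type u} [AddCommGroup V] [Module A V] (s t : Module.End A V)

theorem kosD₁_comp_inl : (kosD₁ s t ∘ₗ LinearMap.inl A V V : V →ₗ[A] V) = t := by
  ext x
  simp [kosD₁]

theorem kosD₁_comp_inr : (kosD₁ s t ∘ₗ LinearMap.inr A V V : V →ₗ[A] V) = -s := by
  ext x
  simp [kosD₁]

theorem prodMap_self_comp_inl : LinearMap.prodMap s s ∘ₗ LinearMap.inl A V V =
    LinearMap.inl A V V ∘ₗ s := by
  ext x <;> simp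

theorem prodMap_self_comp_inr : LinearMap.prodMap s s ∘ₗ LinearMap.inr A V V =
    LinearMap.inr A V V ∘ₗ s := by
  ext x <;> simp

end Products

/-! ### Comparison of Tor with Koszul homology on R ⊗_k V. -/

section TorKoszul

attribute [local instance] MvPolynomial.algebraMvPolynomial eigenTorModule

variable {k : Type u} [Field k] {R : Type u} [CommRing R] [Algebra k R] (τ σ : R)
  {V : ModuleCat.{u} (MvPolynomial (Fin 2) k)} {X : Type} (f : X → (V ⟶ V))

theorem torComplex_d (i : ℕ) : (torComplex τ σ V).d (i + 1) i =
    MonoidalCategory.whiskerRight (kosD (polyMul k (MvPolynomial.X 1 - MvPolynomial.C σ))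
      (polyMul k (MvPolynomial.X 0 - MvPolynomial.C τ)) i) V :=
  congrArg (fun d => MonoidalCategory.whiskerRight d V) (kosComplex_d _ _ (polyMul_comm _ _) i)

theorem torComplex_d_zero : (torComplex τ σ V).d 0 (0 - 1) = 0 :=
  (torComplex τ σ V).shape _ _ (by simp)

/-- A parametrization of the cycles of the complex computing `Tor` gives a parametrization
of `Tor`. -/
theorem exists_toTor (i : ℕ) {Z : Type u} [AddCommGroup Z] [Module (FreeAlgebra R X) Z]
    (z : Z →+ (torComplex τ σ V).X i) (hz : ∀ m, (torComplex τ σ V).d i (i - 1) (z m) = 0)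
    (hsurj : ∀ y, (torComplex τ σ V).d i (i - 1) y = 0 → ∃ m, z m = y)
    (h₁ : ∀ (c : R) m, z (algebraMap R (FreeAlgebra R X) c • m) = (MonoidalCategory.whiskerRight
      (kosXMap (polyMul k (MvPolynomial.C c : MvPolynomial (Fin 2) R)) i) V).hom (z m))
    (h₂ : ∀ (x : X) m, z (FreeAlgebra.ι R x • m) = (MonoidalCategory.whiskerLeft
      (kosX (MvPolynomial (Fin 2) k) (MvPolynomial (Fin 2) R) i) (f x)).hom (z m)) :
    ∃ Φ : Z →ₗ[FreeAlgebra R X]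
        opModule (eigenTor τ σ i V) (fun x => eigenTorMap τ σ i (f x)),
      Function.Surjective Φ ∧
        ∀ m, Φ m = 0 ↔ z m ∈ LinearMap.range ((torComplex τ σ V).d (i + 1) i).hom := by
  let φ : Z →+ eigenTor τ σ i V :=
    (torMk τ σ V i).toAddMonoidHom.comp (z.codRestrict (LinearMap.ker _) hz)
  have hφ : ∀ m, φ m = torMk τ σ V i ⟨z m, hz m⟩ := fun m => rfl
  refine ⟨freeAlgebraLinear (N := opModule (eigenTor τ σ i V) (fun x => eigenTorMap τ σ i (f x))) φ
    (fun c m => ?_) (fun x m => ?_), ?_, fun m => ?_⟩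
  · refine Eq.trans ?_ (opModule_algebraMap_smul _ c (φ m)).symm
    exact (smul_torMk τ σ V i c ⟨z m, hz m⟩ ⟨z _, hz _⟩ (h₁ c m)).symm
  · refine Eq.trans ?_ (opModule_ι_smul _ x (φ m)).symm
    exact (eigenTorMap_torMk τ σ i (f x) ⟨z m, hz m⟩ ⟨z _, hz _⟩ (h₂ x m)).symm
  · intro y
    obtain ⟨⟨y, hy⟩, rfl⟩ := torMk_surjective τ σ V i y
    obtain ⟨m, rfl⟩ := hsurj y hy
    exact ⟨m, rfl⟩
  · exact torMk_eq_zero τ σ V i ⟨z m, hz m⟩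

variable [Module k V] [IsScalarTower k (MvPolynomial (Fin 2) k) V] {W : Type u} [AddCommGroup W]
  [Module R W] (E : W ≃ₗ[R] R ⊗[k] V)

/-- The isomorphism of `R ⊗_k V` with `R[T, S] ⊗_{k[T, S]} V`. -/
def polyTensor : W ≃ₗ[R] MvPolynomial (Fin 2) R ⊗[MvPolynomial (Fin 2) k] V :=
  E ≪≫ₗ (Algebra.IsPushout.cancelBaseChange k R (MvPolynomial (Fin 2) k) (MvPolynomial (Fin 2) R) V).symm

theorem polyTensor_symm_tmul (c : R) (v : V) :
    polyTensor E (E.symm (c ⊗ₜ v)) = (MvPolynomial.C c : MvPolynomial (Fin 2) R) ⊗ₜ v := by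
  rw [polyTensor, LinearEquiv.trans_apply, LinearEquiv.apply_symm_apply,
    Algebra.IsPushout.cancelBaseChange_symm_tmul]
  rfl

/-- The variable X i belongs to k[T, S] and slides across the tensor sign to act on V, while c stays
with R. The map t is merely additive so that operators linear over the free algebra of Hecke
operators can be inserted. -/
theorem rTensor_X_sub_C (i : Fin 2) (c : R) (t : W →+ W)
    (ht : ∀ (d : R) (v : V), t (E.symm (d ⊗ₜ v)) =
      E.symm (d ⊗ₜ ((MvPolynomial.X i : MvPolynomial (Fin 2) k) • v)) - c • E.symm (d ⊗ₜ v)) (w : W) :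
    (polyMul k (MvPolynomial.X i - MvPolynomial.C c)).rTensor V (polyTensor E w) =
      polyTensor E (t w) := by
  induction w using tensor_induction E with
  | h0 => simp
  | hadd x y hx hy => rw [map_add, map_add, hx, hy, map_add t, map_add]
  | ht d v =>
    have h : (MvPolynomial.X i : MvPolynomial (Fin 2) R) * MvPolynomial.C d =
        (MvPolynomial.X i : MvPolynomial (Fin 2) k) • (MvPolynomial.C d : MvPolynomial (Fin 2) R) := by
      rw [Algebra.smul_def]
      congr 1
      exact (MvPolynomial.map_X _ _).symm
    rw [ht, map_sub, map_smul, polyTensor_symm_tmul, polyTensor_symm_tmul,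
      LinearMap.rTensor_tmul, polyMul_apply, sub_mul, TensorProduct.sub_tmul, h,
      TensorProduct.smul_tmul, TensorProduct.smul_tmul', Algebra.smul_def]
    rfl

theorem rTensor_C (c : R) (w : W) :
    (polyMul k (MvPolynomial.C c)).rTensor V (polyTensor E w) = polyTensor E (c • w) := by
  induction w using tensor_induction E with
  | h0 => simp
  | hadd x y hx hy => rw [map_add, map_add, hx, hy, ← map_add, smul_add]
  | ht d v =>
    rw [map_smul, polyTensor_symm_tmul, LinearMap.rTensor_tmul, polyMul_apply,
      TensorProduct.smul_tmul', Algebra.smul_def]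
    rfl

theorem lTensor_polyTensor (φ : V →ₗ[MvPolynomial (Fin 2) k] V) (g : W →+ W)
    (hg : ∀ (c : R) (v : V), g (E.symm (c ⊗ₜ v)) = E.symm (c ⊗ₜ φ v)) (w : W) :
    φ.lTensor (MvPolynomial (Fin 2) R) (polyTensor E w) = polyTensor E (g w) := by
  induction w using tensor_induction E with
  | h0 => simp
  | hadd x y hx hy => rw [map_add, map_add, hx, hy, map_add g, map_add]
  | ht d v => rw [polyTensor_symm_tmul, LinearMap.lTensor_tmul, hg, polyTensor_symm_tmul]

/-- The isomorphism of `(R ⊗_k V)²` with `R[T, S]² ⊗_{k[T, S]} V`. -/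
def polyTensorProd : W × W ≃+
    (MvPolynomial (Fin 2) R × MvPolynomial (Fin 2) R) ⊗[MvPolynomial (Fin 2) k] V :=
  (AddEquiv.prodCongr (polyTensor E).toAddEquiv (polyTensor E).toAddEquiv).trans
    (TensorProduct.prodLeft (MvPolynomial (Fin 2) k) (MvPolynomial (Fin 2) k)
      (MvPolynomial (Fin 2) R) (MvPolynomial (Fin 2) R) V).symm.toAddEquiv

theorem polyTensorProd_apply (w : W × W) :
    polyTensorProd E w =
      (LinearMap.inl (MvPolynomial (Fin 2) k) (MvPolynomial (Fin 2) R) (MvPolynomial (Fin 2) R)).rTensor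
        V (polyTensor E w.1) +
      (LinearMap.inr (MvPolynomial (Fin 2) k) (MvPolynomial (Fin 2) R) (MvPolynomial (Fin 2) R)).rTensor
        V (polyTensor E w.2) := by
  change (TensorProduct.prodLeft (MvPolynomial (Fin 2) k) (MvPolynomial (Fin 2) k)
      (MvPolynomial (Fin 2) R) (MvPolynomial (Fin 2) R) V).symm (polyTensor E w.1, polyTensor E w.2) = _
  rw [LinearEquiv.symm_apply_eq, map_add]
  have h1 : ∀ x, TensorProduct.prodLeft (MvPolynomial (Fin 2) k) (MvPolynomial (Fin 2) k)
      (MvPolynomial (Fin 2) R) (MvPolynomial (Fin 2) R) V ((LinearMap.inl (MvPolynomial (Fin 2) k)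
        (MvPolynomial (Fin 2) R) (MvPolynomial (Fin 2) R)).rTensor V x) = (x, 0) := fun x => by
    induction x with
    | zero => rw [map_zero, map_zero, Prod.mk_zero_zero]
    | add x y hx hy => rw [map_add, map_add, hx, hy, Prod.mk_add_mk, add_zero]
    | tmul x v => simp
  have h2 : ∀ x, TensorProduct.prodLeft (MvPolynomial (Fin 2) k) (MvPolynomial (Fin 2) k)
      (MvPolynomial (Fin 2) R) (MvPolynomial (Fin 2) R) V ((LinearMap.inr (MvPolynomial (Fin 2) k)
        (MvPolynomial (Fin 2) R) (MvPolynomial (Fin 2) R)).rTensor V x) = (0, x) := fun x => by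
    induction x with
    | zero => rw [map_zero, map_zero, Prod.mk_zero_zero]
    | add x y hx hy => rw [map_add, map_add, hx, hy, Prod.mk_add_mk, add_zero]
    | tmul x v => simp
  rw [h1, h2, Prod.mk_add_mk, add_zero, zero_add]

theorem rTensor_kosD₁ (s t : W →+ W)
    (ht : ∀ (c : R) (v : V), t (E.symm (c ⊗ₜ v)) =
      E.symm (c ⊗ₜ ((MvPolynomial.X 0 : MvPolynomial (Fin 2) k) • v)) - τ • E.symm (c ⊗ₜ v))
    (hs : ∀ (c : R) (v : V), s (E.symm (c ⊗ₜ v)) =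
      E.symm (c ⊗ₜ ((MvPolynomial.X 1 : MvPolynomial (Fin 2) k) • v)) - σ • E.symm (c ⊗ₜ v))
    (w : W × W) :
    (kosD₁ (polyMul k (MvPolynomial.X 1 - MvPolynomial.C σ))
      (polyMul k (MvPolynomial.X 0 - MvPolynomial.C τ))).rTensor V (polyTensorProd E w) =
      polyTensor E (t w.1 - s w.2) := by
  rw [polyTensorProd_apply, map_add, ← LinearMap.comp_apply, ← LinearMap.comp_apply,
    ← LinearMap.rTensor_comp, ← LinearMap.rTensor_comp, kosD₁_comp_inl, kosD₁_comp_inr, map_sub,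
    ← rTensor_X_sub_C E 0 τ t ht, ← rTensor_X_sub_C E 1 σ s hs,
    LinearMap.rTensor_neg, LinearMap.neg_apply]
  exact (sub_eq_add_neg _ _).symm

theorem rTensor_kosD₂ (s t : W →+ W)
    (ht : ∀ (c : R) (v : V), t (E.symm (c ⊗ₜ v)) =
      E.symm (c ⊗ₜ ((MvPolynomial.X 0 : MvPolynomial (Fin 2) k) • v)) - τ • E.symm (c ⊗ₜ v))
    (hs : ∀ (c : R) (v : V), s (E.symm (c ⊗ₜ v)) =
      E.symm (c ⊗ₜ ((MvPolynomial.X 1 : MvPolynomial (Fin 2) k) • v)) - σ • E.symm (c ⊗ₜ v))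
    (w : W) :
    (kosD₂ (polyMul k (MvPolynomial.X 1 - MvPolynomial.C σ))
      (polyMul k (MvPolynomial.X 0 - MvPolynomial.C τ))).rTensor V (polyTensor E w) =
      polyTensorProd E (s w, t w) := by
  rw [polyTensorProd_apply, ← rTensor_X_sub_C E 0 τ t ht,
    ← rTensor_X_sub_C E 1 σ s hs, ← LinearMap.comp_apply, ← LinearMap.comp_apply,
    ← LinearMap.rTensor_comp, ← LinearMap.rTensor_comp, ← LinearMap.add_apply,
    ← LinearMap.rTensor_add]
  congr 2
  ext x : 1
  exact Prod.ext (add_zero _).symm (zero_add _).symm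

/-- The computation of `Tor^{k[T, S]}(R[T, S] / (T - τ, S - σ), V)`, with its action of `R` and of
endomorphisms of `V`, as the homology of a Koszul complex. -/
theorem nonempty_eigenTor_iso [Module (FreeAlgebra R X) W] [IsScalarTower R (FreeAlgebra R X) W]
    (hg : ∀ x (c : R) (v : V), FreeAlgebra.ι R x • E.symm (c ⊗ₜ v) = E.symm (c ⊗ₜ (f x).hom v))
    (s t : Module.End (FreeAlgebra R X) W)
    (ht : ∀ (c : R) (v : V), t (E.symm (c ⊗ₜ v)) =
      E.symm (c ⊗ₜ ((MvPolynomial.X 0 : MvPolynomial (Fin 2) k) • v)) - τ • E.symm (c ⊗ₜ v))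
    (hs : ∀ (c : R) (v : V), s (E.symm (c ⊗ₜ v)) =
      E.symm (c ⊗ₜ ((MvPolynomial.X 1 : MvPolynomial (Fin 2) k) • v)) - σ • E.symm (c ⊗ₜ v)) (i : ℕ) :
    Nonempty (opModule (eigenTor τ σ i V) (fun x => eigenTorMap τ σ i (f x)) ≅
      kosHomology s t i) := by
  suffices h : Nonempty (opModule (eigenTor τ σ i V) (fun x => eigenTorMap τ σ i (f x)) ≃ₗ[FreeAlgebra R X]
      kosHomology s t i) from ⟨h.some.toModuleIso⟩
  -- Under the identifications of the tensored Koszul terms with W and W × W, the differentials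
  -- become those of s and t, and scalars and Hecke operators become the action of the free algebra.
  have hd₁ : ∀ w : W × W, (torComplex τ σ V).d 1 0 (polyTensorProd E w) =
      polyTensor E (kosD₁ s t w) := fun w => by
    rw [torComplex_d τ σ 0]
    exact rTensor_kosD₁ τ σ E s.toAddMonoidHom t.toAddMonoidHom ht hs w
  have hd₂ : ∀ w : W, (torComplex τ σ V).d 2 1 (polyTensor E w) =
      polyTensorProd E (kosD₂ s t w) := fun w => by
    rw [torComplex_d τ σ 1]
    exact rTensor_kosD₂ τ σ E s.toAddMonoidHom t.toAddMonoidHom ht hs w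
  have hk₁ : ∀ (c : R) (m : W), polyTensor E (algebraMap R (FreeAlgebra R X) c • m) =
      (polyMul k (MvPolynomial.C c)).rTensor V (polyTensor E m) := fun c m => by
    rw [algebraMap_smul]
    exact (rTensor_C E c m).symm
  have hk₂ : ∀ (x : X) (m : W), polyTensor E (FreeAlgebra.ι R x • m) =
      (f x).hom.lTensor (MvPolynomial (Fin 2) R) (polyTensor E m) := fun x m =>
    (lTensor_polyTensor E (f x).hom (DistribSMul.toAddMonoidHom W (FreeAlgebra.ι R x)) (hg x) m).symm
  have hp₁ : ∀ (c : R) (m : W × W), polyTensorProd E (algebraMap R (FreeAlgebra R X) c • m) =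
      (LinearMap.prodMap (polyMul k (MvPolynomial.C c)) (polyMul k (MvPolynomial.C c))).rTensor V
        (polyTensorProd E m) := fun c m => by
    rw [polyTensorProd_apply, polyTensorProd_apply]
    refine (congrArg₂ (· + ·) (congrArg _ (hk₁ c m.1)) (congrArg _ (hk₁ c m.2))).trans ?_
    rw [map_add, ← LinearMap.comp_apply, ← LinearMap.comp_apply, ← LinearMap.comp_apply,
      ← LinearMap.comp_apply, ← LinearMap.rTensor_comp, ← LinearMap.rTensor_comp,
      ← LinearMap.rTensor_comp, ← LinearMap.rTensor_comp, prodMap_self_comp_inl,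
      prodMap_self_comp_inr]
  have hp₂ : ∀ (x : X) (m : W × W), polyTensorProd E (FreeAlgebra.ι R x • m) =
      (f x).hom.lTensor (MvPolynomial (Fin 2) R × MvPolynomial (Fin 2) R)
        (polyTensorProd E m) := fun x m => by
    rw [polyTensorProd_apply, polyTensorProd_apply]
    refine (congrArg₂ (· + ·) (congrArg _ (hk₂ x m.1)) (congrArg _ (hk₂ x m.2))).trans ?_
    rw [map_add, ← LinearMap.comp_apply, ← LinearMap.comp_apply, ← LinearMap.comp_apply,
      ← LinearMap.comp_apply, LinearMap.lTensor_comp_rTensor, LinearMap.lTensor_comp_rTensor,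
      LinearMap.rTensor_comp_lTensor, LinearMap.rTensor_comp_lTensor]
  match i with
  | 0 =>
    obtain ⟨Φ, hΦ, hΦ0⟩ := exists_toTor τ σ f 0 (polyTensor E).toAddEquiv.toAddMonoidHom
      (fun m => by rw [torComplex_d_zero]; rfl) (fun y _ => (polyTensor E).surjective y) hk₁ hk₂
    refine nonempty_equiv_of_ker_eq Φ (hlgMk (kosD₁ s t) (0 : _ →ₗ[_] PUnit.{u + 1}) ∘ₗ
      LinearMap.id.codRestrict _ fun _ => rfl) hΦ
      ((hlgMk_surjective _ _).comp fun x => ⟨x.1, rfl⟩) fun a => ?_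
    refine (hΦ0 a).trans (Iff.trans ?_ (hlgMk_eq_zero _ _ _).symm)
    constructor
    · rintro ⟨y, hy⟩
      obtain ⟨w, rfl⟩ := (polyTensorProd E).surjective y
      exact ⟨w, (polyTensor E).injective ((hd₁ w).symm.trans hy)⟩
    · rintro ⟨w, hw⟩
      exact ⟨polyTensorProd E w, (hd₁ w).trans (congrArg (polyTensor E) hw)⟩
  | 1 =>
    have hker : ∀ w : W × W, kosD₁ s t w = 0 ↔
        (torComplex τ σ V).d 1 0 (polyTensorProd E w) = 0 := fun w => by
      rw [hd₁]
      exact (map_eq_zero_iff (polyTensor E) (polyTensor E).injective).symm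
    obtain ⟨Φ, hΦ, hΦ0⟩ := exists_toTor τ σ f 1 (Z := LinearMap.ker (kosD₁ s t))
      ((polyTensorProd E).toAddMonoidHom.comp (LinearMap.ker (kosD₁ s t)).subtype.toAddMonoidHom)
      (fun m => (hker m).1 m.2)
      (fun y hy => by
        obtain ⟨w, rfl⟩ := (polyTensorProd E).surjective y
        exact ⟨⟨w, (hker w).2 hy⟩, rfl⟩) (fun c m => hp₁ c m) (fun x m => hp₂ x m)
    refine nonempty_equiv_of_ker_eq Φ (hlgMk (kosD₂ s t) (kosD₁ s t)) hΦ
      (hlgMk_surjective _ _) fun a => ?_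
    refine (hΦ0 a).trans (Iff.trans ?_ (hlgMk_eq_zero _ _ _).symm)
    constructor
    · rintro ⟨y, hy⟩
      obtain ⟨w, rfl⟩ := (polyTensor E).surjective y
      exact ⟨w, (polyTensorProd E).injective ((hd₂ w).symm.trans hy)⟩
    · rintro ⟨w, hw⟩
      exact ⟨polyTensor E w, (hd₂ w).trans (congrArg (polyTensorProd E) hw)⟩
  | 2 =>
    have hker : ∀ w : W, kosD₂ s t w = 0 ↔
        (torComplex τ σ V).d 2 1 (polyTensor E w) = 0 := fun w => by
      rw [hd₂]
      exact (map_eq_zero_iff (polyTensorProd E) (polyTensorProd E).injective).symm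
    obtain ⟨Φ, hΦ, hΦ0⟩ := exists_toTor τ σ f 2 (Z := LinearMap.ker (kosD₂ s t))
      ((polyTensor E).toAddEquiv.toAddMonoidHom.comp
        (LinearMap.ker (kosD₂ s t)).subtype.toAddMonoidHom)
      (fun m => (hker m).1 m.2)
      (fun y hy => by
        obtain ⟨w, rfl⟩ := (polyTensor E).surjective y
        exact ⟨⟨w, (hker w).2 hy⟩, rfl⟩) (fun c m => hk₁ c m) (fun x m => hk₂ x m)
    refine nonempty_equiv_of_ker_eq Φ (hlgMk (0 : PUnit.{u + 1} →ₗ[_] _) (kosD₂ s t)) hΦ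
      (hlgMk_surjective _ _) fun a => ?_
    refine (hΦ0 a).trans (Iff.trans ?_ (hlgMk_eq_zero _ _ _).symm)
    -- The resolution vanishes in degree 3, so nothing is divided out of the cycles of degree 2.
    have h0 : (torComplex τ σ V).d 3 2 = 0 := by
      rw [torComplex_d τ σ 2]
      exact MonoidalPreadditive.zero_whiskerRight
    rw [h0, ModuleCat.hom_zero, LinearMap.range_zero, LinearMap.range_zero, Submodule.mem_bot,
      Submodule.mem_bot]
    exact map_eq_zero_iff (polyTensor E) (polyTensor E).injective
  | i + 3 =>
    have h0 : Subsingleton ((torComplex τ σ V).X (i + 3)) :=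
      inferInstanceAs (Subsingleton (PUnit.{u + 1} ⊗[MvPolynomial (Fin 2) k] V))
    have h1 : Subsingleton (eigenTor τ σ (i + 3) V) :=
      (torMk_surjective τ σ V (i + 3)).subsingleton
    have h2 : Subsingleton (opModule (eigenTor τ σ (i + 3) V)
      (fun x => eigenTorMap τ σ (i + 3) (f x))) := h1
    have h3 : Subsingleton (kosHomology s t (i + 3)) := inferInstanceAs (Subsingleton PUnit)
    exact ⟨LinearEquiv.ofSubsingleton _ _⟩

end TorKoszul

end

noncomputable section

/-! ### Exactness of coinvariants in the coefficients, for free actions. -/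

section Coefficients

variable {A : Type u} [CommRing A] {P H Y Y' : Type} [Group P] [Group H]
  {M M' M'' : Type u} [AddCommGroup M] [Module A M] [AddCommGroup M'] [Module A M']
  [AddCommGroup M''] [Module A M'']
  {j : H →* P} {act : P →* Equiv.Perm Y} {act' : P →* Equiv.Perm Y'}
  {ρ : Representation A H M} {ρ' : Representation A H M'} {ρ'' : Representation A H M''}

theorem chains_induction {C : Chains j act ρ → Prop} (h0 : C 0)
    (hadd : ∀ x x', C x → C x' → C (x + x')) (hcls : ∀ y m, C (cls j act ρ y m)) (x) : C x := by
  obtain ⟨f, rfl⟩ := Representation.Coinvariants.mk_surjective _ x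
  induction f using Finsupp.induction_linear with
  | zero =>
    rw [map_zero]
    exact h0
  | add f g hf hg =>
    rw [map_add]
    exact hadd _ _ hf hg
  | single y m => exact hcls y m

/-- The map `y ⊗ m ↦ y ⊗ f(m)` induced by an equivariant map `f`. -/
def coeffMap (j : H →* P) (act : P →* Equiv.Perm Y) (f : M →ₗ[A] M')
    (hf : ∀ h m, f (ρ h m) = ρ' h (f m)) : Chains j act ρ →ₗ[A] Chains j act ρ' :=
  liftChains (fun y => cls j act ρ' y ∘ₗ f) fun h y m => by
    rw [LinearMap.comp_apply, hf, cls_smul, LinearMap.comp_apply]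

@[simp]
theorem coeffMap_cls (f : M →ₗ[A] M') (hf : ∀ h m, f (ρ h m) = ρ' h (f m)) (y : Y) (m : M) :
    coeffMap j act f hf (cls j act ρ y m) = cls j act ρ' y (f m) :=
  liftChains_cls _ _ _ _

theorem coeffMap_mapChains (f : M →ₗ[A] M') (hf : ∀ h m, f (ρ h m) = ρ' h (f m)) (a : Y → Y')
    (ha : ∀ z y, a (act z y) = act' z (a y)) :
    coeffMap j act' f hf ∘ₗ mapChains ρ j a ha = mapChains ρ' j a ha ∘ₗ coeffMap j act f hf := by
  apply chains_ext
  intro y m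
  simp

theorem centralOp_cls (z : P) (hz : ∀ w, z * w = w * z) (y : Y) (m : M) :
    centralOp j act ρ z hz (cls j act ρ y m) = cls j act ρ (act z⁻¹ y) m :=
  mapChains_cls _ _ y m

theorem coeffMap_centralOp (f : M →ₗ[A] M') (hf : ∀ h m, f (ρ h m) = ρ' h (f m)) (z : P)
    (hz : ∀ w, z * w = w * z) :
    coeffMap j act f hf ∘ₗ centralOp j act ρ z hz =
      centralOp j act ρ' z hz ∘ₗ coeffMap j act f hf := by
  apply chains_ext
  intro y m
  simp [centralOp]

/-- The cosets indexing the sum depend on the group element alone, so two data with the same g are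
summed over the same set; its finiteness, which decides whether the default value 0 is taken, agrees
as well. -/
theorem coeffMap_op (f : M →ₗ[A] M') (hf : ∀ h m, f (ρ h m) = ρ' h (f m))
    (D : HeckeDatum j ρ) (D' : HeckeDatum j ρ') (hg : D'.g = D.g)
    (hφ : ∀ m, f (D.φ m) = D'.φ (f m)) :
    coeffMap j act f hf ∘ₗ D.op act = D'.op act ∘ₗ coeffMap j act f hf := by
  obtain ⟨g, φ, hc⟩ := D
  obtain ⟨g', φ', hc'⟩ := D'
  change g' = g at hg
  subst hg
  by_cases hfin : Finite (H ⧸ (⟨g', φ, hc⟩ : HeckeDatum j ρ).stab)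
  · let _ := Fintype.ofFinite (H ⧸ (⟨g', φ, hc⟩ : HeckeDatum j ρ).stab)
    let _ : Fintype (H ⧸ (⟨g', φ', hc'⟩ : HeckeDatum j ρ').stab) :=
      inferInstanceAs (Fintype (H ⧸ (⟨g', φ, hc⟩ : HeckeDatum j ρ).stab))
    apply chains_ext
    intro y m
    rw [LinearMap.comp_apply, LinearMap.comp_apply, HeckeDatum.op_cls, coeffMap_cls,
      HeckeDatum.op_cls, map_sum]
    refine Finset.sum_congr rfl fun q _ => ?_
    induction q using QuotientGroup.induction_on with | H x => ?_
    refine (coeffMap_cls f hf _ _).trans (congrArg (cls j act ρ' _) ?_)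
    exact (hφ _).trans (congrArg φ' (hf _ _))
  · rw [HeckeDatum.op_eq_zero _ hfin,
      HeckeDatum.op_eq_zero (⟨g', φ', hc'⟩ : HeckeDatum j ρ') hfin, LinearMap.comp_zero,
      LinearMap.zero_comp]

/-- The relation of lying in the same orbit of `H`. -/
def orbitSetoid (j : H →* P) (act : P →* Equiv.Perm Y) : Setoid Y where
  r y y' := ∃ h, act (j h) y = y'
  iseqv :=
    { refl := fun y => ⟨1, by simp⟩
      symm := by
        rintro y _ ⟨h, rfl⟩
        exact ⟨h⁻¹, by simp⟩
      trans := by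
        rintro y _ _ ⟨h, rfl⟩ ⟨h', rfl⟩
        exact ⟨h' * h, by simp⟩ }

/-- A representative of the orbit of `y`. -/
def orbitRep (j : H →* P) (act : P →* Equiv.Perm Y) (y : Y) : Y :=
  (Quotient.mk (orbitSetoid j act) y).out

theorem exists_orbitRep (j : H →* P) (act : P →* Equiv.Perm Y) (y : Y) :
    ∃ h, act (j h) (orbitRep j act y) = y :=
  Quotient.exact (s := orbitSetoid j act) (Quotient.out_eq _)

theorem orbitRep_act (h : H) (y : Y) : orbitRep j act (act (j h) y) = orbitRep j act y :=
  congrArg Quotient.out (Quotient.sound (s := orbitSetoid j act)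
    ((orbitSetoid j act).symm ⟨h, rfl⟩))

/-- An element of `H` mapping the representative of the orbit of `y` to `y`. -/
def orbitElt (j : H →* P) (act : P →* Equiv.Perm Y) (y : Y) : H :=
  (exists_orbitRep j act y).choose

theorem orbitElt_spec (y : Y) : act (j (orbitElt j act y)) (orbitRep j act y) = y :=
  (exists_orbitRep j act y).choose_spec

/-- By freeness only one element of H carries the representative of the orbit to a given point, and
h times the element for y does so for h y. -/
theorem orbitElt_act (hfree : ∀ (h : H) (y : Y), act (j h) y = y → h = 1) (h : H) (y : Y) :
    orbitElt j act (act (j h) y) = h * orbitElt j act y := by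
  have e := orbitElt_spec (j := j) (act := act) (act (j h) y)
  rw [orbitRep_act] at e
  refine inv_mul_eq_one.1 (hfree _ (orbitRep j act y) ?_)
  rw [map_mul, map_mul, Equiv.Perm.mul_apply, map_mul j h, map_mul, Equiv.Perm.mul_apply,
    orbitElt_spec, map_inv, map_inv, Equiv.Perm.inv_eq_iff_eq]
  exact e.symm

/-- For a free action, the normal form of an element of `A[Y] ⊗_{A[H]} M`: it is supported
on representatives of the orbits. -/
def normalForm (ρ : Representation A H M)
    (hfree : ∀ (h : H) (y : Y), act (j h) y = y → h = 1) : Chains j act ρ →ₗ[A] Y →₀ M :=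
  liftChains (fun y => Finsupp.lsingle (orbitRep j act y) ∘ₗ ρ (orbitElt j act y)⁻¹) fun h y m => by
    rw [orbitRep_act, orbitElt_act hfree, LinearMap.comp_apply, LinearMap.comp_apply,
      ← Module.End.mul_apply, ← map_mul, mul_inv_rev, inv_mul_cancel_right]

/-- `normalForm` is a section of the projection to coinvariants. As it is also natural in M, it
makes A[Y] ⊗_{A[H]} M a natural retract of the finitely supported functions Y → M, from which
exactness is inherited. -/
theorem mk_normalForm (hfree : ∀ (h : H) (y : Y), act (j h) y = y → h = 1) (x : Chains j act ρ) :
    Representation.Coinvariants.mk (diagRep j act ρ) (normalForm ρ hfree x) = x := by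
  suffices h : Representation.Coinvariants.mk (diagRep j act ρ) ∘ₗ normalForm ρ hfree =
      LinearMap.id from LinearMap.congr_fun h x
  apply chains_ext
  intro y m
  rw [LinearMap.comp_apply, normalForm, liftChains_cls]
  change cls j act ρ _ _ = cls j act ρ y m
  rw [← cls_smul (orbitElt j act y), orbitElt_spec, ← Module.End.mul_apply, ← map_mul,
    mul_inv_cancel, map_one, Module.End.one_apply]

theorem normalForm_coeffMap (hfree : ∀ (h : H) (y : Y), act (j h) y = y → h = 1) (f : M →ₗ[A] M')
    (hf : ∀ h m, f (ρ h m) = ρ' h (f m)) (x : Chains j act ρ) :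
    normalForm ρ' hfree (coeffMap j act f hf x) =
      Finsupp.mapRange.linearMap f (normalForm ρ hfree x) := by
  suffices h : normalForm ρ' hfree ∘ₗ coeffMap j act f hf =
      Finsupp.mapRange.linearMap f ∘ₗ normalForm ρ hfree from LinearMap.congr_fun h x
  apply chains_ext
  intro y m
  simp only [LinearMap.comp_apply, coeffMap_cls, normalForm, liftChains_cls, Finsupp.lsingle_apply,
    Finsupp.mapRange.linearMap_apply, Finsupp.mapRange_single, hf]

theorem coeffMap_mk (f : M →ₗ[A] M') (hf : ∀ h m, f (ρ h m) = ρ' h (f m)) (z : Y →₀ M) :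
    coeffMap j act f hf (Representation.Coinvariants.mk (diagRep j act ρ) z) =
      Representation.Coinvariants.mk (diagRep j act ρ') (Finsupp.mapRange.linearMap f z) := by
  suffices h : coeffMap j act f hf ∘ₗ Representation.Coinvariants.mk (diagRep j act ρ) =
      Representation.Coinvariants.mk (diagRep j act ρ') ∘ₗ Finsupp.mapRange.linearMap f from
    LinearMap.congr_fun h z
  ext y m : 2
  refine (coeffMap_cls f hf y m).trans ?_
  simp [cls]

theorem coeffMap_surjective (f : M →ₗ[A] M') (hf : ∀ h m, f (ρ h m) = ρ' h (f m))
    (h : Function.Surjective f) : Function.Surjective (coeffMap j act f hf) := by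
  intro x
  induction x using chains_induction with
  | h0 => exact ⟨0, map_zero _⟩
  | hadd x x' hx hx' =>
    obtain ⟨a, rfl⟩ := hx
    obtain ⟨b, rfl⟩ := hx'
    exact ⟨a + b, map_add _ _ _⟩
  | hcls y m =>
    obtain ⟨m, rfl⟩ := h m
    exact ⟨cls j act ρ y m, coeffMap_cls f hf y m⟩

theorem coeffMap_injective (hfree : ∀ (h : H) (y : Y), act (j h) y = y → h = 1) (f : M →ₗ[A] M')
    (hf : ∀ h m, f (ρ h m) = ρ' h (f m)) (h : Function.Injective f) :
    Function.Injective (coeffMap j act f hf) := by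
  rw [injective_iff_map_eq_zero]
  intro x hx
  have e := normalForm_coeffMap hfree f hf x
  rw [hx, map_zero] at e
  have e' : normalForm ρ hfree x = 0 :=
    Finsupp.mapRange_injective f (map_zero f) h (e.symm.trans (Finsupp.mapRange_zero).symm)
  rw [← mk_normalForm hfree x, e', map_zero]

/-- Normal forms reduce the question to functions on Y, where it is settled pointwise. This is the
freeness of A[Y] over A[H] at work, and the source of all long exact sequences below. -/
theorem coeffMap_exact (hfree : ∀ (h : H) (y : Y), act (j h) y = y → h = 1) (f : M →ₗ[A] M')
    (hf : ∀ h m, f (ρ h m) = ρ' h (f m)) (g : M' →ₗ[A] M'')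
    (hg : ∀ h m, g (ρ' h m) = ρ'' h (g m)) (h : Function.Exact f g) :
    Function.Exact (coeffMap j act f hf) (coeffMap j act g hg) := by
  intro x
  constructor
  · intro hx
    have e := normalForm_coeffMap hfree g hg x
    rw [hx, map_zero] at e
    have h' : ∀ m, g m = 0 → ∃ m', f m' = m := fun m => (h m).1
    obtain ⟨z, hz⟩ : ∃ z, Finsupp.mapRange.linearMap f z = normalForm ρ' hfree x := by
      have hx : ∀ y, g (normalForm ρ' hfree x y) = 0 := fun y =>
        (DFunLike.congr_fun e y).symm
      generalize normalForm ρ' hfree x = w at hx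
      choose l hl using fun y => h' _ (hx y)
      classical
      -- The chosen preimages are replaced by 0 off the support of w, since a chosen preimage of 0
      -- need not vanish.
      refine ⟨Finsupp.onFinset w.support (fun y => if w y = 0 then 0 else l y) fun y hy => ?_, ?_⟩
      · rw [Finsupp.mem_support_iff]
        intro h0
        exact hy (if_pos h0)
      · ext y
        rw [Finsupp.mapRange.linearMap_apply, Finsupp.mapRange_apply, Finsupp.onFinset_apply]
        split_ifs with h0
        · rw [h0, map_zero]
        · exact hl y
    exact ⟨Representation.Coinvariants.mk _ z, by rw [coeffMap_mk, hz, mk_normalForm]⟩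
  · rintro ⟨z, rfl⟩
    induction z using chains_induction with
    | h0 => rw [map_zero, map_zero]
    | hadd x x' hx hx' => rw [map_add, map_add, hx, hx', add_zero]
    | hcls y m => rw [coeffMap_cls, coeffMap_cls, h.apply_apply_eq_zero, map_zero]

end Coefficients

end

noncomputable section

open Representation

/-! ### Long exact sequences in homology, with their Hecke action. -/

section LongExactSequence

variable {A : Type u} [CommRing A]

theorem exact₂_homologyMap {S : ShortComplex (ChainComplex (ModuleCat.{u} A) ℕ)}
    (hS : S.ShortExact) (n : ℕ) :
    Function.Exact (HomologicalComplex.homologyMap S.f n).hom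
      (HomologicalComplex.homologyMap S.g n).hom :=
  (ShortComplex.ShortExact.moduleCat_exact_iff_function_exact _).1 (hS.homology_exact₂ n)

theorem exact₃_homologyMap {S : ShortComplex (ChainComplex (ModuleCat.{u} A) ℕ)}
    (hS : S.ShortExact) (n : ℕ) :
    Function.Exact (HomologicalComplex.homologyMap S.g (n + 1)).hom (hS.δ (n + 1) n rfl).hom :=
  (ShortComplex.ShortExact.moduleCat_exact_iff_function_exact _).1 (hS.homology_exact₃ (n + 1) n rfl)

theorem exact₁_homologyMap {S : ShortComplex (ChainComplex (ModuleCat.{u} A) ℕ)}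
    (hS : S.ShortExact) (n : ℕ) :
    Function.Exact (hS.δ (n + 1) n rfl).hom (HomologicalComplex.homologyMap S.f n).hom :=
  (ShortComplex.ShortExact.moduleCat_exact_iff_function_exact _).1 (hS.homology_exact₁ (n + 1) n rfl)

/-- In degree 0 homology is the full cokernel of the incoming differential, and cokernels preserve
epimorphisms. -/
theorem homologyMap_zero_surjective {S : ShortComplex (ChainComplex (ModuleCat.{u} A) ℕ)}
    (hS : S.ShortExact) : Function.Surjective (HomologicalComplex.homologyMap S.g 0).hom := by
  rw [← ModuleCat.epi_iff_surjective]
  have := hS.epi_g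
  have (K : ChainComplex (ModuleCat.{u} A) ℕ) : IsIso (K.homologyι 0) :=
    ShortComplex.isIso_homologyι (K.sc 0) (K.shape _ _ (by simp))
  have e : Epi (HomologicalComplex.homologyMap S.g 0 ≫ S.X₃.homologyι 0) := by
    rw [HomologicalComplex.homologyι_naturality]
    infer_instance
  exact (epi_comp_iff_of_isIso _ _).1 e

end LongExactSequence

section Functoriality

variable {p : ℕ} [Fact p.Prime] {A : Type u} [CommRing A] {L : Type} [Group L]
  {M M' M'' : Type u} [AddCommGroup M] [Module A M] [AddCommGroup M'] [Module A M']
  [AddCommGroup M''] [Module A M'']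
  (U : Subgroup (GL (Fin 2) (FinAdele p))) (i : L →* GL (Fin 2) ℚ_[p])
  {ρ : Representation A L M} {ρ' : Representation A L M'} {ρ'' : Representation A L M''}

/-- The factor E^{n+1} has at least one coordinate and detects the components in GL₂(ℚ) and GL₂(ℝ)°
by left translation. Once the rational component is trivial, those in GL₂(𝔸^{p∞}) and GL₂(ℚ_p) act
by right translation alone. -/
theorem resAct_free {n : ℕ} (z : BigGroup p) (y : ResSet p n) (h : resAct p n z y = y) : z = 1 := by
  have h1 := congrFun (congrArg Prod.fst h) 0
  have h2 : _ * y.2.1 * z.2.1⁻¹ = y.2.1 := congrArg (fun w => w.2.1) h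
  have h3 : _ * y.2.2.1 * z.2.2.1⁻¹ = y.2.2.1 := congrArg (fun w => w.2.2.1) h
  have h1' : ((z.1, z.2.2.2) : GL (Fin 2) ℚ × Matrix.GLPos (Fin 2) ℝ) = 1 := mul_eq_right.1 h1
  have e1 : z.1 = 1 := congrArg Prod.fst h1'
  have e4 : z.2.2.2 = 1 := congrArg Prod.snd h1'
  rw [e1, map_one, one_mul, mul_eq_left, inv_eq_one] at h2 h3
  exact Prod.ext e1 (Prod.ext h2 (Prod.ext h3 e4))

theorem levelIncl_injective (hi : Function.Injective i) : Function.Injective (levelIncl U i) :=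
  Function.injective_id.prodMap (Subtype.val_injective.prodMap (hi.prodMap Function.injective_id))

theorem levelIncl_free (hi : Function.Injective i) {n : ℕ} (h : LevelGroup U L) (y : ResSet p n)
    (e : resAct p n (levelIncl U i h) y = y) : h = 1 :=
  levelIncl_injective U i hi ((resAct_free _ _ e).trans (map_one _).symm)

set_option linter.unusedSectionVars false in
theorem levelRep_intertwining (f : ρ.IntertwiningMap ρ') (h : LevelGroup U L) (m : M) :
    f.toLinearMap (levelRep U ρ h m) = levelRep U ρ' h (f.toLinearMap m) :=
  IntertwiningMap.isIntertwining _ _ f h.2.2.1 m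

variable {U i}

theorem resChainsMap_cls {m n : ℕ} (f : Fin (m + 1) → Fin (n + 1)) (y : ResSet p n) (v : M) :
    resChainsMap U i ρ f (cls _ _ _ y v) =
      cls (levelIncl U i) (resAct p m) (levelRep U ρ) (resMap f y) v :=
  mapChains_cls (ρ := levelRep U ρ) _ _ y v

/-- The map on simplicial modules induced by a map of representations. -/
def simpMap (f : ρ.IntertwiningMap ρ') : simpChains U i ρ ⟶ simpChains U i ρ' where
  app Δ := ModuleCat.ofHom (coeffMap (levelIncl U i) (resAct p Δ.unop.len) f.toLinearMap
    (fun h m => levelRep_intertwining U f h m))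
  naturality Δ Δ' a := by
    apply ModuleCat.hom_ext
    exact coeffMap_mapChains (ρ := levelRep U ρ) (ρ' := levelRep U ρ') f.toLinearMap
      (fun h m => levelRep_intertwining U f h m) (resMap (p := p) a.unop.toOrderHom)
      (resMap_act a.unop.toOrderHom)

theorem simpChains_hom_ext {X : SimplicialObject (ModuleCat.{u} A)} {f g : simpChains U i ρ ⟶ X}
    (h : ∀ Δ y m, (f.app Δ).hom (cls (levelIncl U i) (resAct p Δ.unop.len) (levelRep U ρ) y m) =
      (g.app Δ).hom (cls (levelIncl U i) (resAct p Δ.unop.len) (levelRep U ρ) y m)) : f = g :=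
  NatTrans.ext (funext fun Δ => ModuleCat.hom_ext (chains_ext (h Δ)))

theorem simpMap_cls (f : ρ.IntertwiningMap ρ') (Δ : SimplexCategoryᵒᵖ) (y : ResSet p Δ.unop.len)
    (m : M) : ((simpMap (U := U) (i := i) f).app Δ).hom
      (cls (levelIncl U i) (resAct p Δ.unop.len) (levelRep U ρ) y m) =
      cls (levelIncl U i) (resAct p Δ.unop.len) (levelRep U ρ') y (f m) :=
  coeffMap_cls _ (levelRep_intertwining U f) _ _

theorem simpMap_comp (f : ρ.IntertwiningMap ρ') (g : ρ'.IntertwiningMap ρ'') :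
    simpMap (U := U) (i := i) (g.comp f) = simpMap f ≫ simpMap g :=
  simpChains_hom_ext fun Δ y m => (simpMap_cls _ Δ y m).trans
    (((congrArg _ (simpMap_cls f Δ y m)).trans (simpMap_cls g Δ y (f m))).symm)

theorem simpMap_id : simpMap (U := U) (i := i) (IntertwiningMap.id ρ) = 𝟙 _ :=
  simpChains_hom_ext fun Δ y m => simpMap_cls _ Δ y m

theorem simpMap_add (f g : ρ.IntertwiningMap ρ') :
    simpMap (U := U) (i := i) (f + g) = simpMap f + simpMap g :=
  simpChains_hom_ext fun Δ y m => (simpMap_cls _ Δ y m).trans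
    ((map_add (cls _ _ _ y) (f m) (g m)).trans
      (congrArg₂ (· + ·) (simpMap_cls f Δ y m) (simpMap_cls g Δ y m)).symm)

theorem simpMap_smul (c : A) : simpMap (U := U) (i := i)
    (LinearMap.intertwiningMap_of_isIntertwiningMap ρ ρ (c • LinearMap.id) fun g v => by simp) =
      c • 𝟙 _ :=
  simpChains_hom_ext fun Δ y m => (simpMap_cls _ Δ y m).trans (map_smul (cls _ _ _ y) c m)

/-- Away from p the Hecke operators leave the coefficients alone, so every map of representations of
L commutes with them. -/
theorem simpMap_genEnd {N : ℕ} (hi : Function.Injective i) (f : ρ.IntertwiningMap ρ')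
    (x : HeckeGen p N) :
    genEnd U i hi ρ x ≫ simpMap f = simpMap f ≫ genEnd U i hi ρ' x := by
  refine NatTrans.ext (funext fun Δ => ModuleCat.hom_ext ?_)
  cases x with
  | T l =>
    exact coeffMap_op f.toLinearMap (levelRep_intertwining U f) (datumAt U i hi ρ l.1)
      (datumAt U i hi ρ' l.1) rfl fun _ => rfl
  | S l =>
    exact coeffMap_centralOp f.toLinearMap (levelRep_intertwining U f) (scalarAt l.1)
      (scalarAt_central l.1)

/-- The short complex of chain complexes given by a sequence of representations. -/
def simpComplex (U : Subgroup (GL (Fin 2) (FinAdele p))) (i : L →* GL (Fin 2) ℚ_[p])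
    (f : ρ.IntertwiningMap ρ') (g : ρ'.IntertwiningMap ρ'') (h : ∀ m, g (f m) = 0) :
    ShortComplex (ChainComplex (ModuleCat.{u} A) ℕ) where
  f := (AlgebraicTopology.alternatingFaceMapComplex _).map (simpMap (U := U) (i := i) f)
  g := (AlgebraicTopology.alternatingFaceMapComplex _).map (simpMap (U := U) (i := i) g)
  zero := by
    rw [← Functor.map_comp, ← simpMap_comp]
    have e : simpMap (U := U) (i := i) (g.comp f) = 0 :=
      simpChains_hom_ext fun Δ y m => (simpMap_cls _ Δ y m).trans
        ((congrArg _ (h m)).trans (map_zero _))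
    rw [e, Functor.map_zero]

/-- Exactness may be checked in each simplicial degree, where it is exactness in the coefficients;
injectivity of `i` is what makes the group act freely there. -/
theorem simpComplex_shortExact (hi : Function.Injective i) (f : ρ.IntertwiningMap ρ')
    (g : ρ'.IntertwiningMap ρ'') (hf : Function.Injective f) (h : Function.Exact f g)
    (hg : Function.Surjective g) :
    (simpComplex U i f g fun m => h.apply_apply_eq_zero m).ShortExact := by
  refine HomologicalComplex.shortExact_of_degreewise_shortExact _ fun n => ?_
  refine ShortComplex.ShortExact.mk' ?_ ?_ ?_
  · rw [ShortComplex.ShortExact.moduleCat_exact_iff_function_exact]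
    exact coeffMap_exact (levelIncl_free U i hi) f.toLinearMap (levelRep_intertwining U f)
      g.toLinearMap (levelRep_intertwining U g) h
  · rw [ModuleCat.mono_iff_injective]
    exact coeffMap_injective (levelIncl_free U i hi) f.toLinearMap
      (levelRep_intertwining U f) hf
  · rw [ModuleCat.epi_iff_surjective]
    exact coeffMap_surjective g.toLinearMap (levelRep_intertwining U g) hg

end Functoriality

section PArithmetic

variable {p : ℕ} [Fact p.Prime] {A : Type u} [CommRing A]
  {M M' M'' : Type u} [AddCommGroup M] [Module A M] [AddCommGroup M'] [Module A M']
  [AddCommGroup M''] [Module A M''] (N : ℕ)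
  (U : Subgroup (GL (Fin 2) (FinAdele p)))
  {π : Representation A (GL (Fin 2) ℚ_[p]) M} {π' : Representation A (GL (Fin 2) ℚ_[p]) M'}
  {π'' : Representation A (GL (Fin 2) ℚ_[p]) M''}

/-- A map of simplicial modules commuting with the Hecke operators induces a map on
`p`-arithmetic homology. -/
def pArithMapOf (φ : simpChains U (MonoidHom.id _) π ⟶ simpChains U (MonoidHom.id _) π')
    (hφ : ∀ x : HeckeGen p N, genEnd U (MonoidHom.id _) Function.injective_id π x ≫ φ =
      φ ≫ genEnd U (MonoidHom.id _) Function.injective_id π' x) (n : ℕ) :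
    pArithHomology N U π n →ₗ[FreeAlgebra A (HeckeGen p N)] pArithHomology N U π' n :=
  opHom _ _ ((simpHomology A n).map φ).hom fun x v => by
    have := (Functor.map_comp (simpHomology A n) _ _).symm.trans
      ((congrArg (simpHomology A n).map (hφ x)).trans (Functor.map_comp (simpHomology A n) _ _))
    exact LinearMap.congr_fun (congrArg ModuleCat.Hom.hom this) v

/-- The map on `p`-arithmetic homology induced by a map of representations. -/
def pArithMap (f : π.IntertwiningMap π') (n : ℕ) :
    pArithHomology N U π n →ₗ[FreeAlgebra A (HeckeGen p N)] pArithHomology N U π' n :=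
  pArithMapOf N U (simpMap f) (simpMap_genEnd _ f) n

theorem pArithMap_comp (f : π.IntertwiningMap π') (g : π'.IntertwiningMap π'') (n : ℕ) :
    pArithMap N U (g.comp f) n = pArithMap N U g n ∘ₗ pArithMap N U f n := by
  refine LinearMap.ext fun v => ?_
  have : (simpHomology A n).map (simpMap (U := U) (i := MonoidHom.id _) (g.comp f)) =
      (simpHomology A n).map (simpMap f) ≫ (simpHomology A n).map (simpMap g) := by
    rw [simpMap_comp, Functor.map_comp]
  exact LinearMap.congr_fun (congrArg ModuleCat.Hom.hom this) v

theorem pArithMap_id (n : ℕ) : pArithMap N U (IntertwiningMap.id π) n = LinearMap.id := by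
  refine LinearMap.ext fun v => ?_
  have : (simpHomology A n).map (simpMap (U := U) (i := MonoidHom.id _) (IntertwiningMap.id π)) =
      𝟙 _ := by
    rw [simpMap_id, CategoryTheory.Functor.map_id]
  exact LinearMap.congr_fun (congrArg ModuleCat.Hom.hom this) v

instance (n : ℕ) : (simpHomology A n).Additive :=
  inferInstanceAs (AlgebraicTopology.alternatingFaceMapComplex (ModuleCat.{u} A) ⋙
    HomologicalComplex.homologyFunctor (ModuleCat.{u} A) (ComplexShape.down ℕ) n).Additive

theorem pArithMap_add (f g : π.IntertwiningMap π') (n : ℕ) :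
    pArithMap N U (f + g) n = pArithMap N U f n + pArithMap N U g n := by
  refine LinearMap.ext fun v => ?_
  have : (simpHomology A n).map (simpMap (U := U) (i := MonoidHom.id _) (f + g)) =
      (simpHomology A n).map (simpMap f) + (simpHomology A n).map (simpMap g) := by
    rw [simpMap_add, Functor.map_add]
  exact LinearMap.congr_fun (congrArg ModuleCat.Hom.hom this) v

theorem pArithMap_zero (n : ℕ) : pArithMap N U (0 : π.IntertwiningMap π') n = 0 := by
  have h := pArithMap_add N U (0 : π.IntertwiningMap π') 0 n
  rwa [add_zero, left_eq_add] at h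

theorem pArithMap_neg (f : π.IntertwiningMap π') (n : ℕ) :
    pArithMap N U (-f) n = -pArithMap N U f n := by
  have h := pArithMap_add N U f (-f) n
  have h0 : f + -f = 0 := IntertwiningMap.ext (add_neg_cancel f.toLinearMap)
  rw [h0, pArithMap_zero] at h
  exact (neg_eq_of_add_eq_zero_right h.symm).symm

variable {U} (f : π.IntertwiningMap π') (g : π'.IntertwiningMap π'')

theorem pArithMap_exact (hf : Function.Injective f) (h : Function.Exact f g)
    (hg : Function.Surjective g) (n : ℕ) :
    Function.Exact (pArithMap N U f n) (pArithMap N U g n) :=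
  exact₂_homologyMap (simpComplex_shortExact Function.injective_id f g hf h hg) n

theorem pArithMap_surjective (hf : Function.Injective f) (h : Function.Exact f g)
    (hg : Function.Surjective g) : Function.Surjective (pArithMap N U g 0) :=
  homologyMap_zero_surjective (simpComplex_shortExact Function.injective_id f g hf h hg)

/-- T_l and S_l act on the whole short exact sequence of complexes and connecting homomorphisms are
natural, so δ is linear over the free algebra on these operators. -/
theorem exists_pArithδ (hf : Function.Injective f) (h : Function.Exact f g)
    (hg : Function.Surjective g) (n : ℕ) :
    ∃ δ : pArithHomology N U π'' (n + 1) →ₗ[FreeAlgebra A (HeckeGen p N)] pArithHomology N U π n,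
      Function.Exact (pArithMap N U g (n + 1)) δ ∧ Function.Exact δ (pArithMap N U f n) := by
  let hS := simpComplex_shortExact (U := U) (i := MonoidHom.id _) Function.injective_id f g hf h hg
  refine ⟨opHom _ _ (hS.δ (n + 1) n rfl).hom fun x v => ?_, exact₃_homologyMap hS n,
    exact₁_homologyMap hS n⟩
  let F := AlgebraicTopology.alternatingFaceMapComplex (ModuleCat.{u} A)
  let φ : simpComplex U (MonoidHom.id _) f g (fun m => h.apply_apply_eq_zero m) ⟶
      simpComplex U (MonoidHom.id _) f g (fun m => h.apply_apply_eq_zero m) :=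
    { τ₁ := F.map (genEnd U (MonoidHom.id _) Function.injective_id π x)
      τ₂ := F.map (genEnd U (MonoidHom.id _) Function.injective_id π' x)
      τ₃ := F.map (genEnd U (MonoidHom.id _) Function.injective_id π'' x)
      comm₁₂ := (F.map_comp _ _).symm.trans
        ((congrArg F.map (simpMap_genEnd _ f x)).trans (F.map_comp _ _))
      comm₂₃ := (F.map_comp _ _).symm.trans
        ((congrArg F.map (simpMap_genEnd _ g x)).trans (F.map_comp _ _)) }
  exact (LinearMap.congr_fun (congrArg ModuleCat.Hom.hom
    (HomologicalComplex.HomologySequence.δ_naturality φ hS hS (n + 1) n rfl)) v).symm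

end PArithmetic

end

noncomputable section

open Representation

/-! ### The spectral sequence of a regular pair of endomorphisms of a representation of G. -/

section Koszul

variable {p : ℕ} [Fact p.Prime] {A : Type u} [CommRing A]
  {M : Type u} [AddCommGroup M] [Module A M] (N : ℕ)
  (U : Subgroup (GL (Fin 2) (FinAdele p))) {π : Representation A (GL (Fin 2) ℚ_[p]) M}

/-- Two commuting endomorphisms `s`, `t` of a representation `π` such that `s` is injective and
`t` is injective modulo `s` give a spectral sequence from the Koszul homology of the `p`-arithmetic
homology of `π` to the `p`-arithmetic homology of `π / (t π + s π)`. -/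
theorem exists_koszul_spectralSequence (s t : π.IntertwiningMap π) (hst : ∀ m, s (t m) = t (s m))
    (hs : Function.Injective s) (ht : ∀ m n, t m = s n → ∃ m', m = s m')
    (I : Submodule A M) (hI : I = LinearMap.range t.toLinearMap ⊔ LinearMap.range s.toLinearMap)
    (hπ : ∀ g, I ≤ I.comap (π g)) :
    ∃ E : HomologicalSS (ModuleCat.{u} (FreeAlgebra A (HeckeGen p N))),
      (∀ i j : ℕ, Nonempty ((E.page 2 le_rfl).X (i, j) ≅
        kosHomology (pArithMap N U s j) (pArithMap N U t j) i)) ∧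
      ConvergesTo E fun n => pArithHomology N U (π.quotient I hπ) n := by
  have htI : ∀ m, t m ∈ I := fun m => hI ▸ Submodule.mem_sup_left ⟨m, rfl⟩
  have hsI : ∀ m, s m ∈ I := fun m => hI ▸ Submodule.mem_sup_right ⟨m, rfl⟩
  let πI := π.subrepresentation I hπ
  let t' : π.IntertwiningMap πI :=
    LinearMap.intertwiningMap_of_isIntertwiningMap _ _ (t.toLinearMap.codRestrict I htI)
      fun g m => Subtype.ext (t.isIntertwining _ _ g m)
  let s' : π.IntertwiningMap πI :=
    LinearMap.intertwiningMap_of_isIntertwiningMap _ _ (s.toLinearMap.codRestrict I hsI)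
      fun g m => Subtype.ext (s.isIntertwining _ _ g m)
  let ι : πI.IntertwiningMap π :=
    LinearMap.intertwiningMap_of_isIntertwiningMap _ _ I.subtype fun g m => rfl
  let q : π.IntertwiningMap (π.quotient I hπ) :=
    LinearMap.intertwiningMap_of_isIntertwiningMap _ _ I.mkQ fun g m => rfl
  let fst := IntertwiningMap.fst A π π
  let snd := IntertwiningMap.snd A π π
  -- The Koszul resolution of π / I is cut into 0 → π → π² → I → 0, with maps d₂ and d₁, and 0 → I →
  -- π → π / I → 0, with maps ι and q.
  let d₁ : (π.prod π).IntertwiningMap πI := t'.comp fst - s'.comp snd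
  let d₂ : π.IntertwiningMap (π.prod π) := s.prod t
  have hd₁ : ∀ m, (d₁ m : M) = t m.1 - s m.2 := fun m => rfl
  have hd₂ : ∀ m, d₂ m = (s m, t m) := fun m => rfl
  have hq : Function.Exact ι q := by
    intro m
    refine (Submodule.Quotient.mk_eq_zero I).trans ⟨fun h => ⟨⟨m, h⟩, rfl⟩, ?_⟩
    rintro ⟨m, rfl⟩
    exact m.2
  have hd₂i : Function.Injective d₂ := fun a b h => hs (congrArg Prod.fst h)
  have hd : Function.Exact d₂ d₁ := by
    intro m
    constructor
    · intro h
      have h' : t m.1 = s m.2 := sub_eq_zero.1 (congrArg Subtype.val h)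
      obtain ⟨a, ha⟩ := ht _ _ h'
      refine ⟨a, Prod.ext ha.symm (hs ?_)⟩
      change s (t a) = s m.2
      rw [hst, ← ha, h']
    · rintro ⟨a, rfl⟩
      exact Subtype.ext (sub_eq_zero.2 (hst a).symm)
  have hd₁s : Function.Surjective d₁ := by
    rintro ⟨m, hm⟩
    rw [hI] at hm
    obtain ⟨_, ⟨a, rfl⟩, _, ⟨b, rfl⟩, rfl⟩ := Submodule.mem_sup.1 hm
    refine ⟨(a, -b), Subtype.ext ?_⟩
    rw [hd₁]
    change t a - s (-b) = t a + s b
    rw [map_neg, sub_neg_eq_add]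
  choose e he₁ he₂ using exists_pArithδ N (U := U) d₂ d₁ hd₂i hd hd₁s
  choose δ hδ₁ hδ₂ using exists_pArithδ N (U := U) ι q Subtype.val_injective hq I.mkQ_surjective
  -- Homology is additive, so w identifies H(π)² with H(π²); it turns d₂ and ι ∘ d₁ into the two
  -- Koszul differentials.
  let w (n : ℕ) : pArithHomology N U π n × pArithHomology N U π n →ₗ[FreeAlgebra A (HeckeGen p N)]
      pArithHomology N U (π.prod π) n :=
    LinearMap.coprod (pArithMap N U (IntertwiningMap.inl A π π) n)
      (pArithMap N U (IntertwiningMap.inr A π π) n)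
  have hw (n : ℕ) : Function.Bijective (w n) := by
    refine Function.bijective_iff_has_inverse.2 ⟨LinearMap.prod (pArithMap N U fst n)
      (pArithMap N U snd n), fun x => ?_, fun x => ?_⟩
    · have h1 := LinearMap.congr_fun (pArithMap_comp N U (IntertwiningMap.inl A π π) fst n) x.1
      have h2 := LinearMap.congr_fun (pArithMap_comp N U (IntertwiningMap.inr A π π) fst n) x.2
      have h3 := LinearMap.congr_fun (pArithMap_comp N U (IntertwiningMap.inl A π π) snd n) x.1
      have h4 := LinearMap.congr_fun (pArithMap_comp N U (IntertwiningMap.inr A π π) snd n) x.2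
      rw [IntertwiningMap.fst_comp_inl, pArithMap_id] at h1
      rw [IntertwiningMap.fst_comp_inr, pArithMap_zero] at h2
      rw [IntertwiningMap.snd_comp_inl, pArithMap_zero] at h3
      rw [IntertwiningMap.snd_comp_inr, pArithMap_id] at h4
      refine Prod.ext ((map_add _ _ _).trans ?_) ((map_add _ _ _).trans ?_)
      · exact (congrArg₂ (· + ·) h1.symm h2.symm).trans (add_zero _)
      · exact (congrArg₂ (· + ·) h3.symm h4.symm).trans (zero_add _)
    · have h := LinearMap.congr_fun (pArithMap_add N U ((IntertwiningMap.inl A π π).comp fst)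
        ((IntertwiningMap.inr A π π).comp snd) n) x
      rw [IntertwiningMap.coprod_inl_inr, pArithMap_id, pArithMap_comp, pArithMap_comp] at h
      exact h.symm
  have hd₂w (n : ℕ) (x) : pArithMap N U d₂ n x =
      w n (kosD₂ (pArithMap N U s n) (pArithMap N U t n) x) := by
    have h0 : d₂ = (IntertwiningMap.inl A π π).comp s + (IntertwiningMap.inr A π π).comp t :=
      IntertwiningMap.ext (LinearMap.ext fun m =>
        Prod.ext (add_zero (s m)).symm (zero_add (t m)).symm)
    have h := LinearMap.congr_fun (pArithMap_add N U ((IntertwiningMap.inl A π π).comp s)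
        ((IntertwiningMap.inr A π π).comp t) n) x
    rw [← h0, pArithMap_comp, pArithMap_comp] at h
    exact h
  have hd₁w (n : ℕ) (x) : pArithMap N U ι n (pArithMap N U d₁ n (w n x)) =
      kosD₁ (pArithMap N U s n) (pArithMap N U t n) x := by
    have h1 := LinearMap.congr_fun (pArithMap_comp N U (IntertwiningMap.inl A π π) (ι.comp d₁) n) x.1
    have h2 := LinearMap.congr_fun (pArithMap_comp N U (IntertwiningMap.inr A π π) (ι.comp d₁) n) x.2
    have e1 : (ι.comp d₁).comp (IntertwiningMap.inl A π π) = t :=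
      IntertwiningMap.ext (LinearMap.ext fun m => by
        change t m - s 0 = t m
        rw [map_zero, sub_zero])
    have e2 : (ι.comp d₁).comp (IntertwiningMap.inr A π π) = -s :=
      IntertwiningMap.ext (LinearMap.ext fun m => by
        change t 0 - s m = -s m
        rw [map_zero, zero_sub])
    rw [e1, pArithMap_comp] at h1
    rw [e2, pArithMap_neg, pArithMap_comp] at h2
    refine (congrArg _ (map_add _ _ _)).trans ((map_add _ _ _).trans ?_)
    exact (congrArg₂ (· + ·) h1.symm h2.symm).trans (sub_eq_add_neg _ _).symm
  let D : KoszulSequences (FreeAlgebra A (HeckeGen p N)) :=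
    { H := pArithHomology N U π
      K := pArithHomology N U πI
      Q := pArithHomology N U (π.quotient I hπ)
      s := pArithMap N U s
      t := pArithMap N U t
      u := fun n => pArithMap N U d₁ n ∘ₗ w n
      v := pArithMap N U ι
      q := pArithMap N U q
      δ := δ
      e := e
      v_u := hd₁w
      exact_d_u := fun n x => by
        refine (pArithMap_exact N (U := U) d₂ d₁ hd₂i hd hd₁s n (w n x)).trans
          (exists_congr fun a => ?_)
        rw [hd₂w]
        exact (hw n).1.eq_iff
      exact_u_e := fun n x => by
        refine (he₁ n x).trans ⟨?_, ?_⟩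
        · rintro ⟨y, rfl⟩
          obtain ⟨y, rfl⟩ := (hw (n + 1)).2 y
          exact ⟨y, rfl⟩
        · rintro ⟨y, rfl⟩
          exact ⟨_, rfl⟩
      exact_e_d := fun n x => by
        refine Iff.trans ?_ (he₂ n x)
        rw [hd₂w]
        exact (map_eq_zero_iff (w n) (hw n).1).symm
      u_surjective := (pArithMap_surjective N (U := U) d₂ d₁ hd₂i hd hd₁s).comp (hw 0).2
      exact_v_q := pArithMap_exact N (U := U) ι q Subtype.val_injective hq I.mkQ_surjective
      exact_q_δ := hδ₁
      exact_δ_v := hδ₂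
      q_surjective := pArithMap_surjective N (U := U) ι q Subtype.val_injective hq I.mkQ_surjective }
  exact ⟨D.spectralSequence, fun i j => D.page₂_iso (i, j), D.convergesTo⟩

end Koszul

end

noncomputable section

/-! ### Extension of scalars from k to R commutes with homology. -/

section BaseChangeFunctor

variable (k : Type u) [Field k] (R : Type u) [CommRing R] [Algebra k R]

/-- Extension of scalars from a field `k` to a `k`-algebra `R`. -/
def baseChangeFunctor : ModuleCat.{u} k ⥤ ModuleCat.{u} R where
  obj V := ModuleCat.of R (R ⊗[k] V)
  map f := ModuleCat.ofHom (f.hom.baseChange R)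
  map_id V := by
    refine ModuleCat.hom_ext (LinearMap.ext fun x => ?_)
    exact LinearMap.congr_fun (TensorProduct.map_id (R := k) (M := R) (N := V)) x
  map_comp f g := by
    refine ModuleCat.hom_ext (LinearMap.ext fun x => ?_)
    exact LinearMap.lTensor_comp_apply R g.hom f.hom x

instance : (baseChangeFunctor k R).Additive where
  map_add {_ _ f g} := by
    refine ModuleCat.hom_ext (LinearMap.ext fun x => ?_)
    exact LinearMap.congr_fun (LinearMap.lTensor_add R f.hom g.hom) x

/-- R is flat over the field k. -/
instance : (baseChangeFunctor k R).PreservesHomology :=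
  Functor.preservesHomology_of_map_exact _ fun S hS => by
    rw [ShortComplex.ShortExact.moduleCat_exact_iff_function_exact] at hS ⊢
    exact Module.Flat.lTensor_exact R hS

/-- Homology commutes with extension of scalars. -/
def simpHomologyBaseChange (n : ℕ) :
    (SimplicialObject.whiskering _ _).obj (baseChangeFunctor k R) ⋙ simpHomology R n ≅
      simpHomology k n ⋙ baseChangeFunctor k R :=
  Functor.isoWhiskerRight (eqToIso (AlgebraicTopology.map_alternatingFaceMapComplex
      (baseChangeFunctor k R)).symm)
    (HomologicalComplex.homologyFunctor (ModuleCat.{u} R) (ComplexShape.down ℕ) n) ≪≫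
  Functor.isoWhiskerLeft (AlgebraicTopology.alternatingFaceMapComplex (ModuleCat.{u} k))
    (Functor.isoWhiskerLeft ((baseChangeFunctor k R).mapHomologicalComplex (ComplexShape.down ℕ))
      (HomologicalComplex.homologyFunctorIso (ModuleCat.{u} R) (ComplexShape.down ℕ) n) ≪≫
    Functor.isoWhiskerLeft (HomologicalComplex.shortComplexFunctor (ModuleCat.{u} k)
      (ComplexShape.down ℕ) n) (ShortComplex.homologyFunctorIso (baseChangeFunctor k R)) ≪≫
    Functor.isoWhiskerRight (HomologicalComplex.homologyFunctorIso (ModuleCat.{u} k)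
      (ComplexShape.down ℕ) n).symm (baseChangeFunctor k R))

end BaseChangeFunctor

section Representatives

variable {A : Type u} [CommRing A] {P H H₀ Y : Type} [Group P] [Group H] [Group H₀]
  {M : Type u} [AddCommGroup M] [Module A M] {j : H →* P} {act : P →* Equiv.Perm Y}
  {ρ : Representation A H M}

/-- A Hecke operator can be computed with any family of representatives. -/
theorem HeckeDatum.op_cls_eq_sum (D : HeckeDatum j ρ) {ι : Type} [Fintype ι] (x : ι → H)
    (hx : Function.Bijective fun a => (x a : H ⧸ D.stab)) (y : Y) (m : M) :
    D.op act (cls j act ρ y m) = ∑ a, cls j act ρ (act (j (x a) * D.g)⁻¹ y) (D.φ (ρ (x a)⁻¹ m)) := by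
  have := Fintype.ofBijective _ hx
  rw [op_cls]
  exact (Fintype.sum_bijective _ hx _ _ fun a => (D.term_mk y (x a) m).symm).symm

/-- Representatives of the cosets coming from another group. -/
theorem bijective_out (θ : H₀ →* H) (S : Subgroup H) (S₀ : Subgroup H₀) (h : S₀ = S.comap θ)
    (hs : ∀ x : H, ∃ s, x⁻¹ * θ s ∈ S) :
    Function.Bijective fun q : H₀ ⧸ S₀ => (θ q.out : H ⧸ S) := by
  subst h
  constructor
  · intro q q' e
    rw [← q.out_eq', ← q'.out_eq']
    refine QuotientGroup.eq.2 ?_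
    rw [Subgroup.mem_comap, map_mul, map_inv]
    exact QuotientGroup.eq.1 e
  · intro q
    induction q using QuotientGroup.induction_on with | H x => ?_
    obtain ⟨s, hs⟩ := hs x
    refine ⟨(s : H₀ ⧸ S.comap θ), ?_⟩
    refine (Eq.trans (QuotientGroup.eq.2 hs) (QuotientGroup.eq.2 ?_)).symm
    rw [← map_inv, ← map_mul]
    exact QuotientGroup.eq.1 (QuotientGroup.out_eq' (s : H₀ ⧸ S.comap θ)).symm

end Representatives

end

noncomputable section

/-! ### Shapiro's lemma for the compact induction, on chains. -/

section Shapiro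

variable {p : ℕ} [Fact p.Prime] {k : Type u} [Field k] (R : Type u) [CommRing R] [Algebra k R]
  {M : Type u} [AddCommGroup M] [Module k M] (U : Subgroup (GL (Fin 2) (FinAdele p)))
  (ρ : Representation k (GL (Fin 2) ℤ_[p]) M)

/-- The inclusion of `GL₂(ℚ_p)` in `GL₂(ℚ) × GL₂(𝔸^{p∞}) × GL₂(ℚ_p) × GL₂(ℝ)°`. -/
def atP : GL (Fin 2) ℚ_[p] →* BigGroup p :=
  (MonoidHom.inr _ _).comp ((MonoidHom.inr _ _).comp (MonoidHom.inl _ _))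

theorem atP_eq (g : GL (Fin 2) ℚ_[p]) : atP g = (1, 1, g, 1) :=
  rfl

theorem baseChangeRep_tmul (h : GL (Fin 2) ℤ_[p]) (c : R) (m : M) :
    baseChangeRep R ρ h (c ⊗ₜ m) = c ⊗ₜ ρ h m :=
  rfl

theorem cIndRep_cls {A : Type u} [CommRing A] {V : Type u} [AddCommGroup V] [Module A V]
    (π : Representation A (GL (Fin 2) ℤ_[p]) V) (h g : GL (Fin 2) ℚ_[p]) (v : V) :
    cIndRep p π h (cls (inclK p) (rightAct _) π g v) = cls (inclK p) (rightAct _) π (h * g) v :=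
  mapChains_cls (ρ := π) (fun x => h * x) (mul_rightAct h) g v

theorem cIndS_cls {A : Type u} [CommRing A] {V : Type u} [AddCommGroup V] [Module A V]
    (π : Representation A (GL (Fin 2) ℤ_[p]) V) (g : GL (Fin 2) ℚ_[p]) (v : V) :
    cIndS p π (cls (inclK p) (rightAct _) π g v) =
      cls (inclK p) (rightAct _) π (g * beta p) v :=
  (centralOp_cls (ρ := π) _ (beta_central p) g v).trans
    (congrArg (fun g => cls (inclK p) (rightAct _) π g v) (congrArg (g * ·) (inv_inv _)))

theorem bijective_quotient_out {H : Type} [Group H] (S : Subgroup H) :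
    Function.Bijective fun q : H ⧸ S => (q.out : H ⧸ S) :=
  ⟨fun q q' h => by simpa only [QuotientGroup.out_eq'] using h, fun q => ⟨q, q.out_eq'⟩⟩

theorem cIndT_cls {A : Type u} [CommRing A] {V : Type u} [AddCommGroup V] [Module A V]
    {π : Representation A (GL (Fin 2) ℤ_[p]) V} (D : HeckeDatum (inclK p) π)
    [Fintype (GL (Fin 2) ℤ_[p] ⧸ D.stab)] (g : GL (Fin 2) ℚ_[p]) (v : V) :
    cIndT p D (cls (inclK p) (rightAct _) π g v) = ∑ q : GL (Fin 2) ℤ_[p] ⧸ D.stab,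
      cls (inclK p) (rightAct _) π (g * (inclK p q.out * D.g)) (D.φ (π q.out⁻¹ v)) := by
  refine (D.op_cls_eq_sum Quotient.out (bijective_quotient_out D.stab) g v).trans ?_
  refine Finset.sum_congr rfl fun q _ => ?_
  exact congrArg (fun g => cls (inclK p) (rightAct _) π g (D.φ (π q.out⁻¹ v)))
    (congrArg (g * ·) (inv_inv _))

/-- The map `[g, r ⊗ m] ↦ r ⊗ (y g ⊗ m)`, where `y g` denotes the action of `g⁻¹` on `y`. -/
def shapiroFiber {n : ℕ} (y : ResSet p n) : CInd p (baseChangeRep R ρ) →ₗ[R]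
    R ⊗[k] ResChains U (inclK p) ρ n :=
  liftChains (ρ := baseChangeRep R ρ) (fun g =>
    (cls (levelIncl U (inclK p)) (resAct p n) (levelRep U ρ) (resAct p n (atP g)⁻¹ y)).baseChange R)
      (fun h g m => by
        induction m with
        | zero => rw [map_zero, map_zero, map_zero]
        | add m m' hm hm' => rw [map_add, map_add, hm, hm', map_add]
        | tmul c m =>
          rw [baseChangeRep_tmul, LinearMap.baseChange_tmul, LinearMap.baseChange_tmul]
          refine congrArg (c ⊗ₜ[k] ·) ?_
          refine Eq.trans ?_ (cls_smul (ρ := levelRep U ρ) ((1, 1, h, 1) : LevelGroup U _)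
            (resAct p n (atP g)⁻¹ y) m)
          refine congrArg (fun y => cls _ (resAct p n) (levelRep U ρ) y (ρ h m)) ?_
          rw [← Equiv.Perm.mul_apply, ← map_mul]
          congr 2
          change (atP (g * (inclK p h)⁻¹))⁻¹ = atP (inclK p h) * (atP g)⁻¹
          rw [map_mul, map_inv, mul_inv_rev, inv_inv])

theorem shapiroFiber_cls {n : ℕ} (y : ResSet p n) (g : GL (Fin 2) ℚ_[p]) (c : R) (m : M) :
    shapiroFiber R U ρ y (cls _ _ _ g (c ⊗ₜ m)) =
      c ⊗ₜ cls (levelIncl U (inclK p)) (resAct p n) (levelRep U ρ) (resAct p n (atP g)⁻¹ y) m := by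
  rw [shapiroFiber, liftChains_cls, LinearMap.baseChange_tmul]

theorem cInd_induction {C : CInd p (baseChangeRep R ρ) → Prop} (h0 : C 0)
    (hadd : ∀ x x', C x → C x' → C (x + x'))
    (hcls : ∀ g c m, C (cls (inclK p) (rightAct _) (baseChangeRep R ρ) g (c ⊗ₜ[k] m))) (x) : C x := by
  induction x using chains_induction with
  | h0 => exact h0
  | hadd x x' hx hx' => exact hadd _ _ hx hx'
  | hcls g m =>
    induction m with
    | zero =>
      rw [map_zero]
      exact h0
    | add x x' hx hx' =>
      rw [map_add]
      exact hadd _ _ hx hx'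
    | tmul c m => exact hcls g c m

theorem shapiroFiber_act {n : ℕ} (h : LevelGroup U (GL (Fin 2) ℚ_[p])) (y : ResSet p n)
    (v : CInd p (baseChangeRep R ρ)) :
    shapiroFiber R U ρ (resAct p n (levelIncl U (MonoidHom.id _) h) y)
      (cIndRep p (baseChangeRep R ρ) h.2.2.1 v) = shapiroFiber R U ρ y v := by
  induction v using cInd_induction with
  | h0 => rw [map_zero, map_zero, map_zero]
  | hadd v v' hv hv' => rw [map_add, map_add, hv, hv', map_add]
  | hcls g c m =>
    rw [cIndRep_cls, shapiroFiber_cls, shapiroFiber_cls]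
    refine congrArg (c ⊗ₜ[k] ·) ?_
    refine Eq.trans ?_ (cls_smul (ρ := levelRep U ρ) ((h.1, h.2.1, 1, h.2.2.2) : LevelGroup U _)
      (resAct p n (atP g)⁻¹ y) m)
    refine congrArg₂ (fun y m => cls _ (resAct p n) (levelRep U ρ) y m) ?_
      (LinearMap.congr_fun (map_one ρ) m).symm
    rw [← Equiv.Perm.mul_apply, ← Equiv.Perm.mul_apply, ← map_mul, ← map_mul]
    congr 2
    rw [← map_inv, ← map_inv, atP_eq, atP_eq]
    obtain ⟨h₁, h₂, h₃, h₄⟩ := h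
    simp [levelIncl]

/-- The map `y ⊗ [g, r ⊗ m] ↦ r ⊗ (y g ⊗ m)`, where `y g` denotes the action of `g⁻¹` on `y`. -/
def shapiroMap (n : ℕ) : ResChains U (MonoidHom.id _) (cIndRep p (baseChangeRep R ρ)) n →ₗ[R]
    R ⊗[k] ResChains U (inclK p) ρ n :=
  liftChains (ρ := levelRep U (cIndRep p (baseChangeRep R ρ))) (fun y => shapiroFiber R U ρ y)
    (shapiroFiber_act R U ρ)

theorem shapiroMap_cls (n : ℕ) (y : ResSet p n) (g : GL (Fin 2) ℚ_[p]) (c : R) (m : M) :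
    shapiroMap R U ρ n (cls _ _ _ y (cls _ _ _ g (c ⊗ₜ m))) =
      c ⊗ₜ cls (levelIncl U (inclK p)) (resAct p n) (levelRep U ρ) (resAct p n (atP g)⁻¹ y) m :=
  (liftChains_cls _ _ _ _).trans (shapiroFiber_cls R U ρ y g c m)

/-- Acting with g⁻¹ in the component at p turns [g, m] into [1, m] at the expense of moving y. Hence
chains with values in the induction are generated by those supported on K. -/
theorem cls_cls_eq (n : ℕ) (y : ResSet p n) (g : GL (Fin 2) ℚ_[p]) (m : R ⊗[k] M) :
    cls (levelIncl U (MonoidHom.id _)) (resAct p n) (levelRep U (cIndRep p (baseChangeRep R ρ))) y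
      (cls (inclK p) (rightAct _) (baseChangeRep R ρ) g m) =
    cls (levelIncl U (MonoidHom.id _)) (resAct p n) (levelRep U (cIndRep p (baseChangeRep R ρ)))
      (resAct p n (atP g)⁻¹ y) (cls (inclK p) (rightAct _) (baseChangeRep R ρ) 1 m) := by
  refine (cls_smul (ρ := levelRep U (cIndRep p (baseChangeRep R ρ)))
    ((1, 1, g⁻¹, 1) : LevelGroup U _) y _).symm.trans ?_
  refine congrArg (cls (levelIncl U (MonoidHom.id _)) (resAct p n)
    (levelRep U (cIndRep p (baseChangeRep R ρ))) _) ?_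
  refine (cIndRep_cls (baseChangeRep R ρ) g⁻¹ g m).trans ?_
  rw [inv_mul_cancel]

theorem shapiro_induction {n : ℕ}
    {C : ResChains U (MonoidHom.id _) (cIndRep p (baseChangeRep R ρ)) n → Prop} (h0 : C 0)
    (hadd : ∀ x x', C x → C x' → C (x + x'))
    (hcls : ∀ y g c m, C (cls _ _ _ y (cls _ _ _ g (c ⊗ₜ[k] m)))) (x) : C x := by
  induction x using chains_induction with
  | h0 => exact h0
  | hadd x x' hx hx' => exact hadd x x' hx hx'
  | hcls y v =>
    induction v using cInd_induction with
    | h0 =>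
      rw [map_zero]
      exact h0
    | hadd x x' hx hx' =>
      rw [map_add]
      exact hadd _ _ hx hx'
    | hcls g c m => exact hcls y g c m

theorem shapiroMap_bijective (n : ℕ) : Function.Bijective (shapiroMap R U ρ n) := by
  let _ : Module k (CInd p (baseChangeRep R ρ)) := Module.compHom _ (algebraMap k R)
  have _ : IsScalarTower k R (CInd p (baseChangeRep R ρ)) := IsScalarTower.of_compHom _ _ _
  let _ : Module k (ResChains U (MonoidHom.id _) (cIndRep p (baseChangeRep R ρ)) n) :=
    Module.compHom _ (algebraMap k R)
  have _ : IsScalarTower k R (ResChains U (MonoidHom.id _) (cIndRep p (baseChangeRep R ρ)) n) :=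
    IsScalarTower.of_compHom _ _ _
  -- The inverse sends c ⊗ (y ⊗ m) to c (y ⊗ [1, 1 ⊗ m]). Compatibility with h ∈ K rests on [1, ρ(h)
  -- m] = [h, m].
  let ψ : ResChains U (inclK p) ρ n →ₗ[k]
      ResChains U (MonoidHom.id _) (cIndRep p (baseChangeRep R ρ)) n :=
    liftChains (fun y => ((cls (levelIncl U (MonoidHom.id _)) (resAct p n)
      (levelRep U (cIndRep p (baseChangeRep R ρ))) y).restrictScalars k) ∘ₗ
      ((cls (inclK p) (rightAct _) (baseChangeRep R ρ) 1).restrictScalars k) ∘ₗ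
      TensorProduct.mk k R M 1) fun h y m => by
        simp only [LinearMap.comp_apply, LinearMap.restrictScalars_apply, TensorProduct.mk_apply]
        refine Eq.trans ?_ (cls_smul (ρ := levelRep U (cIndRep p (baseChangeRep R ρ)))
          ((h.1, h.2.1, inclK p h.2.2.1, h.2.2.2) : LevelGroup U _) y _)
        refine congrArg (cls (levelIncl U (MonoidHom.id _)) (resAct p n)
          (levelRep U (cIndRep p (baseChangeRep R ρ))) _) ?_
        refine Eq.trans ?_ (cIndRep_cls (baseChangeRep R ρ) (inclK p h.2.2.1) 1
          (1 ⊗ₜ m)).symm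
        refine (cls_smul (ρ := baseChangeRep R ρ) h.2.2.1⁻¹ _ _).symm.trans ?_
        refine congrArg₂ (fun g m => cls (inclK p) (rightAct _) (baseChangeRep R ρ) g m) ?_ ?_
        · change 1 * (inclK p h.2.2.1⁻¹)⁻¹ = _
          rw [map_inv, inv_inv, one_mul, mul_one]
        · rw [baseChangeRep_tmul]
          refine congrArg ((1 : R) ⊗ₜ[k] ·) ?_
          change ρ h.2.2.1⁻¹ (ρ h.2.2.1 m) = m
          rw [← Module.End.mul_apply, ← map_mul, inv_mul_cancel, map_one, Module.End.one_apply]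
  have hψ : ∀ y m, ψ (cls _ _ _ y m) = cls _ _ _ y (cls _ _ _ 1 (1 ⊗ₜ m)) := fun y m =>
    liftChains_cls _ _ _ _
  refine Function.bijective_iff_has_inverse.2 ⟨ψ.liftBaseChange R, fun x => ?_, fun x => ?_⟩
  · induction x using shapiro_induction with
    | h0 => rw [map_zero, map_zero]
    | hadd x x' hx hx' => rw [map_add, map_add, hx, hx']
    | hcls y g c m =>
      rw [shapiroMap_cls, LinearMap.liftBaseChange_tmul, hψ, cls_cls_eq R U ρ n y g, ← map_smul,
        ← map_smul, TensorProduct.smul_tmul', smul_eq_mul, mul_one]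
  · induction x with
    | zero => rw [map_zero, map_zero]
    | add x x' hx hx' => rw [map_add, map_add, hx, hx']
    | tmul c x =>
      rw [LinearMap.liftBaseChange_tmul, map_smul]
      induction x using chains_induction with
      | h0 => rw [map_zero, map_zero, smul_zero, TensorProduct.tmul_zero]
      | hadd x x' hx hx' => rw [map_add, map_add, smul_add, hx, hx', TensorProduct.tmul_add]
      | hcls y m =>
        rw [hψ, shapiroMap_cls, map_one, inv_one, map_one, TensorProduct.smul_tmul', smul_eq_mul,
          mul_one]
        rfl

end Shapiro

end

noncomputable section

/-! ### Compatibility of Shapiro's lemma with the Hecke operators. -/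

section ShapiroHecke

variable {p : ℕ} [Fact p.Prime] {k : Type u} [Field k] (R : Type u) [CommRing R] [Algebra k R]
  {M : Type u} [AddCommGroup M] [Module k M] (U : Subgroup (GL (Fin 2) (FinAdele p)))
  (ρ : Representation k (GL (Fin 2) ℤ_[p]) M)

variable {R U ρ} in
theorem shapiro_ext {n : ℕ} {W : Type u} [AddCommGroup W] [Module R W]
    {f f' : ResChains U (MonoidHom.id _) (cIndRep p (baseChangeRep R ρ)) n →ₗ[R] W}
    (h : ∀ y g c m, f (cls _ _ _ y (cls _ _ _ g (c ⊗ₜ[k] m))) =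
      f' (cls _ _ _ y (cls _ _ _ g (c ⊗ₜ[k] m)))) : f = f' := by
  refine LinearMap.ext fun x => ?_
  induction x using shapiro_induction with
  | h0 => rw [map_zero, map_zero]
  | hadd x x' hx hx' => rw [map_add, map_add, hx, hx']
  | hcls y g c m => exact h y g c m

theorem shapiroMap_resChainsMap {m n : ℕ} (f : Fin (m + 1) → Fin (n + 1)) :
    shapiroMap R U ρ m ∘ₗ resChainsMap U (MonoidHom.id _) (cIndRep p (baseChangeRep R ρ)) f =
      (resChainsMap U (inclK p) ρ f).baseChange R ∘ₗ shapiroMap R U ρ n := by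
  apply shapiro_ext
  intro y g c v
  rw [LinearMap.comp_apply, LinearMap.comp_apply, shapiroMap_cls, LinearMap.baseChange_tmul,
    resChainsMap_cls, resChainsMap_cls, shapiroMap_cls, resMap_act]

/-- Only centrality of z matters: translation by z commutes with translation by g at p. -/
theorem shapiroMap_centralOp {n : ℕ} (z : BigGroup p) (hz : ∀ w, z * w = w * z) :
    shapiroMap R U ρ n ∘ₗ centralOp (levelIncl U (MonoidHom.id _)) (resAct p n)
        (levelRep U (cIndRep p (baseChangeRep R ρ))) z hz =
      (centralOp (levelIncl U (inclK p)) (resAct p n) (levelRep U ρ) z hz).baseChange R ∘ₗ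
        shapiroMap R U ρ n := by
  refine shapiro_ext fun y g c v => ?_
  rw [LinearMap.comp_apply, LinearMap.comp_apply, shapiroMap_cls, LinearMap.baseChange_tmul]
  refine (congrArg (shapiroMap R U ρ n) (centralOp_cls z hz y _)).trans ((shapiroMap_cls R U ρ n _ g c v).trans ?_)
  refine congrArg (c ⊗ₜ[k] ·) (Eq.trans ?_ (centralOp_cls (ρ := levelRep U ρ) _ _ _ _).symm)
  refine congrArg (fun y => cls _ (resAct p n) (levelRep U ρ) y v) ?_
  rw [← Equiv.Perm.mul_apply, ← Equiv.Perm.mul_apply, ← map_mul, ← map_mul, ← mul_inv_rev,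
    ← mul_inv_rev, hz]

/-- The inclusion of `U^p` in `GL₂(ℚ) × U^p × L × GL₂(ℝ)°`. -/
def levelInclU (L : Type) [Group L] : U →* LevelGroup U L :=
  (MonoidHom.inr _ _).comp (MonoidHom.inl _ _)

/-- The inclusion of `L` in `GL₂(ℚ) × U^p × L × GL₂(ℝ)°`. -/
def levelInclL (L : Type) [Group L] : L →* LevelGroup U L :=
  (MonoidHom.inr _ _).comp ((MonoidHom.inr _ _).comp (MonoidHom.inl _ _))

variable {A : Type u} [CommRing A] {L : Type} [Group L] {V : Type u} [AddCommGroup V] [Module A V]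
  (i : L →* GL (Fin 2) ℚ_[p]) (hi : Function.Injective i) (π : Representation A L V)

/-- The condition concerns the component away from p and does not involve L, so the cosets for L = K
and for L = G are indexed by the same quotient of U^p. -/
theorem levelInclU_mem_stab (l : PrimesAway p) (x : U) :
    levelInclU U L x ∈ (datumAt U i hi π l).stab ↔
      ∃ x' : U, (x : GL (Fin 2) (FinAdele p)) * diagGL 1 (uniformizer p l) =
        diagGL 1 (uniformizer p l) * x' := by
  rw [HeckeDatum.mem_stab]
  constructor
  · rintro ⟨x', h⟩
    exact ⟨x'.2.1, congrArg (fun z : BigGroup p => z.2.1) h⟩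
  · rintro ⟨x', h⟩
    refine ⟨levelInclU U L x', ?_⟩
    ext1
    · rfl
    ext1
    · exact h
    ext1
    · change i 1 * 1 = 1 * i 1
      rw [mul_one, one_mul]
    · rfl

/-- The components outside U^p commute with the Hecke element at l, so every coset has a
representative in U^p. -/
theorem exists_levelInclU (l : PrimesAway p) (x : LevelGroup U L) :
    ∃ s, x⁻¹ * levelInclU U L s ∈ (datumAt U i hi π l).stab := by
  obtain ⟨x₁, x₂, x₃, x₄⟩ := x
  refine ⟨x₂, ?_⟩
  rw [HeckeDatum.mem_stab]
  exact ⟨(x₁⁻¹, 1, x₃⁻¹, x₄⁻¹), by simp [levelIncl, datumAt, levelInclU]⟩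

theorem levelInclL_mem_stab {D : HeckeDatum i π} (x : L) :
    levelInclL U L x ∈ (datumP U D).stab ↔ x ∈ D.stab := by
  rw [HeckeDatum.mem_stab, HeckeDatum.mem_stab]
  constructor
  · rintro ⟨x', h⟩
    exact ⟨x'.2.2.1, congrArg (fun z : BigGroup p => z.2.2.1) h⟩
  · rintro ⟨x', h⟩
    refine ⟨levelInclL U L x', ?_⟩
    ext1
    · rfl
    ext1
    · change ((1 : U) : GL (Fin 2) (FinAdele p)) * 1 = 1 * ((1 : U) : GL (Fin 2) (FinAdele p))
      rw [mul_one, one_mul]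
    ext1
    · exact h
    · rfl

theorem exists_levelInclL {D : HeckeDatum i π} (x : LevelGroup U L) :
    ∃ s, x⁻¹ * levelInclL U L s ∈ (datumP U D).stab := by
  obtain ⟨x₁, x₂, x₃, x₄⟩ := x
  refine ⟨x₃, ?_⟩
  rw [HeckeDatum.mem_stab]
  exact ⟨(x₁⁻¹, x₂⁻¹, 1, x₄⁻¹), by simp [levelIncl, datumP, levelInclL]⟩

theorem bijective_levelInclU (l : PrimesAway p) (S₀ : Subgroup U)
    (h : ∀ x, x ∈ S₀ ↔ ∃ x' : U, (x : GL (Fin 2) (FinAdele p)) * diagGL 1 (uniformizer p l) =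
        diagGL 1 (uniformizer p l) * x') : Function.Bijective fun q : U ⧸ S₀ =>
      (levelInclU U L q.out : LevelGroup U L ⧸ (datumAt U i hi π l).stab) :=
  bijective_out (levelInclU U L) _ S₀
    (Subgroup.ext fun x => (h x).trans (levelInclU_mem_stab U i hi π l x).symm)
    (exists_levelInclU U i hi π l)

theorem op_datumAt_cls (l : PrimesAway p) (S₀ : Subgroup U)
    (h : ∀ x, x ∈ S₀ ↔ ∃ x' : U, (x : GL (Fin 2) (FinAdele p)) * diagGL 1 (uniformizer p l) =
        diagGL 1 (uniformizer p l) * x') [Fintype (U ⧸ S₀)] {n : ℕ} (y : ResSet p n) (v : V) :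
    (datumAt U i hi π l).op (resAct p n) (cls _ _ _ y v) =
      ∑ q : U ⧸ S₀, cls (levelIncl U i) (resAct p n) (levelRep U π)
        (resAct p n (1, q.out * diagGL 1 (uniformizer p l), 1, 1)⁻¹ y) v := by
  rw [HeckeDatum.op_cls_eq_sum _ _ (bijective_levelInclU U i hi π l S₀ h)]
  refine Finset.sum_congr rfl fun q _ => ?_
  refine congrArg₂ (fun y m => cls (levelIncl U i) (resAct p n) (levelRep U π) y m) ?_ ?_
  · congr 3
    ext1
    · exact mul_one _
    ext1
    · rfl
    ext1
    · change i 1 * 1 = 1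
      rw [mul_one, map_one]
    · exact mul_one _
  · change π 1⁻¹ v = v
    rw [inv_one, map_one, Module.End.one_apply]

/-- Both operators are sums over the same quotient of U^p, and translations at l and at p commute.
-/
theorem shapiroMap_op_datumAt {n : ℕ} (l : PrimesAway p) :
    shapiroMap R U ρ n ∘ₗ (datumAt U (MonoidHom.id _) Function.injective_id
        (cIndRep p (baseChangeRep R ρ)) l).op (resAct p n) =
      ((datumAt U (inclK p) inclK_injective ρ l).op (resAct p n)).baseChange R ∘ₗ
        shapiroMap R U ρ n := by
  let S₀ : Subgroup U := (datumAt U (inclK p) inclK_injective ρ l).stab.comap (levelInclU U _)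
  have h₀ := levelInclU_mem_stab U (inclK p) inclK_injective ρ l
  have h₁ := bijective_levelInclU U (inclK p) inclK_injective ρ l S₀ h₀
  have h₂ := bijective_levelInclU U (MonoidHom.id _) Function.injective_id
    (cIndRep p (baseChangeRep R ρ)) l S₀ h₀
  by_cases hfin : Finite (U ⧸ S₀)
  · let _ := Fintype.ofFinite (U ⧸ S₀)
    refine shapiro_ext fun y g c v => ?_
    rw [LinearMap.comp_apply, LinearMap.comp_apply, shapiroMap_cls, LinearMap.baseChange_tmul,
      op_datumAt_cls U _ _ _ l S₀ h₀, op_datumAt_cls U _ _ _ l S₀ h₀, map_sum,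
      TensorProduct.tmul_sum]
    refine Finset.sum_congr rfl fun q _ => ?_
    rw [shapiroMap_cls]
    refine congrArg (c ⊗ₜ[k] ·) (congrArg (fun y => cls _ (resAct p n) (levelRep U ρ) y v) ?_)
    rw [← Equiv.Perm.mul_apply, ← Equiv.Perm.mul_apply, ← map_mul, ← map_mul, ← mul_inv_rev,
      ← mul_inv_rev]
    congr 3
    rw [atP_eq]
    ext1
    · rfl
    ext1
    · exact (mul_one _).trans (one_mul _).symm
    ext1
    · exact (one_mul _).trans (mul_one _).symm
    · rfl
  -- If this quotient is infinite, so are the coset spaces for both groups, and both operators take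
  -- the default value 0.
  · rw [HeckeDatum.op_eq_zero _ (fun h => hfin (@Finite.of_injective _ _ h _ h₁.1)),
      HeckeDatum.op_eq_zero _ (fun h => hfin (@Finite.of_injective _ _ h _ h₂.1)),
      LinearMap.baseChange_zero, LinearMap.comp_zero, LinearMap.zero_comp]

theorem bijective_levelInclL (D : HeckeDatum i π) : Function.Bijective fun q : L ⧸ D.stab =>
      (levelInclL U L q.out : LevelGroup U L ⧸ (datumP U D).stab) :=
  bijective_out (levelInclL U L) (datumP U D).stab D.stab
    (Subgroup.ext fun x => (levelInclL_mem_stab U i π x).symm) (exists_levelInclL U i π)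

theorem op_datumP_cls (D : HeckeDatum i π) [Fintype (L ⧸ D.stab)] {n : ℕ} (y : ResSet p n) (v : V) :
    (datumP U D).op (resAct p n) (cls _ _ _ y v) =
      ∑ q : L ⧸ D.stab, cls (levelIncl U i) (resAct p n) (levelRep U π)
        (resAct p n (atP (i q.out * D.g))⁻¹ y) (D.φ (π q.out⁻¹ v)) := by
  rw [HeckeDatum.op_cls_eq_sum _ _ (bijective_levelInclL U i π D)]
  refine Finset.sum_congr rfl fun q _ => ?_
  refine congrArg (fun y => cls (levelIncl U i) (resAct p n) (levelRep U π) y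
    (D.φ (π q.out⁻¹ v))) ?_
  congr 3
  rw [atP_eq]
  ext1
  · exact mul_one _
  ext1
  · exact mul_one _
  ext1
  · rfl
  · exact mul_one _

/-- T on the induction replaces g by g x α and v by α⁻¹ x⁻¹ v. Since Shapiro's map sends y and g to
g⁻¹ y, the new point is (x α)⁻¹ g⁻¹ y, which is the one in the Hecke operator at p on chains. -/
theorem shapiroMap_cIndT (D : HeckeDatum (inclK p) ρ) {n : ℕ}
    (h : ∀ (g : LevelGroup U (GL (Fin 2) ℚ_[p])) v, cIndT p (D.baseChange R)
      (levelRep U (cIndRep p (baseChangeRep R ρ)) g v) =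
        levelRep U (cIndRep p (baseChangeRep R ρ)) g (cIndT p (D.baseChange R) v)) :
    shapiroMap R U ρ n ∘ₗ coeffMap (levelIncl U (MonoidHom.id _)) (resAct p n)
        (cIndT p (D.baseChange R)) h =
      ((datumP U D).op (resAct p n)).baseChange R ∘ₗ shapiroMap R U ρ n := by
  have h₁ := bijective_levelInclL U (inclK p) ρ D
  by_cases hfin : Finite (GL (Fin 2) ℤ_[p] ⧸ D.stab)
  · let _ := Fintype.ofFinite (GL (Fin 2) ℤ_[p] ⧸ D.stab)
    refine shapiro_ext fun y g c v => ?_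
    let _ : Fintype (GL (Fin 2) ℤ_[p] ⧸ (D.baseChange R).stab) :=
      inferInstanceAs (Fintype (GL (Fin 2) ℤ_[p] ⧸ D.stab))
    have e : cIndT p (D.baseChange R) (cls (inclK p) (rightAct _) (baseChangeRep R ρ) g (c ⊗ₜ v)) =
        ∑ q : GL (Fin 2) ℤ_[p] ⧸ D.stab, cls (inclK p) (rightAct _) (baseChangeRep R ρ)
          (g * (inclK p q.out * D.g)) (c ⊗ₜ D.φ (ρ q.out⁻¹ v)) :=
      cIndT_cls (D.baseChange R) g (c ⊗ₜ v)
    rw [LinearMap.comp_apply, LinearMap.comp_apply, shapiroMap_cls, LinearMap.baseChange_tmul,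
      op_datumP_cls, coeffMap_cls, e, map_sum, map_sum, TensorProduct.tmul_sum]
    refine Finset.sum_congr rfl fun q _ => ?_
    rw [shapiroMap_cls]
    refine congrArg (c ⊗ₜ[k] ·) (congrArg (fun y => cls _ (resAct p n) (levelRep U ρ) y
      (D.φ (ρ q.out⁻¹ v))) ?_)
    rw [← Equiv.Perm.mul_apply, ← map_mul, ← mul_inv_rev, ← map_mul]
  · have e : cIndT p (D.baseChange R) = 0 := HeckeDatum.op_eq_zero _ hfin
    have e' : (datumP U D).op (resAct p n) = 0 :=
      HeckeDatum.op_eq_zero _ (fun h => hfin (@Finite.of_injective _ _ h _ h₁.1))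
    rw [e', LinearMap.baseChange_zero, LinearMap.zero_comp]
    refine shapiro_ext fun y g c v => ?_
    rw [LinearMap.comp_apply, coeffMap_cls, e, LinearMap.zero_apply, map_zero, map_zero,
      LinearMap.zero_apply]

theorem shapiroMap_cIndS {n : ℕ}
    (h : ∀ (g : LevelGroup U (GL (Fin 2) ℚ_[p])) v, cIndS p (baseChangeRep R ρ)
      (levelRep U (cIndRep p (baseChangeRep R ρ)) g v) =
        levelRep U (cIndRep p (baseChangeRep R ρ)) g (cIndS p (baseChangeRep R ρ) v)) :
    shapiroMap R U ρ n ∘ₗ coeffMap (levelIncl U (MonoidHom.id _)) (resAct p n)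
        (cIndS p (baseChangeRep R ρ)) h =
      (centralOp (levelIncl U (inclK p)) (resAct p n) (levelRep U ρ) (betaAd p)
        betaAd_central).baseChange R ∘ₗ shapiroMap R U ρ n := by
  refine shapiro_ext fun y g c v => ?_
  rw [LinearMap.comp_apply, LinearMap.comp_apply, shapiroMap_cls, LinearMap.baseChange_tmul,
    coeffMap_cls, cIndS_cls, shapiroMap_cls]
  refine congrArg (c ⊗ₜ[k] ·) (Eq.trans ?_ (centralOp_cls (ρ := levelRep U ρ) _ _ _ _).symm)
  refine congrArg (fun y => cls _ (resAct p n) (levelRep U ρ) y v) ?_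
  rw [← Equiv.Perm.mul_apply, ← map_mul, ← mul_inv_rev, map_mul]
  rfl

end ShapiroHecke

end

noncomputable section

/-! ### Shapiro's lemma on homology. -/

section ShapiroHomology

variable {p : ℕ} [Fact p.Prime] {k : Type u} [Field k] (R : Type u) [CommRing R] [Algebra k R]
  {M : Type u} [AddCommGroup M] [Module k M] (U : Subgroup (GL (Fin 2) (FinAdele p)))
  (ρ : Representation k (GL (Fin 2) ℤ_[p]) M)

/-- Shapiro's lemma, at the level of simplicial modules. -/
def shapiroIso : simpChains U (MonoidHom.id _) (cIndRep p (baseChangeRep R ρ)) ≅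
    ((SimplicialObject.whiskering _ _).obj (baseChangeFunctor k R)).obj
      (simpChains U (inclK p) ρ) :=
  NatIso.ofComponents (fun Δ => (LinearEquiv.ofBijective (shapiroMap R U ρ Δ.unop.len)
    (shapiroMap_bijective R U ρ Δ.unop.len)).toModuleIso) fun f =>
      ModuleCat.hom_ext (shapiroMap_resChainsMap R U ρ f.unop.toOrderHom)

/-- Shapiro's lemma. -/
def shapiroHomologyIso (n : ℕ) :
    (simpHomology R n).obj (simpChains U (MonoidHom.id _) (cIndRep p (baseChangeRep R ρ))) ≅
      (baseChangeFunctor k R).obj ((simpHomology k n).obj (simpChains U (inclK p) ρ)) :=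
  (simpHomology R n).mapIso (shapiroIso R U ρ) ≪≫ (simpHomologyBaseChange k R n).app _

/-- Shapiro's lemma. -/
def shapiroEquiv (n : ℕ) :
    (simpHomology R n).obj (simpChains U (MonoidHom.id _) (cIndRep p (baseChangeRep R ρ))) ≃ₗ[R]
      R ⊗[k] (simpHomology k n).obj (simpChains U (inclK p) ρ) :=
  (shapiroHomologyIso R U ρ n).toLinearEquiv

variable {R U ρ}

/-- Compatibility of Shapiro's lemma with an operator, checked on simplicial modules. -/
theorem shapiroEquiv_symm_map {α : simpChains U (MonoidHom.id _) (cIndRep p (baseChangeRep R ρ)) ⟶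
      simpChains U (MonoidHom.id _) (cIndRep p (baseChangeRep R ρ))}
    {β : simpChains U (inclK p) ρ ⟶ simpChains U (inclK p) ρ}
    (h : ∀ Δ, shapiroMap R U ρ Δ.unop.len ∘ₗ (α.app Δ).hom =
      (β.app Δ).hom.baseChange R ∘ₗ shapiroMap R U ρ Δ.unop.len) (n : ℕ) (c : R)
    (v : (simpHomology k n).obj (simpChains U (inclK p) ρ)) :
    ((simpHomology R n).map α).hom ((shapiroEquiv R U ρ n).symm (c ⊗ₜ v)) =
      (shapiroEquiv R U ρ n).symm (c ⊗ₜ ((simpHomology k n).map β).hom v) := by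
  have h₀ : α ≫ (shapiroIso R U ρ).hom = (shapiroIso R U ρ).hom ≫
      ((SimplicialObject.whiskering _ _).obj (baseChangeFunctor k R)).map β :=
    NatTrans.ext (funext fun Δ => ModuleCat.hom_ext (h Δ))
  have h₁ : (simpHomology R n).map α ≫ (shapiroHomologyIso R U ρ n).hom =
      (shapiroHomologyIso R U ρ n).hom ≫ (baseChangeFunctor k R).map ((simpHomology k n).map β) := by
    have e := (simpHomologyBaseChange k R n).hom.naturality β
    rw [shapiroHomologyIso, Iso.trans_hom, Functor.mapIso_hom, ← Category.assoc,
      ← Functor.map_comp, h₀, Functor.map_comp, Category.assoc, Category.assoc]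
    exact congrArg ((simpHomology R n).map (shapiroIso R U ρ).hom ≫ ·) e
  rw [LinearEquiv.eq_symm_apply]
  have h₂ := LinearMap.congr_fun (congrArg ModuleCat.Hom.hom h₁)
    ((shapiroEquiv R U ρ n).symm (c ⊗ₜ v))
  refine h₂.trans ?_
  have e : (shapiroHomologyIso R U ρ n).hom.hom ((shapiroEquiv R U ρ n).symm (c ⊗ₜ v)) = c ⊗ₜ v :=
    (shapiroEquiv R U ρ n).apply_symm_apply (c ⊗ₜ v)
  exact (congrArg ((baseChangeFunctor k R).map ((simpHomology k n).map β)).hom e).trans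
    (LinearMap.baseChange_tmul _ _ _)

theorem genEnd_shapiro {N : ℕ} (x : HeckeGen p N) (n : ℕ) (c : R)
    (v : (simpHomology k n).obj (simpChains U (inclK p) ρ)) :
    ((simpHomology R n).map (genEnd U (MonoidHom.id _) Function.injective_id
      (cIndRep p (baseChangeRep R ρ)) x)).hom ((shapiroEquiv R U ρ n).symm (c ⊗ₜ v)) =
      (shapiroEquiv R U ρ n).symm (c ⊗ₜ
        ((simpHomology k n).map (genEnd U (inclK p) inclK_injective ρ x)).hom v) :=
  shapiroEquiv_symm_map (fun Δ => by
    cases x with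
    | T l => exact shapiroMap_op_datumAt R U ρ l.1
    | S l => exact shapiroMap_centralOp R U ρ (scalarAt l.1) (scalarAt_central l.1)) n c v

end ShapiroHomology

section Intertwining

open Representation

variable {p : ℕ} [Fact p.Prime] {A : Type u} [CommRing A] {M : Type u} [AddCommGroup M] [Module A M]
  {ρ : Representation A (GL (Fin 2) ℤ_[p]) M}

/-- The operator `T` as an endomorphism of the representation `cInd_K^G ρ`. -/
def cIndTMap (D : HeckeDatum (inclK p) ρ) : (cIndRep p ρ).IntertwiningMap (cIndRep p ρ) :=
  LinearMap.intertwiningMap_of_isIntertwiningMap _ _ (cIndT p D) fun h v =>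
    (LinearMap.congr_fun (D.mapChains_op _ (mul_rightAct h)) v).symm

/-- The operator `S` as an endomorphism of the representation `cInd_K^G ρ`. -/
def cIndSMap (ρ : Representation A (GL (Fin 2) ℤ_[p]) M) :
    (cIndRep p ρ).IntertwiningMap (cIndRep p ρ) :=
  LinearMap.intertwiningMap_of_isIntertwiningMap _ _ (cIndS p ρ) fun h v =>
    (LinearMap.congr_fun (mapChains_centralOp (ρ := ρ) (beta p) (beta_central p) _
      (mul_rightAct h)) v).symm

/-- A scalar as an endomorphism of a representation. -/
def scalarMap {G V : Type*} [Group G] [AddCommGroup V] [Module A V] (π : Representation A G V)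
    (c : A) : π.IntertwiningMap π :=
  LinearMap.intertwiningMap_of_isIntertwiningMap _ _ (c • LinearMap.id) fun h v => by simp

theorem simpHomology_map_smul (n : ℕ) (X : SimplicialObject (ModuleCat.{u} A)) (c : A) :
    (simpHomology A n).map (c • 𝟙 X) = c • 𝟙 _ := by
  refine Eq.trans ?_ ((ShortComplex.homologyMap_smul (𝟙 _) c).trans
    (congrArg (c • ·) (ShortComplex.homologyMap_id _)))
  change ShortComplex.homologyMap _ = _
  congr 1

theorem pArithMap_scalarMap (N : ℕ) (U : Subgroup (GL (Fin 2) (FinAdele p)))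
    {V : Type u} [AddCommGroup V] [Module A V] (π : Representation A (GL (Fin 2) ℚ_[p]) V)
    (c : A) (n : ℕ) (v : (simpHomology A n).obj (simpChains U (MonoidHom.id _) π)) :
    pArithMap N U (scalarMap π c) n v =
      LinearMap.lsmul A ((simpHomology A n).obj (simpChains U (MonoidHom.id _) π)) c v := by
  have h : (simpHomology A n).map (simpMap (U := U) (i := MonoidHom.id _) (scalarMap π c)) =
      c • 𝟙 _ := by
    rw [← simpHomology_map_smul]
    exact congrArg _ (simpMap_smul (U := U) (i := MonoidHom.id _) c)
  exact LinearMap.congr_fun (congrArg ModuleCat.Hom.hom h) v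

end Intertwining

end

noncomputable section

/-! ### Identification of the second page with Tor. -/

section TorTerm

theorem polyModule_X_zero_smul {k : Type u} [Field k] (V : ModuleCat.{u} k) (T S : V ⟶ V)
    (h : T ≫ S = S ≫ T) (v : V) :
    ((MvPolynomial.X 0 : MvPolynomial (Fin 2) k) • (show polyModule V T S h from v) :
      polyModule V T S h) = T.hom v :=
  LinearMap.congr_fun (polyHom_X_zero _ _ (commute_of_comp h)) v

theorem polyModule_X_one_smul {k : Type u} [Field k] (V : ModuleCat.{u} k) (T S : V ⟶ V)
    (h : T ≫ S = S ≫ T) (v : V) :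
    ((MvPolynomial.X 1 : MvPolynomial (Fin 2) k) • (show polyModule V T S h from v) :
      polyModule V T S h) = S.hom v :=
  LinearMap.congr_fun (polyHom_X_one _ _ (commute_of_comp h)) v

/-- The underlying vector space of `polyModule V T S h`. -/
@[reducible]
def polyModuleBase {k : Type u} [Field k] (V : ModuleCat.{u} k) (T S : V ⟶ V)
    (h : T ≫ S = S ≫ T) : Module k (polyModule V T S h) :=
  V.isModule

attribute [local instance] polyModuleBase

theorem polyModule_isScalarTower {k : Type u} [Field k] (V : ModuleCat.{u} k) (T S : V ⟶ V)
    (h : T ≫ S = S ≫ T) : IsScalarTower k (MvPolynomial (Fin 2) k) (polyModule V T S h) :=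
  IsScalarTower.of_algebraMap_smul fun c v =>
    LinearMap.congr_fun ((polyHom T.hom S.hom (commute_of_comp h)).commutes c) v

/-- The underlying `R`-module of `opModule V ops`. -/
@[reducible]
def opModuleBase {R : Type u} [CommRing R] {X : Type} (V : Type u) [AddCommGroup V]
    [i : Module R V] (ops : X → Module.End R V) : Module R (opModule V ops) :=
  i

attribute [local instance] opModuleBase eigenTorModule

theorem opModule_isScalarTower {R : Type u} [CommRing R] {X : Type} (V : Type u) [AddCommGroup V]
    [Module R V] (ops : X → Module.End R V) :
    IsScalarTower R (FreeAlgebra R X) (opModule V ops) :=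
  IsScalarTower.of_algebraMap_smul fun c v => opModule_algebraMap_smul ops c v

variable {p : ℕ} [Fact p.Prime] {k : Type u} [Field k] [Algebra (ZMod p) k]
  {R : Type u} [CommRing R] [Algebra k R] (N : ℕ) (U : Subgroup (GL (Fin 2) (FinAdele p)))
  (r : ℕ) (s : ℤ) (τ σ : R)

/-- The endomorphism `S - σ` of the compact induction. -/
def weightS (σ : R) : (cIndRep p (baseChangeRep R (weightRep p k r s))).IntertwiningMap
    (cIndRep p (baseChangeRep R (weightRep p k r s))) :=
  cIndSMap (baseChangeRep R (weightRep p k r s)) - scalarMap _ σ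

/-- The endomorphism `T - τ` of the compact induction. -/
def weightT (τ : R) : (cIndRep p (baseChangeRep R (weightRep p k r s))).IntertwiningMap
    (cIndRep p (baseChangeRep R (weightRep p k r s))) :=
  cIndTMap ((weightDatum p k r s).baseChange R) - scalarMap _ τ

theorem pArithMap_sub_scalarMap {V : Type u} [AddCommGroup V] [Module R V]
    (π : Representation R (GL (Fin 2) ℚ_[p]) V) (f : π.IntertwiningMap π) (c : R) (n : ℕ)
    (v : (simpHomology R n).obj (simpChains U (MonoidHom.id _) π)) :
    pArithMap N U (f - scalarMap π c) n v = (((simpHomology R n).map (simpMap f)).hom v -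
      LinearMap.lsmul R ((simpHomology R n).obj (simpChains U (MonoidHom.id _) π)) c v :
        (simpHomology R n).obj (simpChains U (MonoidHom.id _) π)) := by
  have e : f - scalarMap π c = f + -scalarMap π c :=
    Representation.IntertwiningMap.ext (sub_eq_add_neg f.toLinearMap _)
  rw [e, pArithMap_add, pArithMap_neg]
  exact (congrArg (fun w : (simpHomology R n).obj (simpChains U (MonoidHom.id _) π) =>
    (((simpHomology R n).map (simpMap f)).hom v + -w :
      (simpHomology R n).obj (simpChains U (MonoidHom.id _) π))) (pArithMap_scalarMap N U π c n v)).trans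
    (sub_eq_add_neg _ _).symm

/-- `nonempty_eigenTor_iso` for the module defined by two commuting operators. -/
theorem nonempty_eigenTor_polyModule_iso {X : Type} (V : ModuleCat.{u} k) (T S : V ⟶ V)
    (h : T ≫ S = S ≫ T) (f : X → (polyModule V T S h ⟶ polyModule V T S h)) (W : Type u)
    [AddCommGroup W] [Module R W] (ops : X → Module.End R W) (E : W ≃ₗ[R] R ⊗[k] V)
    (hg : ∀ x (c : R) (v : V), ops x (E.symm (c ⊗ₜ v)) = E.symm (c ⊗ₜ[k] ((f x).hom v : V)))
    (s' t' : Module.End (FreeAlgebra R X) (opModule W ops))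
    (ht : ∀ (c : R) (v : V), (t' (E.symm (c ⊗ₜ[k] v) : W) : W) =
      E.symm (c ⊗ₜ[k] T.hom v) - LinearMap.lsmul R W τ (E.symm (c ⊗ₜ[k] v)))
    (hs : ∀ (c : R) (v : V), (s' (E.symm (c ⊗ₜ[k] v) : W) : W) =
      E.symm (c ⊗ₜ[k] S.hom v) - LinearMap.lsmul R W σ (E.symm (c ⊗ₜ[k] v))) (i : ℕ) :
    Nonempty (opModule (eigenTor τ σ i (polyModule V T S h)) (fun x => eigenTorMap τ σ i (f x)) ≅
      kosHomology s' t' i) := by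
  have i₁ := polyModule_isScalarTower V T S h
  have i₂ := opModule_isScalarTower W ops
  let E' : opModule W ops ≃ₗ[R] R ⊗[k] polyModule V T S h := E
  refine nonempty_eigenTor_iso τ σ f E' (fun x c v => ?_) s' t' (fun c v => ?_) (fun c v => ?_) i
  · exact (opModule_ι_smul (V := W) ops x _).trans (hg x c v)
  · exact (ht c v).trans (congrArg (fun w : V => E.symm (c ⊗ₜ[k] w) -
      LinearMap.lsmul R W τ (E.symm (c ⊗ₜ[k] v))) (polyModule_X_zero_smul V T S h v).symm)
  · exact (hs c v).trans (congrArg (fun w : V => E.symm (c ⊗ₜ[k] w) -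
      LinearMap.lsmul R W σ (E.symm (c ⊗ₜ[k] v))) (polyModule_X_one_smul V T S h v).symm)

/-- The second page of the spectral sequence is the Koszul homology of the `p`-arithmetic homology
of the compact induction. -/
theorem nonempty_torTerm_iso (i j : ℕ) :
    Nonempty (torTerm k N U r s τ σ i j ≅
      kosHomology (pArithMap N U (weightS (k := k) (p := p) r s σ) j) (pArithMap N U (weightT r s τ) j) i) := by
  refine nonempty_eigenTor_polyModule_iso τ σ _ _ _ (arithT_arithS k U r s j)
    (arithHecke k U r s j) _ _ (shapiroEquiv R U (weightRep p k r s) j) (fun x c v => ?_) _ _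
    (fun c v => ?_) (fun c v => ?_) i
  · exact genEnd_shapiro x j c v
  -- The scalar τ acts on homology as itself, so it remains to match T on the coefficients with the
  -- adelic Hecke operator at p.
  · refine (pArithMap_sub_scalarMap N U _ _ τ j _).trans ?_
    refine congrArg₂ (· - ·) ?_ rfl
    refine shapiroEquiv_symm_map (β := heckeEnd (datumP U (weightDatum p k r s))) (fun Δ => ?_) j c v
    exact shapiroMap_cIndT R U (weightRep p k r s) (weightDatum p k r s)
      (levelRep_intertwining U (cIndTMap ((weightDatum p k r s).baseChange R)))
  · refine (pArithMap_sub_scalarMap N U _ _ σ j _).trans ?_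
    refine congrArg₂ (· - ·) ?_ rfl
    refine shapiroEquiv_symm_map (β := centralEnd U (inclK p) (weightRep p k r s) (betaAd p)
      betaAd_central) (fun Δ => ?_) j c v
    exact shapiroMap_cIndS R U (weightRep p k r s)
      (levelRep_intertwining U (cIndSMap (baseChangeRep R (weightRep p k r s))))

end TorTerm

end

noncomputable section

/-! ### The distance from the origin in the tree, through norms of matrices. -/

section EntryNorm

variable {p : ℕ} [Fact p.Prime]

/-- The maximum of the norms of the entries of a matrix. -/
def entryNorm (a : Matrix (Fin 2) (Fin 2) ℚ_[p]) : ℝ := ‖fun q : Fin 2 × Fin 2 => a q.1 q.2‖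

theorem norm_le_entryNorm (a : Matrix (Fin 2) (Fin 2) ℚ_[p]) (i j : Fin 2) :
    ‖a i j‖ ≤ entryNorm a :=
  norm_le_pi_norm (fun q : Fin 2 × Fin 2 => a q.1 q.2) (i, j)

theorem entryNorm_le {a : Matrix (Fin 2) (Fin 2) ℚ_[p]} {c : ℝ} (h : ∀ i j, ‖a i j‖ ≤ c) :
    entryNorm a ≤ c :=
  (pi_norm_le_iff_of_nonneg ((norm_nonneg _).trans (h 0 0))).2 fun q => h q.1 q.2

theorem exists_norm_eq_entryNorm (a : Matrix (Fin 2) (Fin 2) ℚ_[p]) :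
    ∃ i j, ‖a i j‖ = entryNorm a := by
  obtain ⟨q, hq⟩ := Finite.exists_max fun q : Fin 2 × Fin 2 => ‖a q.1 q.2‖
  exact ⟨q.1, q.2, le_antisymm (norm_le_entryNorm a _ _) (entryNorm_le fun i j => hq (i, j))⟩

theorem entryNorm_mul_le (a b : Matrix (Fin 2) (Fin 2) ℚ_[p]) (hb : ∀ i j, ‖b i j‖ ≤ 1) :
    entryNorm (a * b) ≤ entryNorm a := by
  refine entryNorm_le fun i j => ?_
  rw [Matrix.mul_apply, Fin.sum_univ_two]
  refine (Padic.nonarchimedean _ _).trans (max_le ?_ ?_) <;> rw [norm_mul]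
  · exact (mul_le_of_le_one_right (norm_nonneg _) (hb _ _)).trans (norm_le_entryNorm _ _ _)
  · exact (mul_le_of_le_one_right (norm_nonneg _) (hb _ _)).trans (norm_le_entryNorm _ _ _)

theorem norm_inclK_le (x : GL (Fin 2) ℤ_[p]) (i j : Fin 2) : ‖inclK p x i j‖ ≤ 1 :=
  (x i j).2

/-- Both x and x⁻¹ have integral entries, so right translation by K neither increases nor decreases
the norm. -/
theorem entryNorm_mul_inclK (g : GL (Fin 2) ℚ_[p]) (x : GL (Fin 2) ℤ_[p]) :
    entryNorm (g * inclK p x : GL (Fin 2) ℚ_[p]).1 = entryNorm g.1 := by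
  refine le_antisymm (entryNorm_mul_le g.1 (inclK p x).1 (norm_inclK_le x)) ?_
  have h := entryNorm_mul_le (g * inclK p x).1 (inclK p x⁻¹).1 (norm_inclK_le x⁻¹)
  rwa [← Units.val_mul, mul_assoc, ← map_mul, mul_inv_cancel, map_one, mul_one] at h

theorem mul_alpha_apply_zero (g : GL (Fin 2) ℚ_[p]) (i : Fin 2) :
    (g * alpha p : GL (Fin 2) ℚ_[p]) i 0 = g i 0 := by
  simp [alpha, diagGL]

theorem mul_beta_apply (g : GL (Fin 2) ℚ_[p]) (i j : Fin 2) :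
    (g * beta p : GL (Fin 2) ℚ_[p]) i j = g i j * p := by
  fin_cases j <;> simp [beta, diagGL, pUnit]

theorem norm_p_pos : (0 : ℝ) < ‖(p : ℚ_[p])‖ :=
  norm_pos_iff.2 (Nat.cast_ne_zero.2 (Fact.out : p.Prime).ne_zero)

theorem entryNorm_mul_alpha_le (g : GL (Fin 2) ℚ_[p]) :
    entryNorm (g * alpha p : GL (Fin 2) ℚ_[p]).1 ≤ entryNorm g.1 := by
  refine entryNorm_mul_le g.1 (alpha p).1 fun i j => ?_
  have h := (Padic.norm_p_lt_one (p := p)).le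
  rw [Padic.norm_p] at h
  fin_cases i <;> fin_cases j <;> simp [alpha, diagGL, pUnit, h]

theorem entryNorm_mul_beta (g : GL (Fin 2) ℚ_[p]) :
    entryNorm (g * beta p : GL (Fin 2) ℚ_[p]).1 = entryNorm g.1 * ‖(p : ℚ_[p])‖ := by
  refine le_antisymm (entryNorm_le fun i j => ?_) ?_
  · refine (congrArg norm (mul_beta_apply g i j)).trans_le ?_
    rw [norm_mul]
    exact mul_le_mul_of_nonneg_right (norm_le_entryNorm _ _ _) (norm_nonneg _)
  · obtain ⟨i, j, h⟩ := exists_norm_eq_entryNorm g.1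
    rw [← h, ← norm_mul]
    exact (congrArg norm (mul_beta_apply g i j)).symm.trans_le (norm_le_entryNorm _ _ _)

theorem entryNorm_pos (g : GL (Fin 2) ℚ_[p]) : 0 < entryNorm g.1 := by
  refine lt_of_le_of_ne (norm_nonneg _) fun h => g.det.ne_zero ?_
  have h₀ : ∀ i j, g.1 i j = 0 := fun i j =>
    norm_le_zero_iff.1 ((norm_le_entryNorm _ _ _).trans h.symm.le)
  rw [Matrix.GeneralLinearGroup.val_det_apply, Matrix.det_fin_two, h₀, h₀ 0 1]
  ring

theorem norm_det_inclK (x : GL (Fin 2) ℤ_[p]) : ‖((inclK p x).det : ℚ_[p])‖ = 1 := by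
  have h : ((inclK p x).det : ℚ_[p]) = ((x.det : ℤ_[p]) : ℚ_[p]) :=
    congrArg Units.val (Matrix.GeneralLinearGroup.map_det (algebraMap ℤ_[p] ℚ_[p]) x)
  rw [h, ← PadicInt.norm_def]
  exact PadicInt.norm_units _

theorem norm_det_alpha : ‖((alpha p).det : ℚ_[p])‖ = ‖(p : ℚ_[p])‖ := by
  congr 1
  simp [alpha, diagGL, pUnit]

theorem norm_det_beta : ‖((beta p).det : ℚ_[p])‖ = ‖(p : ℚ_[p])‖ ^ 2 := by
  rw [← norm_pow]
  congr 1
  simp [beta, diagGL, pUnit, sq]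

/-- The function `‖g‖² / |det g|` on `GL₂(ℚ_p)`, which measures the distance from the vertex fixed
by `GL₂(ℤ_p)` in the tree. -/
def treeDist (g : GL (Fin 2) ℚ_[p]) : ℝ := entryNorm g.1 ^ 2 / ‖(g.det : ℚ_[p])‖

theorem norm_det_pos (g : GL (Fin 2) ℚ_[p]) : 0 < ‖(g.det : ℚ_[p])‖ :=
  norm_pos_iff.2 g.det.ne_zero

theorem norm_det_mul (g h : GL (Fin 2) ℚ_[p]) :
    ‖((g * h).det : ℚ_[p])‖ = ‖(g.det : ℚ_[p])‖ * ‖(h.det : ℚ_[p])‖ := by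
  rw [map_mul, Units.val_mul, norm_mul]

theorem treeDist_pos (g : GL (Fin 2) ℚ_[p]) : 0 < treeDist g :=
  div_pos (pow_pos (entryNorm_pos g) 2) (norm_det_pos g)

theorem treeDist_mul_inclK (g : GL (Fin 2) ℚ_[p]) (x : GL (Fin 2) ℤ_[p]) :
    treeDist (g * inclK p x) = treeDist g := by
  rw [treeDist, treeDist, norm_det_mul, norm_det_inclK, mul_one, entryNorm_mul_inclK]

theorem treeDist_mul_beta (g : GL (Fin 2) ℚ_[p]) : treeDist (g * beta p) = treeDist g := by
  rw [treeDist, treeDist, norm_det_mul, norm_det_beta, entryNorm_mul_beta, mul_pow,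
    mul_div_mul_right _ _ (pow_ne_zero 2 norm_p_pos.ne')]

theorem treeDist_mul_alpha (g : GL (Fin 2) ℚ_[p]) : treeDist (g * alpha p) =
    (entryNorm (g * alpha p : GL (Fin 2) ℚ_[p]).1 / entryNorm g.1) ^ 2 * treeDist g *
      ‖(p : ℚ_[p])‖⁻¹ := by
  have h₁ := (entryNorm_pos g).ne'
  have h₂ := (norm_det_pos g).ne'
  have h₃ := (norm_p_pos (p := p)).ne'
  rw [treeDist, treeDist, norm_det_mul, norm_det_alpha]
  field_simp

/-- As |det α| = 1/p, a step along α that keeps the entry norm multiplies `treeDist` by p: it leads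
one edge away from the origin. -/
theorem treeDist_mul_alpha_of_le (g : GL (Fin 2) ℚ_[p])
    (h : entryNorm g.1 ≤ entryNorm (g * alpha p : GL (Fin 2) ℚ_[p]).1) :
    treeDist (g * alpha p) = treeDist g * ‖(p : ℚ_[p])‖⁻¹ := by
  rw [treeDist_mul_alpha, le_antisymm (entryNorm_mul_alpha_le g) h,
    div_self (entryNorm_pos g).ne', one_pow, one_mul]

/-- The contrapositive, used to recognize the steps that do not lead outwards. -/
theorem entryNorm_mul_alpha_lt (g : GL (Fin 2) ℚ_[p])
    (h : treeDist (g * alpha p) < treeDist g * ‖(p : ℚ_[p])‖⁻¹) :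
    entryNorm (g * alpha p : GL (Fin 2) ℚ_[p]).1 < entryNorm g.1 := by
  by_contra! h'
  exact h.ne (treeDist_mul_alpha_of_le g h')

theorem one_lt_norm_p_inv : 1 < ‖(p : ℚ_[p])‖⁻¹ :=
  (one_lt_inv₀ norm_p_pos).2 Padic.norm_p_lt_one

/-- Since α fixes the first column, lowering the norm of g forces its maximal entries into the
second column. If the norm of g x is lowered too, the first column of g x is small, hence by the
ultrametric inequality so is x 1 0 times the second column of g. Thus the inward directions at g
form at most one coset. -/
theorem norm_lt_one_of_entryNorm_lt (g : GL (Fin 2) ℚ_[p]) (x : GL (Fin 2) ℤ_[p])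
    (h₀ : entryNorm (g * alpha p : GL (Fin 2) ℚ_[p]).1 < entryNorm g.1)
    (h₁ : entryNorm (g * inclK p x * alpha p : GL (Fin 2) ℚ_[p]).1 < entryNorm g.1) :
    ‖x 1 0‖ < 1 := by
  have h₂ : ∀ i, ‖g i 0‖ < entryNorm g.1 := fun i =>
    (congrArg norm (mul_alpha_apply_zero g i)).symm.trans_lt
      ((norm_le_entryNorm _ _ _).trans_lt h₀)
  obtain ⟨i, j, hij⟩ := exists_norm_eq_entryNorm g.1
  have hj : j = 1 := by
    fin_cases j
    · exact absurd hij (h₂ i).ne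
    · rfl
  subst hj
  have h₃ : ‖g i 0 * inclK p x 0 0 + g i 1 * inclK p x 1 0‖ < entryNorm g.1 := by
    have := (norm_le_entryNorm _ i 0).trans_lt h₁
    have e := mul_alpha_apply_zero (g * inclK p x) i
    refine (congrArg norm (e.trans ?_)).symm.trans_lt this
    exact (Matrix.mul_apply ..).trans (Fin.sum_univ_two _)
  have h₄ : ‖g i 1 * inclK p x 1 0‖ < entryNorm g.1 := by
    have e : g i 1 * inclK p x 1 0 = (g i 0 * inclK p x 0 0 + g i 1 * inclK p x 1 0) +
        -(g i 0 * inclK p x 0 0) := by ring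
    rw [e]
    refine (Padic.nonarchimedean _ _).trans_lt (max_lt h₃ ?_)
    rw [norm_neg, norm_mul]
    exact (mul_le_of_le_one_right (norm_nonneg _) (norm_inclK_le x 0 0)).trans_lt (h₂ i)
  rw [norm_mul] at h₄
  have h₅ : entryNorm g.1 * ‖inclK p x 1 0‖ < entryNorm g.1 * 1 := by
    rw [mul_one]
    rwa [← hij] at h₄ ⊢
  exact lt_of_mul_lt_mul_left h₅ (entryNorm_pos g).le

theorem inclK_apply (x : GL (Fin 2) ℤ_[p]) (i j : Fin 2) : inclK p x i j = (x i j : ℚ_[p]) :=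
  rfl

/-- Membership in the stabiliser `K ∩ α K α⁻¹`. -/
theorem exists_alpha_iff (x : GL (Fin 2) ℤ_[p]) :
    (∃ x', inclK p x * alpha p = alpha p * inclK p x') ↔ ‖x 1 0‖ < 1 := by
  have hp : (p : ℚ_[p]) ≠ 0 := Nat.cast_ne_zero.2 (Fact.out : p.Prime).ne_zero
  constructor
  · rintro ⟨x', h⟩
    have e : (x 1 0 : ℚ_[p]) = p * (x' 1 0 : ℚ_[p]) := by
      have e := congrArg (fun g : GL (Fin 2) ℚ_[p] => g 1 0) h
      refine ((mul_alpha_apply_zero (inclK p x) 1).symm.trans e).trans ?_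
      simp [alpha, diagGL, pUnit, inclK_apply]
    rw [PadicInt.norm_def, e, norm_mul]
    exact (mul_le_of_le_one_right (norm_nonneg _) (x' 1 0).2).trans_lt Padic.norm_p_lt_one
  · intro h
    obtain ⟨c, hc⟩ := (PadicInt.norm_lt_one_iff_dvd _).1 h
    -- The candidate for x' is α⁻¹ x α, with lower left entry c = x 1 0 / p.
    have hdet : IsUnit (!![x 0 0, x 0 1 * p; c, x 1 1] : Matrix (Fin 2) (Fin 2) ℤ_[p]).det := by
      have e : (!![x 0 0, x 0 1 * p; c, x 1 1] : Matrix (Fin 2) (Fin 2) ℤ_[p]).det = x.det := by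
        rw [Matrix.det_fin_two_of, Matrix.GeneralLinearGroup.val_det_apply, Matrix.det_fin_two]
        linear_combination x 0 1 * hc
      rw [e]
      exact x.det.isUnit
    let x' := Matrix.GeneralLinearGroup.mk'' _ hdet
    have h₀ : inclK p x' 0 0 = (x 0 0 : ℚ_[p]) := rfl
    have h₁ : inclK p x' 0 1 = ((x 0 1 * p : ℤ_[p]) : ℚ_[p]) := rfl
    have h₂ : inclK p x' 1 0 = (c : ℚ_[p]) := rfl
    have h₃ : inclK p x' 1 1 = (x 1 1 : ℚ_[p]) := rfl
    refine ⟨x', ?_⟩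
    have hc' : (x 1 0 : ℚ_[p]) = p * c := by rw [hc, PadicInt.coe_mul, PadicInt.coe_natCast]
    ext i j
    fin_cases i <;> fin_cases j <;>
      simp [alpha, diagGL, pUnit, h₀, h₁, h₂, h₃, inclK_apply x, hc', mul_comm]

end EntryNorm

end

noncomputable section

/-! ### Coefficients of elements of an induction, and the vertices of the tree. -/

section OrbitCoeff

variable {A : Type u} [CommRing A] {P H Y : Type} [Group P] [Group H]
  {M : Type u} [AddCommGroup M] [Module A M] {j : H →* P} {act : P →* Equiv.Perm Y}
  (ρ : Representation A H M)

theorem exists_act_of_orbitRep_eq {y y' : Y} (h : orbitRep j act y = orbitRep j act y') :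
    ∃ x, act (j x) y = y' := by
  refine ⟨orbitElt j act y' * (orbitElt j act y)⁻¹, ?_⟩
  have e : act (j (orbitElt j act y)⁻¹) y = orbitRep j act y := by
    rw [map_inv, map_inv, Equiv.Perm.inv_eq_iff_eq, orbitElt_spec]
  rw [map_mul, map_mul, Equiv.Perm.mul_apply, e, h, orbitElt_spec]

theorem orbitRep_orbitRep (y : Y) : orbitRep j act (orbitRep j act y) = orbitRep j act y := by
  conv_rhs => rw [← orbitElt_spec (j := j) (act := act) y, orbitRep_act]

theorem normalForm_cls (hfree : ∀ (h : H) (y : Y), act (j h) y = y → h = 1) (y : Y) (m : M) :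
    normalForm ρ hfree (cls j act ρ y m) =
      Finsupp.single (orbitRep j act y) (ρ (orbitElt j act y)⁻¹ m) :=
  liftChains_cls _ _ _ _

/-- Consequently two points of the support lying in one orbit are equal, which later separates the
summands of a normal form. -/
theorem orbitRep_of_normalForm_ne_zero (hfree : ∀ (h : H) (y : Y), act (j h) y = y → h = 1)
    (x : Chains j act ρ) (y : Y) (h : normalForm ρ hfree x y ≠ 0) : orbitRep j act y = y := by
  contrapose! h
  induction x using chains_induction with
  | h0 => rw [map_zero, Finsupp.zero_apply]
  | hadd x x' hx hx' => rw [map_add, Finsupp.add_apply, hx, hx', add_zero]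
  | hcls y' m =>
    rw [normalForm_cls, Finsupp.single_eq_of_ne]
    rintro rfl
    exact h (orbitRep_orbitRep y')

/-- The coefficient of an element of `A[Y] ⊗_{A[H]} M` at the orbit of `y`. -/
def orbitCoeff (hfree : ∀ (h : H) (y : Y), act (j h) y = y → h = 1) (y : Y) :
    Chains j act ρ →ₗ[A] M :=
  Finsupp.lapply (orbitRep j act y) ∘ₗ normalForm ρ hfree

theorem orbitCoeff_cls_of_ne (hfree : ∀ (h : H) (y : Y), act (j h) y = y → h = 1) (y y' : Y)
    (h : ∀ x, act (j x) y' ≠ y) (m : M) : orbitCoeff ρ hfree y (cls j act ρ y' m) = 0 := by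
  change normalForm ρ hfree (cls j act ρ y' m) _ = 0
  rw [normalForm_cls, Finsupp.single_eq_of_ne]
  intro e
  obtain ⟨x, hx⟩ := exists_act_of_orbitRep_eq e.symm
  exact h x hx

theorem eq_zero_of_orbitCoeff_cls (hfree : ∀ (h : H) (y : Y), act (j h) y = y → h = 1) (y : Y)
    (m : M) (h : orbitCoeff ρ hfree y (cls j act ρ y m) = 0) : m = 0 := by
  change normalForm ρ hfree (cls j act ρ y m) _ = 0 at h
  rw [normalForm_cls, Finsupp.single_eq_same] at h
  have := congrArg (ρ (orbitElt j act y)) h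
  rwa [← Module.End.mul_apply, ← map_mul, mul_inv_cancel, map_one, map_zero] at this

theorem sum_cls_normalForm (hfree : ∀ (h : H) (y : Y), act (j h) y = y → h = 1)
    (x : Chains j act ρ) :
    ∑ y ∈ (normalForm ρ hfree x).support, cls j act ρ y (normalForm ρ hfree x y) = x := by
  conv_rhs => rw [← mk_normalForm hfree x, ← (normalForm ρ hfree x).sum_single, Finsupp.sum, map_sum]
  rfl

end OrbitCoeff

section ExtendedInclusion

variable {p : ℕ} [Fact p.Prime] {A : Type u} [CommRing A] {M : Type u} [AddCommGroup M] [Module A M]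

theorem commute_beta_zpow (g : GL (Fin 2) ℚ_[p]) (n : ℤ) : Commute g (beta p ^ n) :=
  Commute.zpow_right (beta_central p g).symm n

/-- The homomorphism `K × ℤ → G` given by the inclusion of `K` and by `β`. -/
def extIncl (p : ℕ) [Fact p.Prime] : GL (Fin 2) ℤ_[p] × Multiplicative ℤ →* GL (Fin 2) ℚ_[p] :=
  (inclK p).noncommCoprod (zpowersHom _ (beta p)) fun x n => commute_beta_zpow (inclK p x) n.toAdd

theorem extIncl_apply (h : GL (Fin 2) ℤ_[p] × Multiplicative ℤ) :
    extIncl p h = inclK p h.1 * beta p ^ h.2.toAdd :=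
  rfl

/-- The representation `ρ` of `K`, extended to `K × ℤ` by letting `n` act by `σ ^ n`. -/
def extRep (ρ : Representation A (GL (Fin 2) ℤ_[p]) M) (σ : Aˣ) :
    Representation A (GL (Fin 2) ℤ_[p] × Multiplicative ℤ) M where
  toFun h := ((σ ^ h.2.toAdd : Aˣ) : A) • ρ h.1
  map_one' := by simp
  map_mul' h h' := by
    rw [Prod.fst_mul, Prod.snd_mul, map_mul ρ, toAdd_mul, zpow_add, Units.val_mul, smul_mul_smul_comm]

theorem norm_det_beta_zpow (n : ℤ) :
    ‖((beta p ^ n).det : ℚ_[p])‖ = (‖(p : ℚ_[p])‖ ^ 2) ^ n := by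
  rw [map_zpow, Units.val_zpow_eq_zpow_val, norm_zpow, norm_det_beta]

theorem eq_zero_of_norm_det_beta_zpow (n : ℤ) (h : ‖((beta p ^ n).det : ℚ_[p])‖ = 1) : n = 0 := by
  rw [norm_det_beta_zpow] at h
  exact (zpow_eq_one_iff_right₀ (sq_nonneg _) (pow_lt_one₀ (norm_nonneg _) Padic.norm_p_lt_one
    two_ne_zero).ne).1 h

/-- The determinant separates the two factors: its norm is 1 on K and p^{-2n} on βⁿ, so a trivial
product has n = 0. -/
theorem extIncl_free (h : GL (Fin 2) ℤ_[p] × Multiplicative ℤ) (y : GL (Fin 2) ℚ_[p])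
    (hy : rightAct _ (extIncl p h) y = y) : h = 1 := by
  have h₁ : extIncl p h = 1 := inv_eq_one.1 (mul_eq_left.1 hy)
  rw [extIncl_apply] at h₁
  have h₂ := norm_det_mul (inclK p h.1) (beta p ^ h.2.toAdd)
  rw [h₁, norm_det_inclK, one_mul, map_one, Units.val_one, norm_one] at h₂
  have h₃ := eq_zero_of_norm_det_beta_zpow _ h₂.symm
  rw [h₃, zpow_zero, mul_one] at h₁
  exact Prod.ext (inclK_injective (h₁.trans (map_one _).symm)) (Multiplicative.toAdd.injective h₃)

theorem treeDist_mul_beta_zpow (g : GL (Fin 2) ℚ_[p]) (n : ℤ) :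
    treeDist (g * beta p ^ n) = treeDist g := by
  induction n with
  | zero => rw [zpow_zero, mul_one]
  | succ n h => rw [zpow_add, zpow_one, ← mul_assoc, treeDist_mul_beta, h]
  | pred n h => rw [← h, ← treeDist_mul_beta, mul_assoc, ← zpow_add_one, sub_add_cancel]

/-- Hence `treeDist` descends to the cosets of the group generated by K and β, that is, to the
vertices of the tree. -/
theorem treeDist_mul_extIncl (g : GL (Fin 2) ℚ_[p]) (h : GL (Fin 2) ℤ_[p] × Multiplicative ℤ) :
    treeDist (g * extIncl p h) = treeDist g := by
  rw [extIncl_apply, ← mul_assoc, treeDist_mul_beta_zpow, treeDist_mul_inclK]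

/-- The matrix exchanging the two basis vectors. -/
def swapMat (p : ℕ) [Fact p.Prime] : GL (Fin 2) ℤ_[p] where
  val := !![0, 1; 1, 0]
  inv := !![0, 1; 1, 0]
  val_inv := by simp [Matrix.one_fin_two]
  inv_val := by simp [Matrix.one_fin_two]

theorem swapMat_mul_self : swapMat p * swapMat p = 1 :=
  (swapMat p).val_inv |> Units.ext

/-- This is backtracking in the tree: after the step from y to y α, the step in the direction of the
swap returns to y, up to K and β. -/
theorem alpha_swapMat_alpha :
    alpha p * inclK p (swapMat p) * alpha p = inclK p (swapMat p) * beta p := by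
  ext i j
  fin_cases i <;> fin_cases j <;>
    simp [alpha, beta, diagGL, pUnit, inclK, swapMat]

/-- If `y x α` and `y₁ x₁ α` are equivalent modulo `K Z`, further away than `y₁`, and `y` is not
further away than `y₁`, then `y` and `y₁` are equivalent. -/
theorem exists_mul_extIncl_eq (y y₁ : GL (Fin 2) ℚ_[p]) (x x₁ : GL (Fin 2) ℤ_[p])
    (h : GL (Fin 2) ℤ_[p] × Multiplicative ℤ)
    (heq : y * (inclK p x * alpha p) * extIncl p h = y₁ * (inclK p x₁ * alpha p))
    (hle : treeDist y ≤ treeDist y₁)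
    (hx : entryNorm (y₁ * inclK p x₁ : GL (Fin 2) ℚ_[p]).1 ≤
      entryNorm (y₁ * inclK p x₁ * alpha p : GL (Fin 2) ℚ_[p]).1) :
    ∃ h', y * extIncl p h' = y₁ := by
  obtain ⟨k, n⟩ := h
  obtain ⟨n, rfl⟩ := Multiplicative.ofAdd.surjective n
  change y * (inclK p x * alpha p) * (inclK p k * beta p ^ n) = _ at heq
  set w := inclK p (swapMat p) with hw
  have hww : w * w = 1 := by rw [hw, ← map_mul, swapMat_mul_self, map_one]
  have hα : alpha p * (w * alpha p) = w * beta p := by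
    rw [← mul_assoc]
    exact alpha_swapMat_alpha
  have hb : ∀ g, beta p ^ n * g = g * beta p ^ n := fun g => (commute_beta_zpow g n).eq.symm
  set z := y₁ * (inclK p x₁ * alpha p) with hz
  have hzd : treeDist z = treeDist y₁ * ‖(p : ℚ_[p])‖⁻¹ := by
    rw [hz, ← mul_assoc, treeDist_mul_alpha_of_le _ hx, treeDist_mul_inclK]
  -- Seen from z, the vertex y₁ is the neighbour in direction w, and by `e₂` the vertex y is the
  -- neighbour in direction k⁻¹ w.
  have e₁ : z * w * alpha p = y₁ * inclK p x₁ * w * beta p := by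
    simp only [hz, mul_assoc, hα]
  have e₂ : z * (inclK p k)⁻¹ * w * alpha p = y * inclK p x * w * beta p * beta p ^ n := by
    rw [← heq]
    simp only [mul_assoc]
    rw [hb ((inclK p k)⁻¹ * (w * alpha p))]
    simp only [mul_assoc, mul_inv_cancel_left]
    rw [← mul_assoc w, ← mul_assoc (alpha p), hα, mul_assoc]
  -- Chosen so that w c = k⁻¹ w; it compares the two directions.
  set c := swapMat p * k⁻¹ * swapMat p with hc
  have e₃ : z * w * inclK p c * alpha p = z * (inclK p k)⁻¹ * w * alpha p := by
    rw [hc, map_mul, map_mul, map_inv, ← hw]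
    simp only [mul_assoc]
    rw [← mul_assoc w w, hww, one_mul]
  have hpos := (treeDist_pos y₁)
  have hlt : treeDist y₁ < treeDist y₁ * ‖(p : ℚ_[p])‖⁻¹ * ‖(p : ℚ_[p])‖⁻¹ := by
    rw [mul_assoc]
    exact lt_mul_of_one_lt_right hpos (one_lt_mul_of_lt_of_le one_lt_norm_p_inv
      one_lt_norm_p_inv.le)
  have hzw : treeDist (z * w) = treeDist y₁ * ‖(p : ℚ_[p])‖⁻¹ := by
    rw [hw, treeDist_mul_inclK, hzd]
  -- Neither y₁ nor y lies one step further out than z, so both directions at z are inward.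
  have l₁ : entryNorm (z * w * alpha p : GL (Fin 2) ℚ_[p]).1 < entryNorm (z * w).1 := by
    refine entryNorm_mul_alpha_lt _ ?_
    rwa [e₁, treeDist_mul_beta, hw, treeDist_mul_inclK, treeDist_mul_inclK, ← hw, hzw]
  have l₂ : entryNorm (z * w * inclK p c * alpha p : GL (Fin 2) ℚ_[p]).1 < entryNorm (z * w).1 := by
    rw [← entryNorm_mul_inclK (z * w) c]
    refine entryNorm_mul_alpha_lt _ ?_
    rw [e₃, e₂, treeDist_mul_beta_zpow, treeDist_mul_beta, hw, treeDist_mul_inclK,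
      treeDist_mul_inclK, ← hw, treeDist_mul_inclK, hzw]
    exact hle.trans_lt hlt
  -- There is at most one inward direction, so c lies in K ∩ α K α⁻¹ and the two neighbours agree
  -- modulo K and β.
  obtain ⟨x', hx'⟩ := (exists_alpha_iff c).2 (norm_lt_one_of_entryNorm_lt _ c l₁ l₂)
  -- The witness is obtained by solving y x w βⁿ = y₁ x₁ w x' for y₁.
  refine ⟨(x * swapMat p * x'⁻¹ * swapMat p * x₁⁻¹, Multiplicative.ofAdd n), ?_⟩
  have e₄ : y * inclK p x * w * beta p * beta p ^ n = y₁ * inclK p x₁ * w * beta p * inclK p x' := by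
    rw [← e₂, ← e₃, ← e₁, mul_assoc _ (inclK p c), hx', ← mul_assoc]
  have e₅ : y * inclK p x * w * beta p ^ n = y₁ * inclK p x₁ * w * inclK p x' := by
    refine mul_right_cancel (b := beta p) ?_
    rw [mul_assoc _ (inclK p x') (beta p), ← beta_central p (inclK p x'), ← mul_assoc, ← e₄,
      mul_assoc _ (beta p ^ n), hb (beta p), ← mul_assoc]
  change y * (inclK p _ * beta p ^ n) = y₁
  have e₆ : y * (inclK p (x * swapMat p * x'⁻¹ * swapMat p * x₁⁻¹) * beta p ^ n) =
      y * inclK p x * w * beta p ^ n * ((inclK p x')⁻¹ * w * (inclK p x₁)⁻¹) := by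
    simp only [map_mul, map_inv, mul_assoc, hb, ← hw]
  rw [e₆, e₅]
  simp only [mul_assoc, mul_inv_cancel_left]
  rw [← mul_assoc w w, hww, one_mul, mul_inv_cancel, mul_one]

theorem mem_stab_iff_norm_lt {ρ : Representation A (GL (Fin 2) ℤ_[p]) M}
    (D : HeckeDatum (inclK p) ρ) (hD : D.g = alpha p) (x : GL (Fin 2) ℤ_[p]) :
    x ∈ D.stab ↔ ‖x 1 0‖ < 1 := by
  rw [D.mem_stab, hD, exists_alpha_iff]

/-- Comparing determinants shows that h has no component along β; what remains says that x and x₁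
define the same coset. -/
theorem mem_stab_of_extIncl_eq {ρ : Representation A (GL (Fin 2) ℤ_[p]) M}
    (D : HeckeDatum (inclK p) ρ) (hD : D.g = alpha p) (x x₁ : GL (Fin 2) ℤ_[p])
    (h : GL (Fin 2) ℤ_[p] × Multiplicative ℤ)
    (heq : inclK p x * alpha p * extIncl p h = inclK p x₁ * alpha p) : x₁⁻¹ * x ∈ D.stab := by
  rw [extIncl_apply] at heq
  have e₁ := congrArg (fun g : GL (Fin 2) ℚ_[p] => ‖(g.det : ℚ_[p])‖) heq
  simp only [norm_det_mul, norm_det_inclK, norm_det_alpha, one_mul] at e₁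
  rw [eq_zero_of_norm_det_beta_zpow _ ((mul_eq_left₀ norm_p_pos.ne').1 e₁), zpow_zero,
    mul_one] at heq
  rw [D.mem_stab, hD]
  refine ⟨h.1⁻¹, ?_⟩
  rw [map_mul, map_inv, map_inv, mul_assoc, inv_mul_eq_iff_eq_mul, ← mul_assoc, ← heq,
    mul_inv_cancel_right]

/-- The stabiliser contains the kernel of reduction modulo p, and GL₂(𝔽_p) is finite. -/
theorem finite_quotient_stab {ρ : Representation A (GL (Fin 2) ℤ_[p]) M}
    (D : HeckeDatum (inclK p) ρ) (hD : D.g = alpha p) : Finite (GL (Fin 2) ℤ_[p] ⧸ D.stab) := by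
  let f : GL (Fin 2) ℤ_[p] →* GL (Fin 2) (ZMod p) := Matrix.GeneralLinearGroup.map PadicInt.toZMod
  have hf : f.ker ≤ D.stab := fun x hx => by
    rw [mem_stab_iff_norm_lt D hD]
    have e : PadicInt.toZMod (x 1 0) = 0 := congrArg (fun g : GL (Fin 2) (ZMod p) => g 1 0) hx
    have e' : x 1 0 ∈ IsLocalRing.maximalIdeal ℤ_[p] := PadicInt.ker_toZMod (p := p) ▸ e
    exact PadicInt.mem_nonunits.1 ((IsLocalRing.mem_maximalIdeal _).1 e')
  have : f.ker.FiniteIndex := Subgroup.finiteIndex_ker f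
  have : D.stab.FiniteIndex := Subgroup.finiteIndex_of_le hf
  exact D.stab.finite_quotient_of_finiteIndex

/-- At most one coset `x (K ∩ α K α⁻¹)` is such that `y x α` is closer than `y`. -/
theorem exists_exceptional_coset {ρ : Representation A (GL (Fin 2) ℤ_[p]) M}
    (D : HeckeDatum (inclK p) ρ) (hD : D.g = alpha p) (y : GL (Fin 2) ℚ_[p]) :
    ∃ x₀, ∀ x, x₀⁻¹ * x ∉ D.stab → entryNorm (y * inclK p x : GL (Fin 2) ℚ_[p]).1 ≤
      entryNorm (y * inclK p x * alpha p : GL (Fin 2) ℚ_[p]).1 := by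
  by_cases h : ∃ x₀, entryNorm (y * inclK p x₀ * alpha p : GL (Fin 2) ℚ_[p]).1 <
      entryNorm (y * inclK p x₀ : GL (Fin 2) ℚ_[p]).1
  · obtain ⟨x₀, h₀⟩ := h
    refine ⟨x₀, fun x hx => ?_⟩
    contrapose! hx
    rw [mem_stab_iff_norm_lt D hD]
    refine norm_lt_one_of_entryNorm_lt _ _ h₀ ?_
    rwa [mul_assoc y, ← map_mul, mul_inv_cancel_left, entryNorm_mul_inclK,
      ← entryNorm_mul_inclK y x]
  · push Not at h
    exact ⟨1, fun x _ => h x⟩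

end ExtendedInclusion

end

noncomputable section

/-! ### Regularity of (S - σ, T - τ) on the compact induction. -/

section Regularity

variable {p : ℕ} [Fact p.Prime] {A : Type u} [CommRing A] {M : Type u} [AddCommGroup M] [Module A M]
  {ρ : Representation A (GL (Fin 2) ℤ_[p]) M}

theorem valuation_det_inclK (x : GL (Fin 2) ℤ_[p]) : ((inclK p x).det : ℚ_[p]).valuation = 0 := by
  have h := norm_det_inclK x
  rw [Padic.norm_eq_zpow_neg_valuation (Units.ne_zero _)] at h
  have hp : (1 : ℝ) < p := mod_cast (Fact.out : p.Prime).one_lt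
  simpa using (zpow_eq_one_iff_right₀ (zero_le_one.trans hp.le) hp.ne').1 h

theorem valuation_det_beta : ((beta p).det : ℚ_[p]).valuation = 2 := by
  have : ((beta p).det : ℚ_[p]) = (p : ℚ_[p]) ^ 2 := by simp [beta, diagGL, pUnit, sq]
  rw [this, Padic.valuation_pow, Padic.valuation_p]
  rfl

theorem valuation_det_mul (g h : GL (Fin 2) ℚ_[p]) : ((g * h).det : ℚ_[p]).valuation =
    (g.det : ℚ_[p]).valuation + (h.det : ℚ_[p]).valuation := by
  rw [map_mul, Units.val_mul, Padic.valuation_mul (Units.ne_zero _) (Units.ne_zero _)]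

/-- The grading of the compact induction by the valuation of the determinant. -/
def detGrading (ρ : Representation A (GL (Fin 2) ℤ_[p]) M) : CInd p ρ →ₗ[A] ℤ →₀ CInd p ρ :=
  liftChains (ρ := ρ) (fun g => Finsupp.lsingle (g.det : ℚ_[p]).valuation ∘ₗ
    cls (inclK p) (rightAct _) ρ g) fun h g m => by
      have e : ((rightAct (GL (Fin 2) ℚ_[p]) (inclK p h) g).det : ℚ_[p]).valuation =
          (g.det : ℚ_[p]).valuation := by
        change ((g * (inclK p h)⁻¹).det : ℚ_[p]).valuation = _
        rw [valuation_det_mul, ← map_inv, valuation_det_inclK, add_zero]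
      rw [LinearMap.comp_apply, cls_smul, e, LinearMap.comp_apply]

theorem detGrading_cls (g : GL (Fin 2) ℚ_[p]) (m : M) :
    detGrading ρ (cls (inclK p) (rightAct _) ρ g m) =
      Finsupp.single (g.det : ℚ_[p]).valuation (cls (inclK p) (rightAct _) ρ g m) :=
  liftChains_cls _ _ _ _

theorem lsum_detGrading (x : CInd p ρ) :
    Finsupp.lsum A (fun _ : ℤ => (LinearMap.id : CInd p ρ →ₗ[A] CInd p ρ)) (detGrading ρ x) = x := by
  induction x using chains_induction with
  | h0 => rw [map_zero, map_zero]
  | hadd x x' hx hx' => rw [map_add, map_add, hx, hx']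
  | hcls g m => rw [detGrading_cls, Finsupp.lsum_single, LinearMap.id_apply]

theorem detGrading_cIndS (x : CInd p ρ) (n : ℤ) :
    detGrading ρ (cIndS p ρ x) n = cIndS p ρ (detGrading ρ x (n - 2)) := by
  induction x using chains_induction with
  | h0 => simp
  | hadd x x' hx hx' => simp only [map_add, Finsupp.add_apply, hx, hx']
  | hcls g m =>
    rw [cIndS_cls, detGrading_cls, detGrading_cls, valuation_det_mul, valuation_det_beta]
    by_cases h : (g.det : ℚ_[p]).valuation = n - 2
    · rw [h, sub_add_cancel, Finsupp.single_eq_same, Finsupp.single_eq_same, cIndS_cls]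
    · rw [Finsupp.single_eq_of_ne (Ne.symm h), Finsupp.single_eq_of_ne, map_zero]
      rintro rfl
      exact h (add_sub_cancel_right _ _).symm

/-- Let n be the lowest degree occurring in x. The degree n part of S x comes from degree n - 2 and
vanishes, so σ times the degree n part of x is zero; but σ is a unit. -/
theorem cIndS_sub_injective (σ : Aˣ) (x : CInd p ρ) (h : cIndS p ρ x = (σ : A) • x) : x = 0 := by
  suffices h₀ : detGrading ρ x = 0 by rw [← lsum_detGrading x, h₀, map_zero]
  by_contra h₀
  obtain ⟨n, hn, hmin⟩ := Finset.exists_min_image (detGrading ρ x).support id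
    (Finsupp.support_nonempty_iff.2 h₀)
  refine Finsupp.mem_support_iff.1 hn ?_
  have e := detGrading_cIndS x n
  have e' : detGrading ρ x (n - 2) = 0 := by
    by_contra h'
    have := hmin _ (Finsupp.mem_support_iff.2 h')
    simp only [id] at this
    lia
  rw [h, map_smul, Finsupp.smul_apply, e', map_zero] at e
  have e'' := congrArg (((σ⁻¹ : Aˣ) : A) • ·) e
  simpa only [smul_zero, ← mul_smul, Units.inv_mul, one_smul] using e''

/-- The quotient of the compact induction by `S - σ`, as an induction from `K × ℤ`. -/
def centralQuot (ρ : Representation A (GL (Fin 2) ℤ_[p]) M) (σ : Aˣ) :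
    CInd p ρ →ₗ[A] Chains (extIncl p) (rightAct (GL (Fin 2) ℚ_[p])) (extRep ρ σ) :=
  liftChains (ρ := ρ) (fun g => cls (extIncl p) (rightAct _) (extRep ρ σ) g) fun h g m => by
    have e := cls_smul (j := extIncl p) (act := rightAct (GL (Fin 2) ℚ_[p])) (ρ := extRep ρ σ)
      (h, 1) g m
    have e₁ : extIncl p (h, 1) = inclK p h := by
      rw [extIncl_apply, toAdd_one, zpow_zero, mul_one]
    have e₂ : extRep ρ σ (h, 1) m = ρ h m := by simp [extRep]
    rwa [e₁, e₂] at e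

theorem centralQuot_cls (σ : Aˣ) (g : GL (Fin 2) ℚ_[p]) (m : M) :
    centralQuot ρ σ (cls (inclK p) (rightAct _) ρ g m) =
      cls (extIncl p) (rightAct _) (extRep ρ σ) g m :=
  liftChains_cls _ _ _ _

theorem centralQuot_cIndS (σ : Aˣ) (x : CInd p ρ) :
    centralQuot ρ σ (cIndS p ρ x) = (σ : A) • centralQuot ρ σ x := by
  induction x using chains_induction with
  | h0 => simp
  | hadd x x' hx hx' => simp only [map_add, smul_add, hx, hx']
  | hcls g m =>
    rw [cIndS_cls, centralQuot_cls, centralQuot_cls]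
    have e := cls_smul (j := extIncl p) (act := rightAct (GL (Fin 2) ℚ_[p])) (ρ := extRep ρ σ)
      (1, Multiplicative.ofAdd 1) (g * beta p) m
    have e₁ : rightAct (GL (Fin 2) ℚ_[p]) (extIncl p (1, Multiplicative.ofAdd 1)) (g * beta p) =
        g := by
      rw [extIncl_apply, toAdd_ofAdd, zpow_one, map_one, one_mul]
      exact mul_inv_cancel_right g _
    have e₂ : extRep ρ σ (1, Multiplicative.ofAdd 1) m = (σ : A) • m := by simp [extRep]
    rw [← e, e₁, e₂, map_smul]

/-- The universal property yields an inverse of `centralQuot` modulo S - σ: in that quotient,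
translation by βⁿ is multiplication by σⁿ for every integer n, which is the relation imposed by
`extRep`. -/
theorem mem_range_of_centralQuot_eq_zero (σ : Aˣ) (x : CInd p ρ) (h : centralQuot ρ σ x = 0) :
    x ∈ LinearMap.range (cIndS p ρ - (σ : A) • 1) := by
  let I := LinearMap.range (cIndS p ρ - (σ : A) • 1)
  have h₁ : ∀ g m, I.mkQ (cls (inclK p) (rightAct _) ρ (g * beta p) m) =
      I.mkQ (cls (inclK p) (rightAct _) ρ g ((σ : A) • m)) := fun g m => by
    refine (Submodule.Quotient.eq I).2 ⟨cls (inclK p) (rightAct _) ρ g m, ?_⟩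
    rw [LinearMap.sub_apply, cIndS_cls, map_smul]
    rfl
  have h₂ : ∀ (n : ℤ) g m, I.mkQ (cls (inclK p) (rightAct _) ρ (g * beta p ^ n) m) =
      I.mkQ (cls (inclK p) (rightAct _) ρ g (((σ ^ n : Aˣ) : A) • m)) := fun n => by
    induction n with
    | zero => simp
    | succ n hn =>
      intro g m
      rw [zpow_add_one, ← mul_assoc, h₁, hn, zpow_add_one, Units.val_mul, mul_smul]
    | pred n hn =>
      intro g m
      have := hn g (((σ⁻¹ : Aˣ) : A) • m)
      rw [← mul_smul, ← Units.val_mul, ← zpow_sub_one] at this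
      rw [← this]
      have e := h₁ (g * beta p ^ (-(n : ℤ) - 1)) (((σ⁻¹ : Aˣ) : A) • m)
      rw [mul_assoc, ← zpow_add_one, sub_add_cancel, ← mul_smul, ← Units.val_mul, mul_inv_cancel,
        Units.val_one, one_smul] at e
      exact e.symm
  let ψ : Chains (extIncl p) (rightAct (GL (Fin 2) ℚ_[p])) (extRep ρ σ) →ₗ[A] CInd p ρ ⧸ I :=
    liftChains (ρ := extRep ρ σ) (fun g => I.mkQ ∘ₗ cls (inclK p) (rightAct _) ρ g) fun h g m => by
      obtain ⟨x, n⟩ := h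
      obtain ⟨n, rfl⟩ := Multiplicative.ofAdd.surjective n
      have e₁ : rightAct (GL (Fin 2) ℚ_[p]) (extIncl p (x, Multiplicative.ofAdd n)) g =
          rightAct _ (inclK p x) (g * beta p ^ (-n)) := by
        change g * (inclK p x * beta p ^ n)⁻¹ = g * beta p ^ (-n) * (inclK p x)⁻¹
        rw [mul_inv_rev, zpow_neg, mul_assoc]
      have e₂ : extRep ρ σ (x, Multiplicative.ofAdd n) m = ρ x (((σ ^ n : Aˣ) : A) • m) :=
        (map_smul _ _ _).symm
      rw [e₁, e₂, LinearMap.comp_apply, cls_smul, h₂, ← mul_smul, ← Units.val_mul, ← zpow_add,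
        neg_add_cancel, zpow_zero, Units.val_one, one_smul]
      rfl
  have hψ : ∀ x, ψ (centralQuot ρ σ x) = I.mkQ x := fun x => by
    induction x using chains_induction with
    | h0 => simp
    | hadd x x' hx hx' => simp only [map_add, hx, hx']
    | hcls g m =>
      rw [centralQuot_cls]
      exact liftChains_cls _ _ _ _
  change x ∈ I
  rw [← Submodule.ker_mkQ I, LinearMap.mem_ker, ← hψ, h, map_zero]

theorem centralQuot_eq_zero_of_mem_range (σ : Aˣ) (x : CInd p ρ)
    (h : x ∈ LinearMap.range (cIndS p ρ - (σ : A) • 1)) : centralQuot ρ σ x = 0 := by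
  obtain ⟨y, rfl⟩ := h
  rw [LinearMap.sub_apply, map_sub, centralQuot_cIndS]
  exact sub_eq_zero.2 (map_smul (centralQuot ρ σ) (σ : A) y).symm

theorem cIndT_cIndS (D : HeckeDatum (inclK p) ρ) (x : CInd p ρ) :
    cIndT p D (cIndS p ρ x) = cIndS p ρ (cIndT p D x) :=
  LinearMap.congr_fun (op_centralOp (act := rightAct _) D (beta p) (beta_central p)) x

theorem cIndT_mem_range (D : HeckeDatum (inclK p) ρ) (σ : Aˣ) (x : CInd p ρ)
    (h : x ∈ LinearMap.range (cIndS p ρ - (σ : A) • 1)) :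
    cIndT p D x ∈ LinearMap.range (cIndS p ρ - (σ : A) • 1) := by
  obtain ⟨y, rfl⟩ := h
  refine ⟨cIndT p D y, ?_⟩
  simp [cIndT_cIndS]

/-- The injectivity of `T - τ` modulo `S - σ`. -/
theorem centralQuot_eq_zero_of_cIndT (D : HeckeDatum (inclK p) ρ) (hD : D.g = alpha p)
    (hinj : ∀ m, (∀ x ∉ D.stab, D.φ (ρ x⁻¹ m) = 0) → m = 0) (τ : A) (σ : Aˣ) (x : CInd p ρ)
    (hx : centralQuot ρ σ (cIndT p D x) = τ • centralQuot ρ σ x) : centralQuot ρ σ x = 0 := by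
  have hfin := finite_quotient_stab D hD
  let _ := Fintype.ofFinite (GL (Fin 2) ℤ_[p] ⧸ D.stab)
  set f := normalForm (extRep ρ σ) extIncl_free (centralQuot ρ σ x) with hf
  by_contra h₀
  have hf0 : f ≠ 0 := fun h => h₀ (by
    rw [← mk_normalForm extIncl_free (centralQuot ρ σ x), ← hf, h, map_zero])
  -- A vertex of the support furthest from the origin.
  obtain ⟨y₁, hy₁, hmax⟩ := Finset.exists_max_image f.support treeDist
    (Finsupp.support_nonempty_iff.2 hf0)
  -- x is replaced by a lift supported on the chosen representatives of vertices. The hypothesis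
  -- survives because T preserves the range of S - σ.
  let x' : CInd p ρ := ∑ y ∈ f.support, cls (inclK p) (rightAct _) ρ y (f y)
  have hx' : centralQuot ρ σ x' = centralQuot ρ σ x := by
    rw [map_sum]
    exact (Finset.sum_congr rfl fun y _ => centralQuot_cls σ y (f y)).trans
      (sum_cls_normalForm (extRep ρ σ) extIncl_free _)
  have hTx' : centralQuot ρ σ (cIndT p D x') = τ • centralQuot ρ σ x' := by
    rw [hx', ← hx, ← sub_eq_zero, ← map_sub, ← map_sub]
    refine centralQuot_eq_zero_of_mem_range σ _ (cIndT_mem_range D σ _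
      (mem_range_of_centralQuot_eq_zero σ _ ?_))
    rw [map_sub, hx', sub_self]
  -- The relation T x' = τ x' is read at an outward neighbour z of y₁, where only the term of T x'
  -- indexed by y₁ and q contributes.
  have key : ∀ q : GL (Fin 2) ℤ_[p] ⧸ D.stab,
      entryNorm (y₁ * inclK p q.out : GL (Fin 2) ℚ_[p]).1 ≤
        entryNorm (y₁ * inclK p q.out * alpha p : GL (Fin 2) ℚ_[p]).1 →
      D.φ (ρ q.out⁻¹ (f y₁)) = 0 := fun q hq => by
    let z := y₁ * (inclK p q.out * alpha p)
    let C := orbitCoeff (extRep ρ σ) extIncl_free z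
    have hz : treeDist y₁ < treeDist z := by
      change _ < treeDist (y₁ * (inclK p q.out * alpha p))
      rw [← mul_assoc, treeDist_mul_alpha_of_le _ hq, treeDist_mul_inclK]
      exact lt_mul_of_one_lt_right (treeDist_pos y₁) one_lt_norm_p_inv
    -- z is further out than the whole support, so τ x' has no coefficient there.
    have c₁ : C (centralQuot ρ σ x') = 0 := by
      rw [map_sum, map_sum]
      refine Finset.sum_eq_zero fun y hy => ?_
      rw [centralQuot_cls]
      refine orbitCoeff_cls_of_ne _ extIncl_free _ _ (fun h e => ?_) _
      have e' : treeDist z = treeDist y := by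
        rw [← e]
        exact (congrArg (fun g => treeDist (y * g)) (map_inv (extIncl p) h).symm).trans
          (treeDist_mul_extIncl y h⁻¹)
      exact (e'.trans_le (hmax y hy)).not_gt hz
    -- Another vertex of the support reaching z would be no further out than y₁, hence equal to y₁,
    -- since z has a single inward neighbour; and starting from y₁ the vertex z determines the
    -- coset.
    have c₂ : ∀ y ∈ f.support, ∀ q' : GL (Fin 2) ℤ_[p] ⧸ D.stab, ¬ (y = y₁ ∧ q' = q) →
        C (cls (extIncl p) (rightAct _) (extRep ρ σ) (y * (inclK p q'.out * alpha p))
          (D.φ (ρ q'.out⁻¹ (f y)))) = 0 := fun y hy q' hne => by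
      refine orbitCoeff_cls_of_ne _ extIncl_free _ _ (fun h e => hne ?_) _
      have e' : y * (inclK p q'.out * alpha p) * extIncl p h⁻¹ = z :=
        (congrArg (y * (inclK p q'.out * alpha p) * ·) (map_inv (extIncl p) h)).trans e
      obtain ⟨h', hh'⟩ := exists_mul_extIncl_eq y y₁ q'.out q.out h⁻¹ e' (hmax y hy) hq
      have hyy : y = y₁ := by
        rw [← orbitRep_of_normalForm_ne_zero (extRep ρ σ) extIncl_free _ y
          (Finsupp.mem_support_iff.1 hy), ← orbitRep_of_normalForm_ne_zero (extRep ρ σ) extIncl_free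
          _ y₁ (Finsupp.mem_support_iff.1 hy₁), ← hh']
        have e'' : y * extIncl p h' = rightAct (GL (Fin 2) ℚ_[p]) (extIncl p h'⁻¹) y := by
          rw [map_inv]
          exact congrArg (y * ·) (inv_inv _).symm
        rw [e'', orbitRep_act]
      subst hyy
      refine ⟨rfl, ?_⟩
      rw [mul_assoc] at e'
      have hs := mem_stab_of_extIncl_eq D hD _ _ _ (mul_left_cancel e')
      rw [← QuotientGroup.out_eq' q', ← QuotientGroup.out_eq' q]
      exact (QuotientGroup.eq.2 hs).symm
    refine eq_zero_of_orbitCoeff_cls (extRep ρ σ) extIncl_free z _ ?_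
    have c₃ := congrArg C hTx'
    rw [map_smul, c₁, smul_zero, map_sum, map_sum, map_sum] at c₃
    rw [← c₃, Finset.sum_eq_single_of_mem y₁ hy₁, cIndT_cls, map_sum, map_sum,
      Finset.sum_eq_single_of_mem q (Finset.mem_univ q), centralQuot_cls, hD]
    · intro q' _ hne
      rw [centralQuot_cls, hD]
      exact c₂ y₁ hy₁ q' fun h => hne h.2
    · intro y hy hne
      rw [cIndT_cls, map_sum, map_sum]
      refine Finset.sum_eq_zero fun q' _ => ?_
      rw [centralQuot_cls, hD]
      exact c₂ y hy q' fun h => hne h.1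
  -- `key` treats the chosen coset representatives; compatibility of φ with K extends it to every x.
  have key' : ∀ x : GL (Fin 2) ℤ_[p], entryNorm (y₁ * inclK p x : GL (Fin 2) ℚ_[p]).1 ≤
      entryNorm (y₁ * inclK p x * alpha p : GL (Fin 2) ℚ_[p]).1 →
      D.φ (ρ x⁻¹ (f y₁)) = 0 := fun x hx => by
    have hs : (x : GL (Fin 2) ℤ_[p] ⧸ D.stab).out⁻¹ * x ∈ D.stab :=
      QuotientGroup.eq.1 (QuotientGroup.out_eq' _)
    set o := (x : GL (Fin 2) ℤ_[p] ⧸ D.stab).out with ho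
    obtain ⟨s, hs⟩ := (D.mem_stab _).1 hs
    have hx₁ : inclK p x * alpha p = inclK p o * alpha p * inclK p s := by
      rw [← hD, mul_assoc, ← hs, map_mul, map_inv]
      group
    have hx₂ : y₁ * inclK p x * alpha p = y₁ * inclK p o * alpha p * inclK p s := by
      rw [mul_assoc y₁, hx₁]
      simp only [mul_assoc]
    have h₁ := key (x : GL (Fin 2) ℤ_[p] ⧸ D.stab) (by
      rw [← ho, entryNorm_mul_inclK, ← entryNorm_mul_inclK y₁ x]
      exact hx.trans_eq ((congrArg (fun g : GL (Fin 2) ℚ_[p] => entryNorm g.1) hx₂).trans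
        (entryNorm_mul_inclK _ s)))
    rw [← ho] at h₁
    have h₂ := D.compat (o⁻¹ * x)⁻¹ s⁻¹ (by
      rw [map_inv, map_inv, inv_mul_eq_iff_eq_mul, ← mul_assoc, hs, mul_inv_cancel_right])
      (ρ o⁻¹ (f y₁))
    rw [h₁, map_zero, ← Module.End.mul_apply (ρ _), ← map_mul] at h₂
    rw [← h₂]
    congr 3
    group
  obtain ⟨x₀, hx₀⟩ := exists_exceptional_coset D hD y₁
  refine Finsupp.mem_support_iff.1 hy₁ ?_
  -- Translating by x₀ moves the one coset that may lead inwards to the trivial coset, the one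
  -- `hinj` does not require.
  have h := hinj (ρ x₀⁻¹ (f y₁)) fun x hx => by
    rw [← Module.End.mul_apply (ρ _), ← map_mul, ← mul_inv_rev]
    refine key' _ (hx₀ _ ?_)
    rwa [inv_mul_cancel_left]
  have := congrArg (ρ x₀) h
  rwa [← Module.End.mul_apply, ← map_mul, mul_inv_cancel, map_one, map_zero] at this

end Regularity

end

noncomputable section

/-! ### Joint injectivity on Serre weights, and the spectral sequence of part (1). -/

section Weights

/-- Over a field the joint map from W to the product of copies of W' has a linear retraction, and a
retraction survives base change. -/
theorem baseChange_jointly_injective {k : Type u} [Field k] (R : Type u) [CommRing R] [Algebra k R]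
    {W W' : Type u} [AddCommGroup W] [Module k W] [AddCommGroup W'] [Module k W'] {ι : Type}
    [Fintype ι] (B : ι → W →ₗ[k] W') (hB : ∀ w, (∀ i, B i w = 0) → w = 0) (w : R ⊗[k] W)
    (hw : ∀ i, (B i).baseChange R w = 0) : w = 0 := by
  classical
  obtain ⟨L, hL⟩ := (LinearMap.pi B).exists_leftInverse_of_injective
    (LinearMap.ker_eq_bot'.2 fun w h => hB w fun i => congrFun h i)
  have h : ∑ i, (L ∘ₗ LinearMap.single k (fun _ => W') i) ∘ₗ B i = LinearMap.id := by
    rw [← hL]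
    ext w
    simp only [LinearMap.sum_apply, LinearMap.comp_apply]
    rw [← map_sum]
    congr 1
    exact LinearMap.sum_single_apply (fun _ => W') fun i => B i w
  have e := congrArg (LinearMap.baseChangeHom k R W W) h
  rw [map_sum] at e
  have e' := LinearMap.congr_fun e w
  rw [LinearMap.sum_apply] at e'
  have e₀ : (LinearMap.baseChangeHom k R W W LinearMap.id) w = w :=
    LinearMap.congr_fun LinearMap.baseChange_id w
  rw [← e₀, ← e']
  refine Finset.sum_eq_zero fun i _ => ?_
  change ((L ∘ₗ LinearMap.single k (fun _ => W') i) ∘ₗ B i).baseChange R w = 0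
  rw [LinearMap.baseChange_comp, LinearMap.comp_apply, hw, map_zero]

variable {p : ℕ} [Fact p.Prime] {k : Type u} [Field k] [Algebra (ZMod p) k]

/-- The binomial coefficient divides r!, which is prime to p for r < p. -/
theorem choose_cast_ne_zero (r j : ℕ) (hr : r < p) (hj : j ≤ r) : (r.choose j : k) ≠ 0 := by
  have : CharP k p := charP_of_injective_algebraMap (algebraMap (ZMod p) k).injective p
  rw [Ne, CharP.cast_eq_zero_iff k p]
  intro h
  have h₁ : p ∣ r.factorial := by
    rw [← Nat.choose_mul_factorial_mul_factorial hj, mul_assoc]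
    exact h.mul_right _
  exact hr.not_ge ((Nat.Prime.dvd_factorial Fact.out).1 h₁)

/-- In small degree, the powers of the linear forms `a X + Y` span the homogeneous polynomials. -/
theorem weight_eq_zero_of_pow (r : ℕ) (hr : r < p)
    (F : MvPolynomial (Fin 2) k →ₗ[k] k)
    (hF : ∀ a : ZMod p, F ((algebraMap (ZMod p) k a • MvPolynomial.X 0 + MvPolynomial.X 1) ^ r) = 0)
    (v : MvPolynomial (Fin 2) k) (hv : v.IsHomogeneous r) : F v = 0 := by
  let c : ℕ → k := fun j => F (MvPolynomial.X 0 ^ j * MvPolynomial.X 1 ^ (r - j))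
  -- P(a) is the value of F on (a X + Y)^r. It vanishes at the p elements of 𝔽_p and has degree at
  -- most r < p, so P = 0, and nonvanishing of the binomials gives the vanishing of F on all
  -- monomials of degree r.
  let P : Polynomial k := ∑ j ∈ Finset.range (r + 1), Polynomial.monomial j (r.choose j * c j)
  have hP : P = 0 := by
    refine Polynomial.eq_zero_of_natDegree_lt_card_of_eval_eq_zero P
      (algebraMap (ZMod p) k).injective (fun a => ?_) ?_
    · rw [← hF a, add_pow, Polynomial.eval_finsetSum, map_sum]
      refine Finset.sum_congr rfl fun j _ => ?_
      have e : F ((r.choose j : MvPolynomial (Fin 2) k) * (MvPolynomial.X 0 ^ j *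
          MvPolynomial.X 1 ^ (r - j))) = r.choose j * c j := by
        rw [← nsmul_eq_mul, map_nsmul, nsmul_eq_mul]
      rw [Polynomial.eval_monomial, smul_pow, smul_mul_assoc, smul_mul_assoc, map_smul,
        mul_comm _ (r.choose j : MvPolynomial (Fin 2) k), e, smul_eq_mul, mul_comm]
    · rw [ZMod.card]
      refine lt_of_le_of_lt (Polynomial.natDegree_sum_le_of_forall_le _ _ fun j hj => ?_) hr
      exact (Polynomial.natDegree_monomial_le _).trans (Finset.mem_range_succ_iff.1 hj)
  have hc : ∀ j ≤ r, c j = 0 := fun j hj => by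
    have e := congrArg (fun Q => Polynomial.coeff Q j) hP
    simp only [P, Polynomial.finsetSum_coeff, Polynomial.coeff_monomial, Polynomial.coeff_zero,
      Finset.sum_ite_eq', Finset.mem_range_succ_iff, if_pos hj] at e
    exact (mul_eq_zero.1 e).resolve_left (choose_cast_ne_zero r j hr hj)
  rw [v.as_sum, map_sum]
  refine Finset.sum_eq_zero fun d hd => ?_
  have hd' : d 0 + d 1 = r := by
    have := hv (MvPolynomial.mem_support_iff.1 hd)
    rwa [Finsupp.weight_apply, Finsupp.sum_fintype _ _ (by simp), Fin.sum_univ_two, Pi.one_apply,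
      Pi.one_apply, smul_eq_mul, smul_eq_mul, mul_one, mul_one] at this
  rw [MvPolynomial.monomial_eq, ← MvPolynomial.smul_eq_C_mul, map_smul,
    Finsupp.prod_fintype _ _ (by simp), Fin.prod_univ_two]
  have := hc (d 0) (by lia)
  rw [show d 1 = r - d 0 by lia]
  exact (congrArg (_ • ·) this).trans (smul_zero _)

/-- The matrix with rows `(a, 1)` and `(1, 0)`. -/
def cosetMat (a : ℤ_[p]) : GL (Fin 2) ℤ_[p] where
  val := !![a, 1; 1, 0]
  inv := !![0, 1; 1, -a]
  val_inv := by simp [Matrix.one_fin_two]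
  inv_val := by simp [Matrix.one_fin_two]

/-- Everything is tested on X^r. Modulo p the matrix α fixes X, and `cosetMat a` sends X to a X + Y,
so up to a unit the hypothesis evaluates f on (a X + Y)^r; these powers span in degree r < p. -/
theorem weight_eq_zero (r : ℕ) (hr : r < p) (s : ℤ) (f : Weight k r)
    (hf : ∀ a : ZMod p, weightAlpha p k r (weightRep p k r s (cosetMat (a.val : ℤ_[p]))⁻¹ f) = 0) :
    f = 0 := by
  -- Extending f to all polynomials lets it be evaluated on monomials without carrying proofs of
  -- homogeneity.
  obtain ⟨F, hF⟩ := LinearMap.exists_extend f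
  have hF' : ∀ v : SymPow k r, F v.1 = f v := fun v => LinearMap.congr_fun hF v
  ext v
  rw [← hF']
  refine weight_eq_zero_of_pow r hr F (fun a => ?_) v.1 v.2
  let X₀ : SymPow k r := ⟨MvPolynomial.X 0 ^ r, by
    simpa using (MvPolynomial.isHomogeneous_X k (0 : Fin 2)).pow r⟩
  have e := LinearMap.congr_fun (hf a) X₀
  have e₁ : symAction k r (reduceMat p k (alphaInt p)) X₀ = X₀ := by
    apply Subtype.ext
    change MvPolynomial.aeval (R := k) (fun j : Fin 2 => ∑ i, reduceMat p k (alphaInt p) i j •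
      (MvPolynomial.X i : MvPolynomial (Fin 2) k)) (MvPolynomial.X 0 ^ r) = MvPolynomial.X 0 ^ r
    rw [map_pow, MvPolynomial.aeval_X, Fin.sum_univ_two]
    simp [reduceMat, alphaInt]
  have e₂ : (symAction k r (reduceMat p k (cosetMat (a.val : ℤ_[p])).1) X₀).1 =
      (algebraMap (ZMod p) k a • MvPolynomial.X 0 + MvPolynomial.X 1) ^ r := by
    change MvPolynomial.aeval (R := k) (fun j : Fin 2 => ∑ i, reduceMat p k (cosetMat (a.val : ℤ_[p])).1 i j •
      (MvPolynomial.X i : MvPolynomial (Fin 2) k)) (MvPolynomial.X 0 ^ r) = _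
    rw [map_pow, MvPolynomial.aeval_X, Fin.sum_univ_two]
    simp [reduceMat, cosetMat]
  have e₃ : (((omega p k ^ s) (inclK p (cosetMat (a.val : ℤ_[p]))⁻¹).det : kˣ) : k) *
      f (symAction k r (reduceMat p k (cosetMat (a.val : ℤ_[p])).1)
        (symAction k r (reduceMat p k (alphaInt p)) X₀)) = 0 := by
    refine Eq.trans ?_ e
    simp only [weightRep, weightAlpha, MonoidHom.coe_mk, OneHom.coe_mk, LinearMap.smul_apply,
      map_smul, inv_inv, Module.Dual.transpose_apply, LinearMap.comp_apply, smul_eq_mul]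
  rw [e₁] at e₃
  rw [← e₂, hF']
  exact (mul_eq_zero.1 e₃).resolve_left (Units.ne_zero _)

/-- The lower left entry of `cosetMat a` is 1, so these matrices avoid the stabiliser. Being
finitely many, they still test injectivity after base change to R. -/
theorem weight_baseChange_eq_zero (R : Type u) [CommRing R] [Algebra k R] (r : ℕ) (hr : r < p)
    (s : ℤ) (w : R ⊗[k] Weight k r)
    (hw : ∀ x ∉ ((weightDatum p k r s).baseChange R).stab,
      ((weightDatum p k r s).baseChange R).φ (baseChangeRep R (weightRep p k r s) x⁻¹ w) = 0) :
    w = 0 := by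
  refine baseChange_jointly_injective R
    (fun a : ZMod p => weightAlpha p k r ∘ₗ weightRep p k r s (cosetMat (a.val : ℤ_[p]))⁻¹)
    (weight_eq_zero r hr s) w fun a => ?_
  rw [LinearMap.baseChange_comp]
  refine hw (cosetMat (a.val : ℤ_[p])) ?_
  rw [mem_stab_iff_norm_lt _ rfl]
  simp [cosetMat]

variable {R : Type u} [CommRing R] [Algebra k R] (r : ℕ) (s : ℤ) (τ : R) (σ : Rˣ)

theorem weightS_injective : Function.Injective (weightS (p := p) (k := k) r s (σ : R)) := by
  refine (injective_iff_map_eq_zero _).2 fun x hx => cIndS_sub_injective σ x ?_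
  exact sub_eq_zero.1 hx

theorem weightS_weightT (x) : weightS (p := p) (k := k) r s (σ : R) (weightT r s τ x) =
    weightT r s τ (weightS r s (σ : R) x) := by
  let S := cIndS p (baseChangeRep R (weightRep p k r s))
  let T := cIndT p ((weightDatum p k r s).baseChange R)
  change S (T x - τ • x) - (σ : R) • (T x - τ • x) = T (S x - (σ : R) • x) - τ • (S x - (σ : R) • x)
  have h : T (S x) = S (T x) := cIndT_cIndS _ x
  simp only [map_sub, map_smul, smul_sub, h, smul_comm τ (σ : R)]
  abel

/-- The kernel of `centralQuot` is the range of S - σ, so injectivity of T - τ after applying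
`centralQuot` is the regularity that the Koszul resolution requires. -/
theorem weightT_regular (hr : r < p) (x y) (h : weightT (p := p) (k := k) r s τ x =
    weightS r s (σ : R) y) : ∃ x', x = weightS r s (σ : R) x' := by
  have h₀ := centralQuot_eq_zero_of_mem_range σ (weightT (p := p) (k := k) r s τ x) ⟨y, h.symm⟩
  have h₁ : centralQuot (baseChangeRep R (weightRep p k r s)) σ
      (cIndT p ((weightDatum p k r s).baseChange R) x - τ • x) = 0 := h₀
  rw [map_sub, map_smul, sub_eq_zero] at h₁
  obtain ⟨x', hx'⟩ := mem_range_of_centralQuot_eq_zero σ x (centralQuot_eq_zero_of_cIndT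
    ((weightDatum p k r s).baseChange R) rfl (weight_baseChange_eq_zero R r hr s) τ σ x h₁)
  exact ⟨x', hx'.symm⟩

theorem range_sup_range_le_comap {G V : Type*} [Group G] [AddCommGroup V] [Module R V]
    {π : Representation R G V} (t s : π.IntertwiningMap π) (g : G) :
    LinearMap.range t.toLinearMap ⊔ LinearMap.range s.toLinearMap ≤
      (LinearMap.range t.toLinearMap ⊔ LinearMap.range s.toLinearMap).comap (π g) := by
  refine sup_le ?_ ?_
  · rintro _ ⟨v, rfl⟩
    exact Submodule.mem_sup_left ⟨π g v, t.isIntertwining _ _ g v⟩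
  · rintro _ ⟨v, rfl⟩
    exact Submodule.mem_sup_right ⟨π g v, s.isIntertwining _ _ g v⟩

/-- The spectral sequence converging to the `p`-arithmetic homology of `π̃(r, τ, σ, s)_R`. -/
theorem exists_piTilde_spectralSequence (hr : r < p) (N : ℕ)
    (U : Subgroup (GL (Fin 2) (FinAdele p))) :
    ∃ E : HomologicalSS (ModuleCat.{u} (FreeAlgebra R (HeckeGen p N))),
      (∀ i j : ℕ, Nonempty ((E.page 2 le_rfl).X (i, j) ≅ torTerm k N U r s τ (σ : R) i j)) ∧
        ConvergesTo E fun n => pArithHomology N U (piTilde p k r τ σ s) n := by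
  obtain ⟨E, h₁, h₂⟩ := exists_koszul_spectralSequence N U
    (weightS (p := p) (k := k) r s (σ : R)) (weightT r s τ)
    (weightS_weightT r s τ σ) (weightS_injective r s σ)
    (fun x y h => weightT_regular r s τ σ hr x y h)
    (eigenSub p ((weightDatum p k r s).baseChange R) τ σ) rfl
    (range_sup_range_le_comap (weightT (p := p) (k := k) r s τ) (weightS r s (σ : R)))
  refine ⟨E, fun i j => ?_, h₂⟩
  obtain ⟨e⟩ := h₁ i j
  obtain ⟨e'⟩ := nonempty_torTerm_iso (k := k) N U r s τ (σ : R) i j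
  exact ⟨e ≪≫ e'.symm⟩

end Weights

end

noncomputable section

/-! ### Twisting compact inductions by characters of G. -/

section Twist

variable {p : ℕ} [Fact p.Prime] {A : Type u} [CommRing A] {M M' : Type u} [AddCommGroup M]
  [Module A M] [AddCommGroup M'] [Module A M'] {ρ : Representation A (GL (Fin 2) ℤ_[p]) M}
  {ρ' : Representation A (GL (Fin 2) ℤ_[p]) M'}

/-- The map `[g, m] ↦ χ(det g)⁻¹ [g, e m]` between compact inductions of representations which
differ by a twist by `χ`. -/
def twistInd (χ : ℚ_[p]ˣ →* Aˣ) (e : M →ₗ[A] M')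
    (he : ∀ h m, ρ' h (e m) = ((χ (inclK p h).det : Aˣ) : A) • e (ρ h m)) :
    CInd p ρ →ₗ[A] CInd p ρ' :=
  liftChains (ρ := ρ) (fun g => ((χ g.det)⁻¹ : Aˣ) • (cls (inclK p) (rightAct _) ρ' g ∘ₗ e))
    fun h g m => by
      have e₁ : (rightAct (GL (Fin 2) ℚ_[p]) (inclK p h) g).det = g.det * (inclK p h).det⁻¹ := by
        rw [← map_inv, ← map_mul]
        rfl
      have e₂ : e (ρ h m) = (χ (inclK p h).det)⁻¹ • ρ' h (e m) := by
        rw [he, Units.smul_def, smul_smul, Units.inv_mul, one_smul]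
      rw [LinearMap.smul_apply, LinearMap.smul_apply, LinearMap.comp_apply, LinearMap.comp_apply,
        e₂, Units.smul_def (χ _)⁻¹ (ρ' h (e m)), map_smul, ← Units.smul_def, cls_smul, smul_smul, e₁,
        map_mul, map_inv χ, mul_inv_rev, inv_inv, mul_comm (χ (inclK p h).det),
        mul_inv_cancel_right]

variable (χ : ℚ_[p]ˣ →* Aˣ)

theorem twistInd_cls (e : M →ₗ[A] M')
    (he : ∀ h m, ρ' h (e m) = ((χ (inclK p h).det : Aˣ) : A) • e (ρ h m)) (g : GL (Fin 2) ℚ_[p])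
    (m : M) : twistInd χ e he (cls (inclK p) (rightAct _) ρ g m) =
      (((χ g.det)⁻¹ : Aˣ) : A) • cls (inclK p) (rightAct _) ρ' g (e m) :=
  liftChains_cls _ _ _ _

/-- The map `twistInd`, as an isomorphism. -/
def twistIndEquiv (e : M ≃ₗ[A] M')
    (he : ∀ h m, ρ' h (e m) = ((χ (inclK p h).det : Aˣ) : A) • e (ρ h m)) :
    CInd p ρ ≃ₗ[A] CInd p ρ' :=
  have he' : ∀ h m, ρ h (e.symm m) = ((χ⁻¹ (inclK p h).det : Aˣ) : A) • e.symm (ρ' h m) :=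
    fun h m => by
      refine e.injective ?_
      have := he h (e.symm m)
      rw [e.apply_symm_apply] at this
      rw [map_smul, e.apply_symm_apply, this, smul_smul, MonoidHom.inv_apply, Units.inv_mul, one_smul]
  LinearEquiv.ofLinearMap (twistInd χ e.toLinearMap he) (twistInd χ⁻¹ e.symm.toLinearMap he')
    (chains_ext fun g m => by
      rw [LinearMap.comp_apply, twistInd_cls, map_smul, twistInd_cls, smul_smul, MonoidHom.inv_apply,
        inv_inv, Units.mul_inv, one_smul]
      exact congrArg _ (e.apply_symm_apply m))
    (chains_ext fun g m => by
      rw [LinearMap.comp_apply, twistInd_cls, map_smul, twistInd_cls, smul_smul, MonoidHom.inv_apply,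
        inv_inv, Units.inv_mul, one_smul]
      exact congrArg _ (e.symm_apply_apply m))

variable (e : M ≃ₗ[A] M') (he : ∀ h m, ρ' h (e m) = ((χ (inclK p h).det : Aˣ) : A) • e (ρ h m))

theorem twistIndEquiv_cls (g : GL (Fin 2) ℚ_[p]) (m : M) :
    twistIndEquiv χ e he (cls (inclK p) (rightAct _) ρ g m) =
      (((χ g.det)⁻¹ : Aˣ) : A) • cls (inclK p) (rightAct _) ρ' g (e m) :=
  twistInd_cls χ _ he g m

theorem twistIndEquiv_cIndRep (h : GL (Fin 2) ℚ_[p]) (x : CInd p ρ) :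
    twistIndEquiv χ e he (((χ h.det : Aˣ) : A) • cIndRep p ρ h x) =
      cIndRep p ρ' h (twistIndEquiv χ e he x) := by
  induction x using chains_induction with
  | h0 => simp
  | hadd x x' hx hx' => simp only [map_add, smul_add, hx, hx']
  | hcls g m =>
    rw [map_smul, cIndRep_cls, twistIndEquiv_cls, twistIndEquiv_cls, map_smul, cIndRep_cls, smul_smul,
      ← Units.val_mul, map_mul, map_mul, mul_inv_rev, mul_comm, inv_mul_cancel_right]

theorem twistIndEquiv_cIndS (x : CInd p ρ) : twistIndEquiv χ e he (cIndS p ρ x) =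
    (((χ (beta p).det)⁻¹ : Aˣ) : A) • cIndS p ρ' (twistIndEquiv χ e he x) := by
  induction x using chains_induction with
  | h0 => simp
  | hadd x x' hx hx' => simp only [map_add, smul_add, hx, hx']
  | hcls g m =>
    rw [cIndS_cls, twistIndEquiv_cls, twistIndEquiv_cls, map_smul, cIndS_cls, smul_smul,
      ← Units.val_mul, map_mul, map_mul, mul_inv_rev]

/-- The factors χ(det g) and χ(det x) occur on both sides, the latter on the right through the
action of x⁻¹ on the twisted coefficients; only χ(det α) is left over. -/
theorem twistIndEquiv_cIndT (D : HeckeDatum (inclK p) ρ) (D' : HeckeDatum (inclK p) ρ')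
    (hD : D.g = alpha p) (hD' : D'.g = alpha p) (hφ : ∀ m, D'.φ (e m) = e (D.φ m)) (x : CInd p ρ) :
    twistIndEquiv χ e he (cIndT p D x) =
      (((χ (alpha p).det)⁻¹ : Aˣ) : A) • cIndT p D' (twistIndEquiv χ e he x) := by
  have hfin := finite_quotient_stab D hD
  let _ := Fintype.ofFinite (GL (Fin 2) ℤ_[p] ⧸ D.stab)
  have hs : D.stab = D'.stab := Subgroup.ext fun x => by
    rw [mem_stab_iff_norm_lt D hD, mem_stab_iff_norm_lt D' hD']
  have hbij : Function.Bijective fun q : GL (Fin 2) ℤ_[p] ⧸ D.stab =>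
      (q.out : GL (Fin 2) ℤ_[p] ⧸ D'.stab) := hs ▸ bijective_quotient_out D.stab
  have hT : ∀ g m, cIndT p D' (cls (inclK p) (rightAct _) ρ' g m) =
      ∑ q : GL (Fin 2) ℤ_[p] ⧸ D.stab, cls (inclK p) (rightAct _) ρ'
        (g * (inclK p q.out * alpha p)) (D'.φ (ρ' q.out⁻¹ m)) := fun g m => by
    refine (D'.op_cls_eq_sum Quotient.out hbij g m).trans (Finset.sum_congr rfl fun q _ => ?_)
    rw [hD']
    exact congrArg (fun g => cls (inclK p) (rightAct _) ρ' g _) (congrArg (g * ·) (inv_inv _))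
  induction x using chains_induction with
  | h0 => simp
  | hadd x x' hx hx' => simp only [map_add, smul_add, hx, hx']
  | hcls g m =>
    rw [twistIndEquiv_cls, map_smul, cIndT_cls, hT, map_sum, Finset.smul_sum, Finset.smul_sum]
    refine Finset.sum_congr rfl fun q _ => ?_
    rw [twistIndEquiv_cls, he, map_smul, map_smul, hφ, smul_smul, smul_smul, ← Units.val_mul,
      ← Units.val_mul, hD]
    refine congrArg (fun c : Aˣ => (c : A) • _) ?_
    simp only [map_mul, map_inv, mul_inv_rev, mul_assoc, mul_comm]

/-- Scaling by a unit changes the operator but not its range. -/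
theorem map_range_of_smul_comp {V V' : Type*} [AddCommGroup V] [Module A V] [AddCommGroup V']
    [Module A V'] (θ : V ≃ₗ[A] V') (f : Module.End A V) (f' : Module.End A V') (c : Aˣ)
    (h : ∀ v, θ (f v) = (c : A) • f' (θ v)) :
    (LinearMap.range f).map θ.toLinearMap = LinearMap.range f' := by
  ext w
  constructor
  · rintro ⟨_, ⟨v, rfl⟩, rfl⟩
    exact ⟨(c : A) • θ v, by rw [map_smul, ← h]; rfl⟩
  · rintro ⟨w, rfl⟩
    refine ⟨f (((c⁻¹ : Aˣ) : A) • θ.symm w), ⟨_, rfl⟩, (h _).trans ?_⟩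
    rw [map_smul, map_smul, smul_smul, Units.mul_inv, one_smul, θ.apply_symm_apply]

/-- Since the twist commutes with T and S up to the units χ(det α)⁻¹ and χ(det β)⁻¹, it also carries
T - τ and S - σ to unit multiples of T - τ' and S - σ', and ranges do not see the units. -/
theorem map_eigenSub (D : HeckeDatum (inclK p) ρ) (D' : HeckeDatum (inclK p) ρ')
    (hD : D.g = alpha p) (hD' : D'.g = alpha p) (hφ : ∀ m, D'.φ (e m) = e (D.φ m)) (τ σ τ' σ' : A)
    (hτ : τ' = χ (alpha p).det * τ) (hσ : σ' = χ (beta p).det * σ) :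
    (eigenSub p D τ σ).map (twistIndEquiv χ e he).toLinearMap = eigenSub p D' τ' σ' := by
  rw [eigenSub, eigenSub, Submodule.map_sup]
  refine congrArg₂ _ (map_range_of_smul_comp _ _ _ (χ (alpha p).det)⁻¹ fun v => ?_)
    (map_range_of_smul_comp _ _ _ (χ (beta p).det)⁻¹ fun v => ?_)
  · change twistIndEquiv χ e he (cIndT p D v - τ • v) = _ • (cIndT p D' _ - τ' • _)
    rw [map_sub, map_smul, twistIndEquiv_cIndT χ e he D D' hD hD' hφ, smul_sub, smul_smul, hτ,
      Units.inv_mul_cancel_left]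
    rfl
  · change twistIndEquiv χ e he (cIndS p ρ v - σ • v) = _ • (cIndS p ρ' _ - σ' • _)
    rw [map_sub, map_smul, twistIndEquiv_cIndS χ e he, smul_sub, smul_smul, hσ,
      Units.inv_mul_cancel_left]
    rfl

/-- An invertible intertwining map induces an isomorphism on `p`-arithmetic homology. -/
theorem nonempty_pArithHomology_iso (N : ℕ) (U : Subgroup (GL (Fin 2) (FinAdele p)))
    {V V' : Type u} [AddCommGroup V] [Module A V] [AddCommGroup V'] [Module A V']
    (π : Representation A (GL (Fin 2) ℚ_[p]) V) (π' : Representation A (GL (Fin 2) ℚ_[p]) V')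
    (θ : V ≃ₗ[A] V') (hθ : ∀ g v, θ (π g v) = π' g (θ v)) (n : ℕ) :
    Nonempty (pArithHomology N U π n ≅ pArithHomology N U π' n) := by
  let f : π.IntertwiningMap π' :=
    LinearMap.intertwiningMap_of_isIntertwiningMap _ _ θ.toLinearMap hθ
  let g : π'.IntertwiningMap π :=
    LinearMap.intertwiningMap_of_isIntertwiningMap _ _ θ.symm.toLinearMap fun h v =>
      θ.injective (((θ.apply_symm_apply _).trans (congrArg _ (θ.apply_symm_apply v).symm)).trans
        (hθ h _).symm)
  have h₁ : g.comp f = Representation.IntertwiningMap.id π :=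
    Representation.IntertwiningMap.ext (LinearMap.ext θ.symm_apply_apply)
  have h₂ : f.comp g = Representation.IntertwiningMap.id π' :=
    Representation.IntertwiningMap.ext (LinearMap.ext θ.apply_symm_apply)
  refine ⟨(LinearEquiv.ofLinearMap (pArithMap N U f n) (pArithMap N U g n) ?_ ?_).toModuleIso⟩
  · rw [← pArithMap_comp, h₂, pArithMap_id]
  · rw [← pArithMap_comp, h₁, pArithMap_id]

end Twist

section Transport

theorem ConvergesTo.of_iso {𝒪 : Type u} [Ring 𝒪] {E : HomologicalSS (ModuleCat.{u} 𝒪)}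
    {H H' : ℕ → ModuleCat.{u} 𝒪} (h : ConvergesTo E H) (e : ∀ n, Nonempty (H n ≅ H' n)) :
    ConvergesTo E H' := by
  intro n
  obtain ⟨Fil, hmono, h0, htop, hgr⟩ := h n
  obtain ⟨e⟩ := e n
  let θ : H n ≃ₗ[𝒪] H' n := e.toLinearEquiv
  refine ⟨fun i => (Fil i).map θ.toLinearMap, fun i j hij => Submodule.map_mono (hmono hij), ?_, ?_,
    fun i j hij r hr => ?_⟩
  · exact (congrArg (Submodule.map θ.toLinearMap) h0).trans (Submodule.map_bot _)
  · exact (congrArg (Submodule.map θ.toLinearMap) htop).trans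
      ((Submodule.map_top _).trans (LinearEquiv.range θ))
  · obtain ⟨e'⟩ := hgr i j hij r hr
    let θ' : Fil (i + 1) ≃ₗ[𝒪] (Fil (i + 1)).map θ.toLinearMap := θ.submoduleMap (Fil (i + 1))
    refine ⟨e' ≪≫ (Submodule.Quotient.equiv _ _ θ' ?_).toModuleIso⟩
    ext x
    constructor
    · rintro ⟨y, hy, rfl⟩
      exact ⟨y.1, hy, rfl⟩
    · rintro ⟨y, hy, hyx⟩
      exact ⟨⟨y, hmono (Nat.le_succ i) hy⟩, hy, Subtype.ext hyx⟩

end Transport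

/-! ### The spectral sequence of part (2). -/

section Characters

theorem unr_pUnit {p : ℕ} [Fact p.Prime] {k : Type u} [Field k] (b : kˣ) :
    unr p b (pUnit p) = b := by
  change b ^ (p : ℚ_[p]).valuation = b
  rw [Padic.valuation_p, zpow_one]

variable {p : ℕ} [Fact p.Prime] {k : Type u} [Field k] [Algebra (ZMod p) k]

theorem omega_pUnit : omega p k (pUnit p) = 1 := by
  have h : unitPart p (pUnit p) = 1 := by
    apply Subtype.ext
    change (p : ℚ_[p]) * (p : ℚ_[p]) ^ (-(p : ℚ_[p]).valuation) = 1
    rw [Padic.valuation_p, zpow_neg_one, mul_inv_cancel₀]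
    exact Nat.cast_ne_zero.2 (Fact.out : p.Prime).ne_zero
  ext
  change algebraMap (ZMod p) k (PadicInt.toZMod (unitPart p (pUnit p))) = 1
  rw [h, map_one, map_one]

theorem det_alpha : (alpha p).det = pUnit p := by
  ext
  simp [alpha, diagGL]

theorem det_beta : (beta p).det = pUnit p * pUnit p := by
  ext
  simp [beta, diagGL]

theorem weightRep_eq_smul (r : ℕ) (s : ℤ) (x : GL (Fin 2) ℤ_[p]) (f : Weight k r) :
    weightRep p k r s x f = (((omega p k ^ s) (inclK p x).det : kˣ) : k) • weightRep p k r 0 x f := by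
  simp [weightRep]

/-- The spectral sequence converging to the `p`-arithmetic homology of `π(r, λ, ω^a unr_b)`. -/
theorem exists_piRep_spectralSequence (r : ℕ) (hr : r < p) (N : ℕ)
    (U : Subgroup (GL (Fin 2) (FinAdele p))) (l : k) (a : ℤ) (b : kˣ) :
    ∃ E : HomologicalSS (ModuleCat.{u} (FreeAlgebra k (HeckeGen p N))),
      (∀ i j : ℕ, Nonempty ((E.page 2 le_rfl).X (i, j) ≅
        torTerm k N U r (a + r) (l * b) ((b : k) ^ 2) i j)) ∧
        ConvergesTo E fun n => pArithHomology N U (piRep p r l (omega p k ^ a * unr p b)) n := by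
  obtain ⟨E, h₁, h₂⟩ := exists_piTilde_spectralSequence (p := p) (k := k) r (a + r) (l * b) (b ^ 2)
    hr N U
  -- The factor ω^r belongs to the twist in `piRep`. On determinants of K the unramified factor is
  -- trivial, so the twisted weight has s = a + r.
  let χ : ℚ_[p]ˣ →* kˣ := omega p k ^ a * unr p b * omega p k ^ r
  let e : Weight k r ≃ₗ[k] k ⊗[k] Weight k r := (TensorProduct.lid k (Weight k r)).symm
  have hχ : ∀ x : GL (Fin 2) ℤ_[p], χ (inclK p x).det = (omega p k ^ (a + r)) (inclK p x).det := by
    intro x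
    have : unr p b (inclK p x).det = 1 := by
      change b ^ ((inclK p x).det : ℚ_[p]).valuation = 1
      rw [valuation_det_inclK, zpow_zero]
    change (omega p k (inclK p x).det) ^ a * unr p b (inclK p x).det *
      (omega p k (inclK p x).det) ^ r = (omega p k (inclK p x).det) ^ (a + r)
    rw [this, mul_one, zpow_add, zpow_natCast]
  have hχp : χ (pUnit p) = b := by
    change (omega p k (pUnit p)) ^ a * unr p b (pUnit p) * (omega p k (pUnit p)) ^ r = b
    rw [omega_pUnit, unr_pUnit, one_zpow, one_pow, one_mul, mul_one]
  have he : ∀ h m, baseChangeRep k (weightRep p k r (a + r)) h (e m) =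
      ((χ (inclK p h).det : kˣ) : k) • e (weightRep p k r 0 h m) := fun h m => by
    rw [hχ, ← map_smul, ← weightRep_eq_smul]
    rfl
  -- As ω(p) = 1, the values χ(det α) and χ(det β) are b and b², which turn the eigenvalues l and 1
  -- into l b and b².
  have hsub := map_eigenSub χ e he (weightDatum p k r 0) ((weightDatum p k r (a + r)).baseChange k)
    rfl rfl (fun m => rfl) l 1 (l * b) ((b ^ 2 : kˣ) : k) (by rw [det_alpha, hχp, mul_comm])
    (by rw [det_beta, map_mul, hχp, mul_one, sq])
  refine ⟨E, h₁, h₂.of_iso fun n => ?_⟩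
  obtain ⟨i⟩ := nonempty_pArithHomology_iso N U (piRep p r l (omega p k ^ a * unr p b))
    (piTilde p k r (l * b) (b ^ 2) (a + r))
    (Submodule.Quotient.equiv _ _ (twistIndEquiv χ e he) hsub) (fun g v => by
      obtain ⟨v, rfl⟩ := Submodule.Quotient.mk_surjective _ v
      exact congrArg (Submodule.Quotient.mk) (twistIndEquiv_cIndRep χ e he g v)) n
  exact ⟨i.symm⟩

end Characters

end

end PArith

theorem mainTheorem2 (p : ℕ) [Fact p.Prime] (k : Type u) [Field k] [Algebra (ZMod p) k]
    [IsAlgClosure (ZMod p) k] (N : ℕ) (hN : Nat.Coprime N p) (UN : Subgroup (PArith.LevelGL p N))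
    (hopen : IsOpen (UN : Set (PArith.LevelGL p N)))
    (hcompact : IsCompact (UN : Set (PArith.LevelGL p N))) (r : ℕ) (hr : r ≤ p - 1) :
    (∀ (R : Type u) [CommRing R] [Algebra k R] (τ : R) (σ : Rˣ) (s : ℤ),
      ∃ E : PArith.HomologicalSS (ModuleCat.{u} (FreeAlgebra R (PArith.HeckeGen p N))),
        (∀ i j : ℕ, Nonempty ((E.page 2 le_rfl).X (i, j) ≅
          PArith.torTerm k N (PArith.levelSubgroup p N UN) r s τ (σ : R) i j)) ∧
        PArith.ConvergesTo E fun n =>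
          PArith.pArithHomology N (PArith.levelSubgroup p N UN) (PArith.piTilde p k r τ σ s) n) ∧
    (∀ (l : k) (a : ℤ) (b : kˣ),
      ∃ E : PArith.HomologicalSS (ModuleCat.{u} (FreeAlgebra k (PArith.HeckeGen p N))),
        (∀ i j : ℕ, Nonempty ((E.page 2 le_rfl).X (i, j) ≅
          PArith.torTerm k N (PArith.levelSubgroup p N UN) r (a + r) (l * b) ((b : k) ^ 2) i j)) ∧
        PArith.ConvergesTo E fun n =>
          PArith.pArithHomology N (PArith.levelSubgroup p N UN)
            (PArith.piRep p r l (PArith.omega p k ^ a * PArith.unr p b)) n) := by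
  have hp : r < p := hr.trans_lt (Nat.sub_lt (Fact.out : p.Prime).pos one_pos)
  exact ⟨fun R _ _ τ σ s => PArith.exists_piTilde_spectralSequence r s τ σ hp N _,
    fun l a b => PArith.exists_piRep_spectralSequence r hp N _ l a b⟩
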